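/- Write $\mathbb{L}_\mu(u)=\int e^{-ux}\,\mu(dx)=e^{-\psi_\mu(u)}$, $u\ge 0$, for a probability distribution $\mu$ on $[0,\infty)$. A function on $(0,\infty)$ is called completely monotone if it is smooth and its $n$-th derivative multiplied by $(-1)^n$ is nonnegative for every $n\ge 0$. Let $\mathrm{T}$ (generalized gamma convolutions) be the set of probability distributions $\mu$ on $[0,\infty)$ with $$\psi_\mu(u)=au+\int_{(0,\infty)}(1-e^{-ut})\frac{k(t)}{t}\,dt,\qquad u\ge 0, \qquad (*)$$ for some $a\ge 0$ and some completely monotone $k:(0,\infty)\to[0,\infty)$ (the integral being finite). Let $\mathrm{BO}$ (the Goldie–Steutel–Bondesson class) be the set of probability distributions $\mu$ on $[0,\infty)$ satisfying $(*)$ for some $a\ge 0$ and some $k:(0,\infty)\to[0,\infty)$ for which $t\mapsto k(t)/t$ is completely monotone (the integral being finite). A distribution $\mu\in\mathrm{BO}$ is said to have finite Stieltjes measure if $$\psi_\mu(u)=au+\int_{(0,\infty)}\frac{u}{u+x}\,\rho(dx),\qquad u\ge 0,$$ for some $a\ge 0$ and some finite measure $\rho$ on $(0,\infty)$ (in general $\rho$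 is only required to satisfy $\int_{(0,\infty)}(1+x)^{-1}\rho(dx)<\infty$). Let $\mathrm{ID}_{\log}$ be the set of infinitely divisible distributions $\mu$ on $\mathbb{R}$ with $\int\log^+|x|\,\mu(dx)<\infty$. For $\xi_t=t$ let $\Phi_\xi$ be the mapping $$\mathcal{L}(X_1)\longmapsto \mathcal{L}\left(\int_{(0,\infty)}e^{-t}\,dX_t\right),$$ defined for those laws $\mathcal{L}(X_1)$ of subordinators $X=(X_t)_{t\ge0}$ for which the integral converges almost surely. Proposition. For $\xi_t=t$, the mapping $\Phi_\xi$ is defined on all of $\mathrm{BO}\cap\mathrm{ID}_{\log}$ (that is, every law in $\mathrm{BO}\cap\mathrm{ID}_{\log}$ is the law of $X_1$ for some subordinator $X$, and for every such $X$ the integral converges almost surely and its law depends only on $\mathcal{L}(X_1)$), and $$\Phi_\xi(\mathrm{BO}\cap\mathrm{ID}_{\log})=\mathrm{T}.$$ Moreover, the image under $\Phi_\xi$ of the set of distributions in $\mathrm{BO}\cap\mathrm{ID}_{\log}$ with finite Stieltjes measure is exactly the set of $\mu\in\mathrm{T}$ whose function $k$ in $(*)$ satisfies $k(0+)=\lim_{t\downarrow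 0}k(t)<\infty$. -/

import Mathlib

open MeasureTheory ProbabilityTheory Filter Topology Set
open scoped NNReal ENNReal

noncomputable section

namespace ExpFunctional

/-! ### Classes of probability distributions -/

/-- `k : (0,∞) → [0,∞)` is completely monotone: smooth with `(-1)ⁿ k⁽ⁿ⁾ ≥ 0` on `(0,∞)` for every
`n ≥ 0`. (Values of `k` off `(0,∞)` are irrelevant.) -/
def IsCompletelyMonotone (k : ℝ → ℝ) : Prop :=
  ContDiffOn ℝ ((⊤ : ℕ∞) : WithTop ℕ∞) k (Ioi 0) ∧
    ∀ n : ℕ, ∀ t ∈ Ioi (0 : ℝ), 0 ≤ (-1 : ℝ) ^ n * iteratedDerivWithin n k (Ioi 0) t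

/-- `μ` is a probability distribution on `ℝ₊ = [0,∞)`. -/
def IsProbOnNonneg (μ : Measure ℝ) : Prop :=
  IsProbabilityMeasure μ ∧ μ (Iio 0) = 0

/-- The Laplace transform of `μ`. -/
def laplaceTransform (μ : Measure ℝ) (u : ℝ) : ℝ := ∫ x, Real.exp (-(u * x)) ∂μ

/-- `μ` has Laplace exponent `ψ(u) = a u + ∫_{(0,∞)} (1 - e^{-ut}) k(t)/t dt`, `u ≥ 0`, with
`a ≥ 0`, where the integral is finite, i.e. `∫_{(0,∞)} min(1,t) k(t)/t dt` is finite. -/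
def HasLevyDensityForm (μ : Measure ℝ) (a : ℝ) (k : ℝ → ℝ) : Prop :=
  0 ≤ a ∧ IntegrableOn (fun t => min 1 t * (k t / t)) (Ioi 0) ∧
    ∀ u : ℝ, 0 ≤ u → laplaceTransform μ u =
      Real.exp (-(a * u + ∫ t in Ioi (0 : ℝ), (1 - Real.exp (-(u * t))) * (k t / t)))

/-- Thorin's class `T`, the generalized gamma convolutions. -/
def thorinClass : Set (Measure ℝ) :=
  {μ | IsProbOnNonneg μ ∧ ∃ (a : ℝ) (k : ℝ → ℝ), IsCompletelyMonotone k ∧ HasLevyDensityForm μ a k}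

/-- The generalized gamma convolutions for which the limit `k(0+)` is finite. -/
def thorinClassFinite : Set (Measure ℝ) :=
  {μ | IsProbOnNonneg μ ∧ ∃ (a : ℝ) (k : ℝ → ℝ), IsCompletelyMonotone k ∧ HasLevyDensityForm μ a k ∧
    ∃ L : ℝ, Tendsto k (𝓝[>] 0) (𝓝 L)}

/-- The Goldie-Steutel-Bondesson class `BO`. -/
def bondessonClass : Set (Measure ℝ) :=
  {μ | IsProbOnNonneg μ ∧ ∃ (a : ℝ) (k : ℝ → ℝ),
    IsCompletelyMonotone (fun t => k t / t) ∧ HasLevyDensityForm μ a k}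

/-- A Stieltjes measure: a measure `ρ` on `(0,∞)` with `∫_{(0,∞)} (1+x)⁻¹ ρ(dx) < ∞`. -/
def IsStieltjesMeasure (ρ : Measure ℝ) : Prop :=
  ρ (Iic 0) = 0 ∧ ∫⁻ x in Ioi (0 : ℝ), ENNReal.ofReal ((1 + x)⁻¹) ∂ρ < ∞

/-- `μ` has Laplace exponent `ψ(u) = a u + ∫_{(0,∞)} u/(u+x) ρ(dx)`, `u ≥ 0`, with `a ≥ 0` and a
Stieltjes measure `ρ`. -/
def HasStieltjesForm (μ : Measure ℝ) (a : ℝ) (ρ : Measure ℝ) : Prop :=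
  0 ≤ a ∧ IsStieltjesMeasure ρ ∧
    ∀ u : ℝ, 0 ≤ u → laplaceTransform μ u =
      Real.exp (-(a * u + ∫ x in Ioi (0 : ℝ), u / (u + x) ∂ρ))

/-- The distributions in `BO` with finite Stieltjes measure. -/
def bondessonClassFinite : Set (Measure ℝ) :=
  {μ | μ ∈ bondessonClass ∧ ∃ (a : ℝ) (ρ : Measure ℝ), HasStieltjesForm μ a ρ ∧ IsFiniteMeasure ρ}

/-- The `n`-fold convolution power of `ν`. -/
def convPow (ν : Measure ℝ) (n : ℕ) : Measure ℝ :=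
  (fun τ : Measure ℝ => Measure.conv τ ν)^[n] (Measure.dirac 0)

/-- `μ` is infinitely divisible. -/
def IsInfinitelyDivisible (μ : Measure ℝ) : Prop :=
  ∀ n : ℕ, 0 < n → ∃ ν : Measure ℝ, IsProbabilityMeasure ν ∧ convPow ν n = μ

/-- `ID_log`: the infinitely divisible distributions on `ℝ` with finite log-moment. Here
`Real.posLog x = max 0 (log |x|)`. -/
def infDivLog : Set (Measure ℝ) :=
  {μ | IsProbabilityMeasure μ ∧ IsInfinitelyDivisible μ ∧ Integrable (fun x => Real.posLog x) μ}

/-! ### Subordinators and the exponential functional -/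

/-- `X = (X_t)_{t ≥ 0}` is a subordinator under `P`: a Lévy process (started in `0`, independent and
stationary increments, almost surely right-continuous paths) with almost surely nondecreasing
paths. Left limits exist by monotonicity and stochastic continuity follows from right-continuity. -/
structure IsSubordinator {Ω : Type*} [MeasurableSpace Ω] (X : ℝ≥0 → Ω → ℝ) (P : Measure Ω) :
    Prop where
  measurable : ∀ t, Measurable (X t)
  zero : ∀ᵐ ω ∂P, X 0 ω = 0
  indep : HasIndepIncrements X P
  stationary : ∀ s h : ℝ≥0, P.map (fun ω => X (s + h) ω - X s ω) = P.map (X h)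
  paths : ∀ᵐ ω ∂P, Monotone (fun t => X t ω) ∧
    ∀ t, ContinuousWithinAt (fun r => X r ω) (Ici t) t

open Classical in
/-- The Lebesgue-Stieltjes integral `∫_{(0,∞)} e^{-ξ_{s-}} dx_s ∈ [0,∞]` along a path
`x : [0,∞) → ℝ`, for paths that are monotone and right-continuous (an irrelevant value is assigned
to other paths). As the integrand is nonnegative, the improper integral
`lim_{T → ∞} ∫_{(0,T]} e^{-ξ_{s-}} dx_s` converges iff this value is finite. -/
def pathIntegral (ξ x : ℝ≥0 → ℝ) : ℝ≥0∞ :=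
  if h : Monotone x then
    ∫⁻ s in Ioi (0 : ℝ≥0), ENNReal.ofReal (Real.exp (-(Function.leftLim ξ s)))
      ∂h.stieltjesFunction.measure
  else 0

/-- `σ = 𝓛(X₁)` for some subordinator `X` such that `V = ∫_{(0,∞)} e^{-ξ_{s-}} dX_s` converges
almost surely, and `μ = 𝓛(V)`. The process `ξ` is deterministic here, hence independent of `X`. -/
def IsExpFunctionalLaw (ξ : ℝ≥0 → ℝ) (σ μ : Measure ℝ) : Prop :=
  ∃ (Ω : Type) (_ : MeasurableSpace Ω) (P : Measure Ω) (X : ℝ≥0 → Ω → ℝ),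
    IsProbabilityMeasure P ∧ IsSubordinator X P ∧ P.map (X 1) = σ ∧
    (∀ᵐ ω ∂P, pathIntegral ξ (fun t => X t ω) < ∞) ∧
    P.map (fun ω => (pathIntegral ξ (fun t => X t ω)).toReal) = μ

/-- The domain `D_ξ` of `Φ_ξ`. -/
def expDomain (ξ : ℝ≥0 → ℝ) : Set (Measure ℝ) := {σ | ∃ μ, IsExpFunctionalLaw ξ σ μ}

open Classical in
/-- The mapping `Φ_ξ : 𝓛(X₁) ↦ 𝓛(∫_{(0,∞)} e^{-ξ_{s-}} dX_s)` on `D_ξ` (with value `0` off `D_ξ`). -/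
def expMap (ξ : ℝ≥0 → ℝ) (σ : Measure ℝ) : Measure ℝ :=
  if h : ∃ μ, IsExpFunctionalLaw ξ σ μ then h.choose else 0

end ExpFunctional

end

/-! If `X₁` has Laplace exponent `ψ`, then `∫ e^{-s} dX_s` has exponent `Ψ(u) = ∫_0^∞ ψ(u e^{-s})
ds`: on a grid of mesh `h` the integral is a sum of independent scaled increments, whose exponent is
a Riemann sum of `Ψ`. If `ψ` has drift `a` and Lévy density `g`, then the substitution `w = t
e^{-s}` and Tonelli show that `Ψ` has the same drift and Lévy density `K(w)/w` with `K(w) = ∫_w^∞ g`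
(`setLIntegral_levyExponent`). So the mapping acts as `g ↦ K`, with inverse `K ↦ -K'`.

Tails and negative derivatives of completely monotone functions are completely monotone. This gives
the inclusion in `T` (`hasLevyDensityForm_expMap`). Conversely, finiteness of the exponent makes
`k(t)/t` integrable at infinity, so a completely monotone `k` tends to `0` and is the tail of `-k'`
(`exists_bondesson_of_thorin`). The log-moment condition is equivalent to `Ψ(1) < ∞`, because `∫_0^∞
(1 - exp(-x e^{-s})) ds` is comparable to `log⁺ x`, up to an additive constant.

Since `K(0+)` is the total mass of `g`, the last claim says that this mass is finite exactly when
the Stieltjes measure is. If `ρ` is finite, `∫ (1 - e^{-ut}) g(t) dt` stays bounded as `u → ∞` and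
Fatou applies. If `k(0+) < ∞`, Bernstein's theorem gives `k(t) = ∫ e^{-tx} ρ(dx)` with `ρ` finite,
and integration by parts turns the exponent with density `-k'` into `∫ u e^{-us} k(s) ds = ∫ u/(u+x)
ρ(dx)`.

Three classical tools are proved on the way. Laplace transforms determine finite measures on an
orthant, which identifies laws and yields independence. Subordinators are built from Poisson random
measures. Bernstein's theorem follows from Taylor remainders and weak compactness on `[0,∞]`.
Exponents take values in `[0,∞]` throughout, so that Tonelli needs no integrability and divergence
is the value `∞`. -/

noncomputable section

namespace ExpFunctional

/-! ### The function `x ↦ e⁻ˣ` on `[0,∞]` -/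

/-- The decreasing function `x ↦ e⁻ˣ` on `[0,∞]`, with value `0` at `∞`. -/
def expNeg (x : ℝ≥0∞) : ℝ≥0∞ := EReal.exp (-(x : EReal))

@[simp] lemma expNeg_top : expNeg ∞ = 0 := by simp [expNeg]

@[simp] lemma expNeg_zero : expNeg 0 = 1 := by simp [expNeg]

lemma expNeg_ofReal {r : ℝ} (hr : 0 ≤ r) :
    expNeg (ENNReal.ofReal r) = ENNReal.ofReal (Real.exp (-r)) := by
  rw [expNeg, EReal.coe_ennreal_ofReal, max_eq_left hr, ← EReal.coe_neg, EReal.exp_coe]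

lemma expNeg_coe (r : ℝ≥0) : expNeg r = ENNReal.ofReal (Real.exp (-r)) := by
  rw [← ENNReal.ofReal_coe_nnreal, expNeg_ofReal r.coe_nonneg]

lemma expNeg_add (x y : ℝ≥0∞) : expNeg (x + y) = expNeg x * expNeg y := by
  induction x with
  | top => simp
  | coe x =>
    induction y with
    | top => simp
    | coe y =>
      rw [← ENNReal.coe_add, expNeg_coe, expNeg_coe, expNeg_coe,
        ← ENNReal.ofReal_mul (Real.exp_nonneg _), ← Real.exp_add]
      congr 2; push_cast; ring

lemma expNeg_antitone : Antitone expNeg := fun x y h => by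
  unfold expNeg
  exact EReal.exp_monotone (EReal.neg_le_neg_iff.2 (EReal.coe_ennreal_le_coe_ennreal_iff.2 h))

@[fun_prop]
lemma expNeg_continuous : Continuous expNeg := by
  unfold expNeg
  exact EReal.expHomeomorph.continuous.comp (continuous_neg.comp continuous_coe_ennreal_ereal)

@[fun_prop]
lemma expNeg_measurable : Measurable expNeg := expNeg_continuous.measurable

lemma expNeg_le_one (x : ℝ≥0∞) : expNeg x ≤ 1 := by
  simpa using expNeg_antitone (zero_le (a := x))

lemma expNeg_ne_top (x : ℝ≥0∞) : expNeg x ≠ ∞ := ne_top_of_le_ne_top (by simp) (expNeg_le_one x)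

lemma expNeg_sum {ι : Type*} (s : Finset ι) (f : ι → ℝ≥0∞) :
    expNeg (∑ i ∈ s, f i) = ∏ i ∈ s, expNeg (f i) := by
  classical
  induction s using Finset.induction_on with
  | empty => simp
  | insert a s ha ih => rw [Finset.sum_insert ha, Finset.prod_insert ha, expNeg_add, ih]

/-- Continuity of `expNeg` up to `∞` lets an infinite sum of independent terms be handled through
finite products, whether or not it converges. -/
lemma tendsto_expNeg_tsum (f : ℕ → ℝ≥0∞) :
    Tendsto (fun n => ∏ i ∈ Finset.range n, expNeg (f i)) atTop (𝓝 (expNeg (∑' i, f i))) := by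
  simp_rw [← expNeg_sum]
  exact (expNeg_continuous.tendsto _).comp (ENNReal.tendsto_nat_tsum f)

lemma expNeg_strictAnti : StrictAnti expNeg := fun x y h => by
  unfold expNeg
  exact EReal.exp_strictMono (EReal.neg_lt_neg_iff.2 (EReal.coe_ennreal_lt_coe_ennreal_iff.2 h))

lemma expNeg_pos {x : ℝ≥0∞} (hx : x ≠ ∞) : 0 < expNeg x := by
  simpa using expNeg_strictAnti hx.lt_top

/-! ### Uniqueness of the Laplace transform -/

section Uniqueness

variable {ι : Type*} [Fintype ι]

open BoundedContinuousFunction in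
/-- The bounded continuous function `x ↦ exp (-∑ uᵢ xᵢ)` on the nonnegative orthant. -/
def expNegInner (u : ι → ℝ≥0) : (ι → ℝ≥0) →ᵇ ℝ :=
  BoundedContinuousFunction.ofNormedAddCommGroup
    (fun x => Real.exp (-∑ i, (u i : ℝ) * x i)) (by fun_prop) 1 (fun x => by
      rw [Real.norm_of_nonneg (Real.exp_nonneg _), Real.exp_le_one_iff, neg_nonpos]
      positivity)

lemma expNegInner_apply (u x : ι → ℝ≥0) :
    expNegInner u x = Real.exp (-∑ i, (u i : ℝ) * x i) := rfl

/-- The functions `expNegInner u` form a submonoid. -/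
def expNegInnerSubmonoid (ι : Type*) [Fintype ι] :
    Submonoid (BoundedContinuousFunction (ι → ℝ≥0) ℝ) where
  carrier := range expNegInner
  one_mem' := ⟨0, by ext x; simp [expNegInner_apply]⟩
  mul_mem' := by
    rintro _ _ ⟨u, rfl⟩ ⟨v, rfl⟩
    refine ⟨u + v, ?_⟩
    ext x
    simp only [expNegInner_apply, BoundedContinuousFunction.coe_mul, Pi.mul_apply, Pi.add_apply,
      NNReal.coe_add, ← Real.exp_add, add_mul, Finset.sum_add_distrib]
    congr 1; ring

/-- The star subalgebra spanned by the functions `expNegInner u`. -/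
def expNegInnerSubalgebra (ι : Type*) [Fintype ι] :
    StarSubalgebra ℝ (BoundedContinuousFunction (ι → ℝ≥0) ℝ) where
  toSubalgebra := Algebra.adjoin ℝ (expNegInnerSubmonoid ι : Set _)
  star_mem' := by
    intro a ha
    have : star a = a := by ext x; simp
    rwa [this]

/-- A point-separating subalgebra of bounded continuous functions determines finite measures. The
exponentials separate points already through the coordinate functions `e^{-xᵢ}`. -/
lemma measure_ext_of_integral_expNegInner {P Q : Measure (ι → ℝ≥0)} [IsFiniteMeasure P]
    [IsFiniteMeasure Q]
    (h : ∀ u : ι → ℝ≥0, ∫ x, expNegInner u x ∂P = ∫ x, expNegInner u x ∂Q) : P = Q := by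
  classical
  refine ext_of_forall_mem_subalgebra_integral_eq_of_pseudoEMetric_complete_countable
    (𝕜 := ℝ) (A := expNegInnerSubalgebra ι) ?_ ?_
  · intro x y hxy
    obtain ⟨i, hi⟩ := Function.ne_iff.1 hxy
    refine ⟨_, ⟨_, ⟨expNegInner (Pi.single i 1), ?_, rfl⟩, rfl⟩, ?_⟩
    · exact Algebra.subset_adjoin ⟨_, rfl⟩
    · have h1 : ∀ z : ι → ℝ≥0, expNegInner (Pi.single i 1) z = Real.exp (-(z i : ℝ)) := by
        intro z
        rw [expNegInner_apply, Finset.sum_eq_single i]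
        · simp
        · intro j _ hj; simp [Pi.single_eq_of_ne hj]
        · simp
      intro h
      replace h : expNegInner (Pi.single i 1) x = expNegInner (Pi.single i 1) y := h
      rw [h1, h1] at h
      apply hi
      have := Real.exp_injective h
      exact_mod_cast neg_injective this
  · intro g hg
    -- The exponentials are closed under products, so the algebra they generate is their linear span
    -- and the equality of integrals extends by linearity.
    have hg' : g ∈ Submodule.span ℝ (expNegInnerSubmonoid ι : Set _) := by
      rw [← Algebra.adjoin_eq_span_of_subset _ (by
        intro f hf
        rw [Submonoid.closure_eq] at hf
        exact Submodule.subset_span hf)]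
      exact hg
    induction hg' using Submodule.span_induction with
    | mem x hx => obtain ⟨u, rfl⟩ := hx; exact h u
    | zero => simp
    | add f g hf hg' ihf ihg =>
      have hf2 : f ∈ expNegInnerSubalgebra ι := Algebra.span_le_adjoin _ _ hf
      have hg2 : g ∈ expNegInnerSubalgebra ι := Algebra.span_le_adjoin _ _ hg'
      simp only [BoundedContinuousFunction.coe_add, Pi.add_apply]
      rw [integral_add (f.integrable P) (g.integrable P),
        integral_add (f.integrable Q) (g.integrable Q), ihf hf2, ihg hg2]
    | smul c f hf ihf =>
      have hf2 : f ∈ expNegInnerSubalgebra ι := Algebra.span_le_adjoin _ _ hf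
      simp only [BoundedContinuousFunction.coe_smul, smul_eq_mul]
      rw [integral_const_mul, integral_const_mul, ihf hf2]

/-- A finite measure on the nonnegative orthant is determined by its Laplace transform. -/
lemma measure_ext_of_lintegral_expNeg {P Q : Measure (ι → ℝ≥0)} [IsFiniteMeasure P]
    [IsFiniteMeasure Q]
    (h : ∀ u : ι → ℝ≥0, ∫⁻ x, expNeg (∑ i, (u i : ℝ≥0∞) * x i) ∂P
      = ∫⁻ x, expNeg (∑ i, (u i : ℝ≥0∞) * x i) ∂Q) : P = Q := by
  refine measure_ext_of_integral_expNegInner fun u => ?_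
  have key : ∀ x : ι → ℝ≥0, ENNReal.ofReal (expNegInner u x)
      = expNeg (∑ i, (u i : ℝ≥0∞) * x i) := by
    intro x
    have : (∑ i, (u i : ℝ≥0∞) * x i) = ((∑ i, u i * x i : ℝ≥0) : ℝ≥0∞) := by push_cast; rfl
    rw [this, expNeg_coe, expNegInner_apply]
    push_cast; rfl
  have hnn : ∀ x, 0 ≤ expNegInner u x := fun x => Real.exp_nonneg _
  rw [integral_eq_lintegral_of_nonneg_ae (ae_of_all _ hnn)
    (expNegInner u).continuous.aestronglyMeasurable,
    integral_eq_lintegral_of_nonneg_ae (ae_of_all _ hnn)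
    (expNegInner u).continuous.aestronglyMeasurable]
  simp_rw [key, h u]

/-- Nonnegative random variables whose joint Laplace transform factorizes are independent. -/
lemma iIndepFun_of_lintegral_expNeg {Ω : Type*} [MeasurableSpace Ω] {P : Measure Ω}
    [IsProbabilityMeasure P] {D : ι → Ω → ℝ≥0} (hD : ∀ i, Measurable (D i))
    (h : ∀ u : ι → ℝ≥0, ∫⁻ ω, expNeg (∑ i, (u i : ℝ≥0∞) * D i ω) ∂P
      = ∏ i, ∫⁻ ω, expNeg ((u i : ℝ≥0∞) * D i ω) ∂P) : iIndepFun D P := by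
  rw [iIndepFun_iff_map_fun_eq_pi_map fun i => (hD i).aemeasurable]
  have : ∀ i, IsProbabilityMeasure (P.map (D i)) := fun i =>
    Measure.isProbabilityMeasure_map (hD i).aemeasurable
  have : IsProbabilityMeasure (P.map fun ω i => D i ω) :=
    Measure.isProbabilityMeasure_map (measurable_pi_lambda _ hD).aemeasurable
  refine measure_ext_of_lintegral_expNeg fun u => ?_
  rw [lintegral_map (by fun_prop) (by fun_prop), h u]
  simp_rw [expNeg_sum]
  rw [lintegral_prod_eq_prod_lintegral_of_indepFun Finset.univ
    (fun i (x : ι → ℝ≥0) => expNeg (u i * x i))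
    (iIndepFun_pi (X := fun i (x : ℝ≥0) => expNeg (u i * x))
      fun i => Measurable.aemeasurable (by fun_prop)) (fun i => by fun_prop)]
  refine Finset.prod_congr rfl fun i _ => ?_
  have := (measurePreserving_eval (fun i => P.map (D i)) i).lintegral_comp
    (f := fun x : ℝ≥0 => expNeg (u i * x)) (by fun_prop)
  rw [this, lintegral_map (by fun_prop) (hD i)]

end Uniqueness

/-! ### Laplace transforms of distributions on `[0,∞)` -/

lemma IsProbOnNonneg.ae_nonneg {μ : Measure ℝ} (h : IsProbOnNonneg μ) : ∀ᵐ x ∂μ, 0 ≤ x := by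
  rw [ae_iff]
  convert h.2 using 2
  ext x; simp

/-- This passes from the Bochner integral of the definitions to the `[0,∞]`-valued integral used in
all later computations. -/
lemma ofReal_laplaceTransform {μ : Measure ℝ} (h : IsProbOnNonneg μ) {u : ℝ} (hu : 0 ≤ u) :
    ENNReal.ofReal (laplaceTransform μ u) = ∫⁻ x, expNeg (ENNReal.ofReal (u * x)) ∂μ := by
  have := h.1
  rw [laplaceTransform, ofReal_integral_eq_lintegral_ofReal]
  · refine lintegral_congr_ae ?_
    filter_upwards [h.ae_nonneg] with x hx
    rw [expNeg_ofReal (mul_nonneg hu hx)]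
  · refine Integrable.of_bound (C := 1) (by fun_prop) ?_
    filter_upwards [h.ae_nonneg] with x hx
    rw [Real.norm_of_nonneg (Real.exp_nonneg _), Real.exp_le_one_iff, neg_nonpos]
    positivity
  · exact ae_of_all _ fun x => Real.exp_nonneg _

/-- A distribution on `[0,∞)` is determined by its Laplace transform. -/
lemma IsProbOnNonneg.ext {μ ν : Measure ℝ} (hμ : IsProbOnNonneg μ) (hν : IsProbOnNonneg ν)
    (h : ∀ u : ℝ, 0 ≤ u → ∫⁻ x, expNeg (ENNReal.ofReal (u * x)) ∂μ
      = ∫⁻ x, expNeg (ENNReal.ofReal (u * x)) ∂ν) : μ = ν := by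
  have := hμ.1
  have := hν.1
  -- The one-dimensional orthant suffices. Truncation at `0` loses nothing because neither measure
  -- charges the negative half line.
  set T : ℝ → (Unit → ℝ≥0) := fun x _ => x.toNNReal with hT
  have hTm : Measurable T := by fun_prop
  have hback : ∀ {μ : Measure ℝ}, IsProbOnNonneg μ →
      (μ.map T).map (fun y => ((y ()) : ℝ)) = μ := by
    intro μ hμ
    rw [Measure.map_map (by fun_prop) hTm]
    conv_rhs => rw [← Measure.map_id (μ := μ)]
    refine Measure.map_congr ?_
    filter_upwards [hμ.ae_nonneg] with x hx
    simp [hT, hx]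
  rw [← hback hμ, ← hback hν]
  congr 1
  have := Measure.isProbabilityMeasure_map (μ := μ) hTm.aemeasurable
  have := Measure.isProbabilityMeasure_map (μ := ν) hTm.aemeasurable
  refine measure_ext_of_lintegral_expNeg fun u => ?_
  rw [lintegral_map (by fun_prop) hTm, lintegral_map (by fun_prop) hTm]
  have key : ∀ x : ℝ, expNeg (∑ i, (u i : ℝ≥0∞) * (T x i : ℝ≥0∞))
      = expNeg (ENNReal.ofReal ((u () : ℝ) * x)) := by
    intro x
    rw [ENNReal.ofReal_mul (u ()).coe_nonneg]
    simp [hT, ENNReal.ofReal]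
  simp_rw [key]
  exact h _ (u ()).coe_nonneg

/-! ### Poisson random measures -/

section PoissonRandomMeasure

variable {E : Type*} [MeasurableSpace E]

/-- This splits a finite intensity into a Poisson rate and a law of locations. For the zero measure
the rate is `0` and the location law is arbitrary. -/
lemma exists_probability_smul_eq [Nonempty E] (m : Measure E) [IsFiniteMeasure m] :
    ∃ p : Measure E, IsProbabilityMeasure p ∧ m univ • p = m := by
  by_cases h : m = 0
  · exact ⟨Measure.dirac (Classical.arbitrary E), inferInstance, by simp [h]⟩
  · have : NeZero m := ⟨h⟩
    refine ⟨(m univ)⁻¹ • m, inferInstance, ?_⟩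
    rw [smul_smul, ENNReal.mul_inv_cancel (by simpa using h) (measure_ne_top _ _), one_smul]

lemma lintegral_poissonMeasure_pow (r : ℝ≥0) {q : ℝ≥0∞} (hq : q ≤ 1) :
    ∫⁻ n, q ^ n ∂(poissonMeasure r) = expNeg (r * (1 - q)) := by
  lift q to ℝ≥0 using ne_top_of_le_ne_top (by simp) hq
  have hq' : q ≤ 1 := by exact_mod_cast hq
  rw [lintegral_countable']
  have h1 : ∀ n : ℕ, (q : ℝ≥0∞) ^ n * poissonMeasure r {n}
      = ENNReal.ofReal (Real.exp (-r) * ((r * q : ℝ) ^ n / n.factorial)) := by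
    intro n
    rw [poissonMeasure_singleton, ← ENNReal.ofReal_coe_nnreal,
      ← ENNReal.ofReal_pow q.coe_nonneg, ← ENNReal.ofReal_mul (by positivity)]
    congr 1
    rw [mul_pow]; ring
  simp_rw [h1]
  have h2 : HasSum (fun n : ℕ => Real.exp (-r) * ((r * q : ℝ) ^ n / n.factorial))
      (Real.exp (-r) * Real.exp (r * q)) := by
    refine HasSum.mul_left _ ?_
    rw [Real.exp_eq_exp_ℝ]
    exact NormedSpace.expSeries_div_hasSum_exp (r * q : ℝ)
  rw [← ENNReal.ofReal_tsum_of_nonneg (fun n => by positivity) h2.summable, h2.tsum_eq,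
    ← Real.exp_add]
  have h3 : (r : ℝ≥0∞) * (1 - q) = ((r * (1 - q) : ℝ≥0) : ℝ≥0∞) := by push_cast; rfl
  rw [h3, expNeg_coe]
  congr 2
  push_cast [NNReal.coe_sub hq']
  ring

/-- The law of a Poisson number of points together with an i.i.d. sequence of locations. -/
def compoundLaw (r : ℝ≥0) (p : Measure E) [IsProbabilityMeasure p] : Measure (ℕ × (ℕ → E)) :=
  (poissonMeasure r).prod (Measure.infinitePi fun _ => p)

instance (r : ℝ≥0) (p : Measure E) [IsProbabilityMeasure p] :
    IsProbabilityMeasure (compoundLaw r p) := by unfold compoundLaw; infer_instance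

/-- The sum of `f` over the first `N` points of a sequence. -/
def pointSum (f : E → ℝ≥0∞) (ω : ℕ × (ℕ → E)) : ℝ≥0∞ := ∑' i, if i < ω.1 then f (ω.2 i) else 0

@[fun_prop]
lemma measurable_pointSum {f : E → ℝ≥0∞} (hf : Measurable f) : Measurable (pointSum f) := by
  refine Measurable.tsum fun i => ?_
  refine Measurable.ite ?_ (by fun_prop) measurable_const
  exact measurableSet_lt measurable_const measurable_fst

omit [MeasurableSpace E] in
lemma pointSum_eq_sum (f : E → ℝ≥0∞) (ω : ℕ × (ℕ → E)) :
    pointSum f ω = ∑ i ∈ Finset.range ω.1, f (ω.2 i) := by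
  rw [pointSum, tsum_eq_sum (s := Finset.range ω.1)]
  · exact Finset.sum_congr rfl fun i hi => if_pos (Finset.mem_range.1 hi)
  · exact fun i hi => if_neg (by simpa using hi)

/-- Given `n` points the integral is `qⁿ` with `q = ∫ e^{-f} dp`. The Poisson generating function
then gives `e^{-r(1-q)}`. -/
lemma lintegral_expNeg_pointSum (r : ℝ≥0) (p : Measure E) [IsProbabilityMeasure p]
    {f : E → ℝ≥0∞} (hf : Measurable f) :
    ∫⁻ ω, expNeg (pointSum f ω) ∂(compoundLaw r p)
      = expNeg (∫⁻ x, (1 - expNeg (f x)) ∂((r : ℝ≥0∞) • p)) := by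
  rw [compoundLaw, lintegral_prod _ (by fun_prop)]
  have h1 : ∀ n : ℕ, ∫⁻ z, expNeg (pointSum f (n, z)) ∂(Measure.infinitePi fun _ => p)
      = (∫⁻ x, expNeg (f x) ∂p) ^ n := by
    intro n
    simp_rw [pointSum_eq_sum, expNeg_sum]
    rw [lintegral_prod_eq_prod_lintegral_of_indepFun (Finset.range n)
      (fun i (z : ℕ → E) => expNeg (f (z i)))
      (iIndepFun_infinitePi (P := fun _ : ℕ => p) (X := fun i x => expNeg (f x))
        fun i => by fun_prop) (fun i => by fun_prop)]
    rw [Finset.prod_congr rfl (g := fun _ => ∫⁻ x, expNeg (f x) ∂p), Finset.prod_const,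
      Finset.card_range]
    intro i _
    exact (measurePreserving_eval_infinitePi (fun _ : ℕ => p) i).lintegral_comp
      (f := fun x => expNeg (f x)) (by fun_prop)
  simp_rw [h1]
  have hle : ∫⁻ x, expNeg (f x) ∂p ≤ 1 := by
    calc ∫⁻ x, expNeg (f x) ∂p ≤ ∫⁻ _, 1 ∂p := lintegral_mono fun x => expNeg_le_one _
      _ = 1 := by simp
  rw [lintegral_poissonMeasure_pow r hle, lintegral_smul_measure,
    lintegral_sub (by fun_prop) (ne_top_of_le_ne_top (by simp) hle)
      (ae_of_all _ fun x => expNeg_le_one _)]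
  simp

/-- The random measure with a Dirac mass at each point of each component. -/
def pointMeasure (ω : ℕ → ℕ × (ℕ → E)) : Measure E :=
  Measure.sum fun n => Measure.sum fun i =>
    (if i < (ω n).1 then (1 : ℝ≥0∞) else 0) • Measure.dirac ((ω n).2 i)

lemma lintegral_pointMeasure {f : E → ℝ≥0∞} (hf : Measurable f) (ω : ℕ → ℕ × (ℕ → E)) :
    ∫⁻ x, f x ∂(pointMeasure ω) = ∑' n, pointSum f (ω n) := by
  rw [pointMeasure, lintegral_sum_measure]
  congr 1; ext n
  rw [lintegral_sum_measure, pointSum]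
  congr 1; ext i
  rw [lintegral_smul_measure, lintegral_dirac' _ hf]
  split_ifs <;> simp

end PoissonRandomMeasure

/-- Existence of a Poisson random measure with a given s-finite intensity, characterized by its
Laplace functional. -/
theorem exists_poissonRandomMeasure {E : Type} [MeasurableSpace E] [Nonempty E] (ν : Measure E)
    [SFinite ν] : ∃ (Ω : Type) (_ : MeasurableSpace Ω) (P : Measure Ω) (M : Ω → Measure E),
      IsProbabilityMeasure P ∧
      (∀ f : E → ℝ≥0∞, Measurable f → Measurable fun ω => ∫⁻ x, f x ∂(M ω)) ∧
      ∀ f : E → ℝ≥0∞, Measurable f → ∫⁻ ω, expNeg (∫⁻ x, f x ∂(M ω)) ∂P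
        = expNeg (∫⁻ x, (1 - expNeg (f x)) ∂ν) := by
  choose p hp hpm using fun n => exists_probability_smul_eq (sfiniteSeq ν n)
  set r : ℕ → ℝ≥0 := fun n => (sfiniteSeq ν n univ).toNNReal with hr
  have hrm : ∀ n, ((r n : ℝ≥0∞) • p n) = sfiniteSeq ν n := fun n => by
    rw [hr, ENNReal.coe_toNNReal (measure_ne_top _ _), hpm n]
  refine ⟨ℕ → ℕ × (ℕ → E), inferInstance, Measure.infinitePi fun n => compoundLaw (r n) (p n),
    pointMeasure, inferInstance, fun f hf => ?_, fun f hf => ?_⟩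
  · simp_rw [lintegral_pointMeasure hf]
    fun_prop
  · simp_rw [lintegral_pointMeasure hf]
    set Q := Measure.infinitePi fun n => compoundLaw (r n) (p n)
    -- An s-finite intensity is a countable sum of finite ones. The corresponding independent
    -- components are superposed, so the Laplace functional is an infinite product.
    have h1 : Tendsto (fun n => ∫⁻ ω, ∏ k ∈ Finset.range n, expNeg (pointSum f (ω k)) ∂Q) atTop
        (𝓝 (∫⁻ ω, expNeg (∑' n, pointSum f (ω n)) ∂Q)) := by
      refine tendsto_lintegral_of_dominated_convergence (fun _ => 1) (fun n => by fun_prop)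
        (fun n => ae_of_all _ fun ω => ?_) (by simp)
        (ae_of_all _ fun ω => tendsto_expNeg_tsum _)
      exact Finset.prod_le_one' fun k _ => expNeg_le_one _
    have h2 : ∀ n, ∫⁻ ω, ∏ k ∈ Finset.range n, expNeg (pointSum f (ω k)) ∂Q
        = ∏ k ∈ Finset.range n, expNeg (∫⁻ x, (1 - expNeg (f x)) ∂(sfiniteSeq ν k)) := by
      intro n
      rw [lintegral_prod_eq_prod_lintegral_of_indepFun (Finset.range n)
        (fun k (ω : ℕ → ℕ × (ℕ → E)) => expNeg (pointSum f (ω k)))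
        (iIndepFun_infinitePi (P := fun n => compoundLaw (r n) (p n))
          (X := fun i x => expNeg (pointSum f x)) fun i => by fun_prop) (fun i => by fun_prop)]
      refine Finset.prod_congr rfl fun k _ => ?_
      rw [← hrm k, ← lintegral_expNeg_pointSum (r k) (p k) hf]
      exact (measurePreserving_eval_infinitePi (fun n => compoundLaw (r n) (p n)) k).lintegral_comp
        (f := fun x => expNeg (pointSum f x)) (by fun_prop)
    simp_rw [h2] at h1
    refine tendsto_nhds_unique h1 ?_
    conv in ∫⁻ x, (1 - expNeg (f x)) ∂ν => rw [← sum_sfiniteSeq ν]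
    rw [lintegral_sum_measure]
    exact tendsto_expNeg_tsum _

/-! ### Construction of subordinators -/

/-- A variable whose Laplace transform tends to the total mass along some sequence is almost
everywhere finite. -/
lemma ae_lt_top_of_tendsto_lintegral_expNeg {Ω : Type*} [MeasurableSpace Ω] {P : Measure Ω}
    [IsFiniteMeasure P] {V : Ω → ℝ≥0∞} (hV : AEMeasurable V P) {u : ℕ → ℝ≥0∞}
    (hu : ∀ n, u n ≠ 0)
    (h : Tendsto (fun n => ∫⁻ ω, expNeg (u n * V ω) ∂P) atTop (𝓝 (P univ))) : ∀ᵐ ω ∂P, V ω < ∞ := by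
  obtain ⟨V', hV', hVV'⟩ := hV
  suffices ∀ᵐ ω ∂P, V' ω < ∞ by
    filter_upwards [this, hVV'] with ω h1 h2
    rwa [h2]
  have hm : MeasurableSet {ω | V' ω < ∞} := measurableSet_lt hV' measurable_const
  -- Because `u n ≠ 0`, the integrand vanishes where `V = ∞`, so the Laplace transform is at most
  -- the measure of `{V < ∞}`.
  have hle : ∀ n, ∫⁻ ω, expNeg (u n * V ω) ∂P ≤ P {ω | V' ω < ∞} := by
    intro n
    calc ∫⁻ ω, expNeg (u n * V ω) ∂P ≤ ∫⁻ ω, {ω | V' ω < ∞}.indicator 1 ω ∂P := by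
          refine lintegral_mono_ae ?_
          filter_upwards [hVV'] with ω hω
          by_cases hf : V' ω < ∞
          · rw [indicator_of_mem (by exact hf)]
            exact expNeg_le_one _
          · rw [hω, not_lt_top_iff.1 hf, ENNReal.mul_top (hu n)]
            simp
      _ = P {ω | V' ω < ∞} := lintegral_indicator_one hm
  have h1 : P {ω | V' ω < ∞} = P univ :=
    le_antisymm (measure_mono (subset_univ _)) (le_of_tendsto' h hle)
  exact ae_iff.2 ((measure_compl hm (measure_ne_top _ _)).trans (by rw [h1, tsub_self]))

/-- `∫ (1 - e^{-uy}) Λ(dy)`. -/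
def jumpExponent (Λ : Measure ℝ) (u : ℝ≥0∞) : ℝ≥0∞ :=
  ∫⁻ y, (1 - expNeg (u * ENNReal.ofReal y)) ∂Λ

/-- Dominated convergence, with the integrand at `u = 1` as the bound. -/
lemma tendsto_jumpExponent {Λ : Measure ℝ} (h : jumpExponent Λ 1 ≠ ∞) :
    Tendsto (fun n : ℕ => jumpExponent Λ ((n : ℝ≥0∞) + 1)⁻¹) atTop (𝓝 0) := by
  have h0 : (0 : ℝ≥0∞) = ∫⁻ _, 0 ∂Λ := by simp
  rw [h0]
  refine tendsto_lintegral_of_dominated_convergence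
    (fun y => 1 - expNeg (1 * ENNReal.ofReal y)) (fun n => by fun_prop) (fun n => ?_) h ?_
  · refine ae_of_all _ fun y => ?_
    refine tsub_le_tsub_left (expNeg_antitone ?_) _
    gcongr
    simp
  · refine ae_of_all _ fun y => ?_
    have h1 : Tendsto (fun n : ℕ => ((n : ℝ≥0∞) + 1)⁻¹) atTop (𝓝 0) := by
      have := (ENNReal.tendsto_inv_nat_nhds_zero).comp (tendsto_add_atTop_nat 1)
      simpa [Function.comp_def] using this
    have h2 : Tendsto (fun n : ℕ => expNeg (((n : ℝ≥0∞) + 1)⁻¹ * ENNReal.ofReal y)) atTop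
        (𝓝 1) := by
      have h3 := ENNReal.Tendsto.mul_const (b := ENNReal.ofReal y) h1 (Or.inr (by simp))
      simpa [Function.comp_def] using (expNeg_continuous.tendsto _).comp h3
    simpa using ENNReal.Tendsto.sub (tendsto_const_nhds (x := (1 : ℝ≥0∞))) h2 (by simp)

/-- The total size of the points of the random measure lying above a set of times. -/
def jumpMeasure (M : Measure (ℝ × ℝ)) : Measure ℝ :=
  (M.withDensity fun z => ENNReal.ofReal z.2).map Prod.fst

lemma jumpMeasure_apply (M : Measure (ℝ × ℝ)) {A : Set ℝ} (hA : MeasurableSet A) :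
    jumpMeasure M A = ∫⁻ z, A.indicator 1 z.1 * ENNReal.ofReal z.2 ∂M := by
  rw [jumpMeasure, Measure.map_apply measurable_fst hA,
    withDensity_apply _ (measurable_fst hA), ← lintegral_indicator (measurable_fst hA)]
  congr 1; ext z
  by_cases hz : z.1 ∈ A
  · simp [indicator, hz]
  · simp [indicator, hz]

/-- At most one summand is nonzero at a given time. This additivity makes the masses above disjoint
time sets independent. -/
lemma one_sub_expNeg_sum_indicator {ι : Type*} [Fintype ι] {A : ι → Set ℝ}
    (hA : Pairwise (Function.onFun Disjoint A)) (c : ι → ℝ≥0∞) (s : ℝ) :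
    1 - expNeg (∑ i, c i * (A i).indicator 1 s)
      = ∑ i, (A i).indicator 1 s * (1 - expNeg (c i)) := by
  by_cases h : ∃ i, s ∈ A i
  · obtain ⟨i, hi⟩ := h
    have hj : ∀ j, j ≠ i → (A j).indicator (1 : ℝ → ℝ≥0∞) s = 0 := fun j hj =>
      indicator_of_notMem (fun hsj => (Set.disjoint_left.1 (hA hj) hsj hi)) _
    rw [Finset.sum_eq_single i, Finset.sum_eq_single i]
    · simp [hi]
    · intro j _ h; simp [hj j h]
    · simp
    · intro j _ h; simp [hj j h]
    · simp
  · push Not at h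
    simp [indicator, h]

/-- This is the Laplace functional at `f(s,y) = ∑ uᵢ y 1_{Aᵢ}(s)`. The product form encodes
independence over disjoint time sets, and dependence on the length of `Aᵢ` alone encodes
stationarity. -/
lemma lintegral_expNeg_jumpMeasure {Ω : Type*} [MeasurableSpace Ω] {P : Measure Ω}
    {Λ : Measure ℝ} [SFinite Λ] {M : Ω → Measure (ℝ × ℝ)}
    (hM : ∀ f : ℝ × ℝ → ℝ≥0∞, Measurable f → ∫⁻ ω, expNeg (∫⁻ x, f x ∂(M ω)) ∂P
        = expNeg (∫⁻ x, (1 - expNeg (f x)) ∂((volume : Measure ℝ).prod Λ)))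
    {ι : Type*} [Fintype ι] {A : ι → Set ℝ} (hAm : ∀ i, MeasurableSet (A i))
    (hA : Pairwise (Function.onFun Disjoint A)) (u : ι → ℝ≥0∞) :
    ∫⁻ ω, expNeg (∑ i, u i * jumpMeasure (M ω) (A i)) ∂P
      = ∏ i, expNeg (volume (A i) * jumpExponent Λ (u i)) := by
  have hind : ∀ i, Measurable ((A i).indicator (1 : ℝ → ℝ≥0∞)) := fun i =>
    measurable_one.indicator (hAm i)
  have h1 : ∀ ω, ∑ i, u i * jumpMeasure (M ω) (A i)
      = ∫⁻ z, ∑ i, (u i * ENNReal.ofReal z.2) * (A i).indicator 1 z.1 ∂(M ω) := by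
    intro ω
    rw [lintegral_finsetSum _ fun i _ => by fun_prop]
    refine Finset.sum_congr rfl fun i _ => ?_
    rw [jumpMeasure_apply _ (hAm i), ← lintegral_const_mul _ (by fun_prop)]
    congr 1; ext z; ring
  simp_rw [h1]
  rw [hM _ (by fun_prop)]
  simp_rw [one_sub_expNeg_sum_indicator hA]
  rw [lintegral_finsetSum _ fun i _ => by fun_prop, expNeg_sum]
  refine Finset.prod_congr rfl fun i _ => ?_
  rw [lintegral_prod_mul (f := (A i).indicator 1)
    (g := fun y => 1 - expNeg (u i * ENNReal.ofReal y)) (by fun_prop) (by fun_prop),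
    lintegral_indicator_one (hAm i), jumpExponent]

lemma lintegral_expNeg_jumpMeasure_single {Ω : Type*} [MeasurableSpace Ω] {P : Measure Ω}
    {Λ : Measure ℝ} [SFinite Λ] {M : Ω → Measure (ℝ × ℝ)}
    (hM : ∀ f : ℝ × ℝ → ℝ≥0∞, Measurable f → ∫⁻ ω, expNeg (∫⁻ x, f x ∂(M ω)) ∂P
        = expNeg (∫⁻ x, (1 - expNeg (f x)) ∂((volume : Measure ℝ).prod Λ)))
    {A : Set ℝ} (hAm : MeasurableSet A) (u : ℝ≥0∞) :
    ∫⁻ ω, expNeg (u * jumpMeasure (M ω) A) ∂P = expNeg (volume A * jumpExponent Λ u) := by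
  simpa using lintegral_expNeg_jumpMeasure hM (ι := Unit) (A := fun _ => A) (fun _ => hAm)
    (fun i j h => absurd (Subsingleton.elim i j) h) (fun _ => u)

/-- Continuity from above of the measure along `(0,r] ↓ (0,t]`, which requires finiteness on bounded
intervals. -/
lemma tendsto_jumpMeasure_Ioc {J : Measure ℝ} (hJ : ∀ n : ℕ, J (Ioc 0 n) < ∞) (t : ℝ≥0) :
    ContinuousWithinAt (fun r : ℝ≥0 => (J (Ioc 0 (r : ℝ))).toReal) (Ici t) t := by
  have hfin : ∀ r : ℝ, J (Ioc 0 r) ≠ ∞ := fun r => by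
    obtain ⟨n, hn⟩ := exists_nat_ge r
    exact ((measure_mono (Ioc_subset_Ioc_right hn)).trans_lt (hJ n)).ne
  rw [← continuousWithinAt_Ioi_iff_Ici]
  have h := tendsto_measure_biInter_gt (μ := J) (s := fun r : ℝ≥0 => Ioc (0 : ℝ) r) (a := t)
    (fun r _ => measurableSet_Ioc.nullMeasurableSet)
    (fun i j _ hij => Ioc_subset_Ioc_right (by exact_mod_cast hij))
    ⟨t + 1, lt_add_one t, hfin _⟩
  have hInter : (⋂ r > t, Ioc (0 : ℝ) (r : ℝ≥0)) = Ioc (0 : ℝ) t := by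
    ext x
    simp only [mem_iInter, mem_Ioc]
    constructor
    · intro hx
      have h0 := (hx (t + 1) (lt_add_one t)).1
      refine ⟨h0, le_of_forall_pos_le_add fun ε hε => ?_⟩
      lift ε to ℝ≥0 using hε.le
      exact_mod_cast (hx (t + ε) (lt_add_of_pos_right t (by exact_mod_cast hε))).2
    · intro hx r hr
      exact ⟨hx.1, hx.2.trans (by exact_mod_cast hr.le)⟩
  rw [hInter] at h
  exact (ENNReal.tendsto_toReal (hfin t)).comp h

/-- Existence of a subordinator with given drift and Lévy measure. -/
theorem exists_isSubordinator (a : ℝ≥0) (Λ : Measure ℝ) [SFinite Λ] (hΛ : jumpExponent Λ 1 ≠ ∞) :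
    ∃ (Ω : Type) (_ : MeasurableSpace Ω) (P : Measure Ω) (X : ℝ≥0 → Ω → ℝ),
      IsProbabilityMeasure P ∧ IsSubordinator X P ∧
      ∀ t u : ℝ≥0, ∫⁻ ω, expNeg (u * ENNReal.ofReal (X t ω)) ∂P
        = expNeg (t * (u * a + jumpExponent Λ u)) := by
  obtain ⟨Ω, mΩ, P, M, hP, hMm, hM⟩ :=
    exists_poissonRandomMeasure ((volume : Measure ℝ).prod Λ)
  have hJm : ∀ {A : Set ℝ}, MeasurableSet A → Measurable fun ω => jumpMeasure (M ω) A := by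
    intro A hA
    simp_rw [jumpMeasure_apply _ hA]
    exact hMm _ (((measurable_one.indicator hA).comp measurable_fst).mul (by fun_prop))
  -- The transform of the mass above `(0,n]` is `exp(-n · jumpExponent Λ u)`, which tends to `1` as
  -- `u ↓ 0`. Integer endpoints keep the exceptional set null.
  have hfin : ∀ᵐ ω ∂P, ∀ n : ℕ, jumpMeasure (M ω) (Ioc 0 n) < ∞ := by
    rw [ae_all_iff]
    intro n
    refine ae_lt_top_of_tendsto_lintegral_expNeg (hJm measurableSet_Ioc).aemeasurable
      (u := fun k => ((k : ℝ≥0∞) + 1)⁻¹) (fun k => by simp) ?_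
    simp_rw [lintegral_expNeg_jumpMeasure_single hM measurableSet_Ioc]
    have := ENNReal.Tendsto.const_mul (a := volume (Ioc (0 : ℝ) n)) (tendsto_jumpExponent hΛ)
      (Or.inr (by simp))
    simpa [Function.comp_def] using (expNeg_continuous.tendsto _).comp this
  have hfin' : ∀ᵐ ω ∂P, ∀ s t : ℝ≥0, jumpMeasure (M ω) (Ioc s t) ≠ ∞ := by
    filter_upwards [hfin] with ω hω s t
    obtain ⟨n, hn⟩ := exists_nat_ge (t : ℝ)
    exact ((measure_mono (Ioc_subset_Ioc s.coe_nonneg hn)).trans_lt (hω n)).ne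
  set X : ℝ≥0 → Ω → ℝ := fun t ω => a * t + (jumpMeasure (M ω) (Ioc 0 t)).toReal with hX
  -- a nonnegative version of the increments
  set D : ℝ≥0 → ℝ≥0 → Ω → ℝ≥0 := fun s t ω =>
    a * (t - s) + (jumpMeasure (M ω) (Ioc (s : ℝ) t)).toNNReal with hD
  have hDm : ∀ s t, Measurable (D s t) := fun s t =>
    ((hJm measurableSet_Ioc).ennreal_toNNReal).const_add _
  have hXm : ∀ t, Measurable (X t) := fun t =>
    ((hJm measurableSet_Ioc).ennreal_toReal).const_add _
  have hXD : ∀ᵐ ω ∂P, ∀ s t : ℝ≥0, s ≤ t → X t ω - X s ω = D s t ω := by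
    filter_upwards [hfin'] with ω hω s t hst
    have h1 : jumpMeasure (M ω) (Ioc 0 t) = jumpMeasure (M ω) (Ioc 0 s)
        + jumpMeasure (M ω) (Ioc s t) := by
      rw [← measure_union _ measurableSet_Ioc,
        Ioc_union_Ioc_eq_Ioc s.coe_nonneg (by exact_mod_cast hst)]
      exact Set.disjoint_left.2 fun x hx hx' => absurd hx.2 (not_le.2 hx'.1)
    have h0 : jumpMeasure (M ω) (Ioc 0 s) ≠ ∞ := by simpa using hω 0 s
    simp only [hX, hD, h1, ENNReal.toReal_add h0 (hω s t)]
    push_cast [NNReal.coe_sub hst, ENNReal.coe_toNNReal_eq_toReal]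
    ring
  -- The joint transform of consecutive increments factorizes. The case of one interval gives the
  -- marginal law and stationarity, and comparison with the general case gives independence.
  have hL : ∀ {n : ℕ} (t : Fin (n + 1) → ℝ≥0), Monotone t → ∀ u : Fin n → ℝ≥0,
      ∫⁻ ω, expNeg (∑ i, (u i : ℝ≥0∞) * D (t i.castSucc) (t i.succ) ω) ∂P
        = ∏ i, expNeg ((t i.succ - t i.castSucc : ℝ≥0) * (u i * a + jumpExponent Λ (u i))) := by
    intro n t ht u
    have h1 : ∫⁻ ω, expNeg (∑ i, (u i : ℝ≥0∞) * D (t i.castSucc) (t i.succ) ω) ∂P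
        = ∫⁻ ω, expNeg (∑ i, (u i : ℝ≥0∞) * (a * (t i.succ - t i.castSucc : ℝ≥0)))
          * expNeg (∑ i, (u i : ℝ≥0∞) *
            jumpMeasure (M ω) (Ioc (t i.castSucc : ℝ) (t i.succ))) ∂P := by
      refine lintegral_congr_ae ?_
      filter_upwards [hfin'] with ω hω
      rw [← expNeg_add, ← Finset.sum_add_distrib]
      congr 1
      refine Finset.sum_congr rfl fun i _ => ?_
      simp only [hD]
      rw [ENNReal.coe_add, ENNReal.coe_toNNReal (hω _ _), mul_add]
      push_cast
      rfl
    have hdisj : Pairwise (Function.onFun Disjoint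
        fun i : Fin n => Ioc (t i.castSucc : ℝ) (t i.succ)) := by
      have key : ∀ i j : Fin n, i < j →
          Disjoint (Ioc (t i.castSucc : ℝ) (t i.succ)) (Ioc (t j.castSucc : ℝ) (t j.succ)) := by
        intro i j hij
        refine Set.disjoint_left.2 fun x hx hx' => absurd (hx.2.trans ?_) (not_le.2 hx'.1)
        exact_mod_cast ht (Fin.succ_le_castSucc_iff.2 hij)
      intro i j hij
      rcases lt_or_gt_of_ne hij with h | h
      · exact key i j h
      · exact (key j i h).symm
    rw [h1, lintegral_const_mul _ (by
      refine expNeg_measurable.comp (Finset.measurable_sum _ fun i _ => ?_)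
      exact (hJm measurableSet_Ioc).const_mul _),
      lintegral_expNeg_jumpMeasure hM (fun i => measurableSet_Ioc) hdisj, expNeg_sum,
      ← Finset.prod_mul_distrib]
    refine Finset.prod_congr rfl fun i _ => ?_
    rw [← expNeg_add, Real.volume_Ioc, ← NNReal.coe_sub (ht (Fin.castSucc_lt_succ).le),
      ENNReal.ofReal_coe_nnreal]
    congr 1; ring
  have hL1 : ∀ (s t : ℝ≥0), s ≤ t → ∀ u : ℝ≥0, ∫⁻ ω, expNeg ((u : ℝ≥0∞) * D s t ω) ∂P
      = expNeg ((t - s : ℝ≥0) * (u * a + jumpExponent Λ u)) := by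
    intro s t hst u
    have := hL (n := 1) ![s, t] (by
      intro i j hij
      fin_cases i <;> fin_cases j <;> simp_all) (fun _ => u)
    simpa using this
  have hX0 : ∀ ω, X 0 ω = 0 := fun ω => by simp [hX]
  have hXlaw : ∀ t u : ℝ≥0, ∫⁻ ω, expNeg (u * ENNReal.ofReal (X t ω)) ∂P
      = expNeg (t * (u * a + jumpExponent Λ u)) := by
    intro t u
    have := hL1 0 t (by simp) u
    rw [tsub_zero] at this
    rw [← this]
    refine lintegral_congr_ae ?_
    filter_upwards [hXD] with ω hω
    have h := hω 0 t (by simp)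
    rw [hX0, sub_zero] at h
    rw [h, ENNReal.ofReal_coe_nnreal]
  refine ⟨Ω, mΩ, P, X, hP, ⟨hXm, ae_of_all _ hX0, ?_, ?_, ?_⟩, hXlaw⟩
  · intro n t ht
    have hind : iIndepFun (fun i : Fin n => D (t i.castSucc) (t i.succ)) P := by
      refine iIndepFun_of_lintegral_expNeg (fun i => hDm _ _) fun u => ?_
      rw [hL t ht u]
      exact Finset.prod_congr rfl fun i _ => (hL1 _ _ (ht (Fin.castSucc_lt_succ).le) _).symm
    refine (hind.comp (fun _ x => (x : ℝ)) fun _ => measurable_coe_nnreal_real).congr fun i => ?_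
    filter_upwards [hXD] with ω hω
    exact (hω _ _ (ht (Fin.castSucc_lt_succ).le)).symm
  · intro s h
    have hnn : ∀ᵐ ω ∂P, 0 ≤ X (s + h) ω - X s ω := by
      filter_upwards [hXD] with ω hω
      rw [hω s (s + h) (by simp)]
      exact NNReal.coe_nonneg _
    have hnn' : ∀ᵐ ω ∂P, 0 ≤ X h ω := by
      filter_upwards [hXD] with ω hω
      have := hω 0 h (by simp)
      rw [hX0, sub_zero] at this
      rw [this]
      exact NNReal.coe_nonneg _
    have hmd : Measurable fun ω => X (s + h) ω - X s ω := (hXm _).sub (hXm _)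
    have hprob : ∀ {Y : Ω → ℝ}, Measurable Y → (∀ᵐ ω ∂P, 0 ≤ Y ω) → IsProbOnNonneg (P.map Y) := by
      intro Y hY hY0
      refine ⟨Measure.isProbabilityMeasure_map hY.aemeasurable, ?_⟩
      rw [Measure.map_apply hY measurableSet_Iio]
      simp only [ae_iff, not_le] at hY0
      exact hY0
    refine (hprob hmd hnn).ext (hprob (hXm h) hnn') fun u hu => ?_
    rw [lintegral_map (by fun_prop) hmd, lintegral_map (by fun_prop) (hXm h)]
    lift u to ℝ≥0 using hu
    simp_rw [ENNReal.ofReal_mul u.coe_nonneg, ENNReal.ofReal_coe_nnreal]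
    rw [hXlaw h u]
    have := hL1 s (s + h) (by simp) u
    rw [add_tsub_cancel_left] at this
    rw [← this]
    refine lintegral_congr_ae ?_
    filter_upwards [hXD] with ω hω
    rw [hω s (s + h) (by simp), ENNReal.ofReal_coe_nnreal]
  · filter_upwards [hfin, hXD] with ω hω hω'
    refine ⟨fun s t hst => ?_, fun t => ?_⟩
    · have := hω' s t hst
      have h0 := (D s t ω).coe_nonneg
      linarith
    · exact (by fun_prop : Continuous fun r : ℝ≥0 => (a : ℝ) * r).continuousWithinAt.add
        (tendsto_jumpMeasure_Ioc hω t)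

/-! ### Riemann sums over the half line -/

lemma setLIntegral_Ioi_eq_tsum {R : Type*} [LinearOrder R] [MeasurableSpace R]
    [TopologicalSpace R] [OrderClosedTopology R] [OpensMeasurableSpace R] (μ : Measure R)
    {t : ℕ → R} (ht : Monotone t) (ht' : ∀ x, ∃ i, x ≤ t i) (F : R → ℝ≥0∞) :
    ∫⁻ s in Ioi (t 0), F s ∂μ = ∑' i, ∫⁻ s in Ioc (t i) (t (i + 1)), F s ∂μ := by
  have hU : Ioi (t 0) = ⋃ i, Ioc (t i) (t (i + 1)) := by
    ext x
    simp only [mem_Ioi, mem_iUnion, mem_Ioc]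
    constructor
    · intro hx
      classical
      have h0 : Nat.find (ht' x) ≠ 0 := by
        intro h
        have := Nat.find_spec (ht' x)
        rw [h] at this
        exact absurd hx (not_lt.2 this)
      obtain ⟨k, hk⟩ := Nat.exists_eq_succ_of_ne_zero h0
      refine ⟨k, ?_, ?_⟩
      · exact not_le.1 (Nat.find_min (ht' x) (by omega))
      · have := Nat.find_spec (ht' x)
        rwa [hk] at this
    · rintro ⟨i, hi, -⟩
      exact (ht (Nat.zero_le i)).trans_lt hi
  rw [hU, lintegral_iUnion (fun i => measurableSet_Ioc)
    (by simpa using ht.pairwise_disjoint_on_Ioc_succ)]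

/-- The grid points `i h`. -/
lemma monotone_grid {R : Type*} [Semiring R] [PartialOrder R] [IsOrderedRing R] {h : R}
    (hh : 0 ≤ h) : Monotone fun i : ℕ => (i : R) * h := fun _ _ hij =>
  mul_le_mul_of_nonneg_right (Nat.mono_cast hij) hh

/-- The left-endpoint sum dominates the integral cell by cell. Without its first term it is the
right-endpoint sum, which the integral dominates, so the error is at most `h F(0)`. -/
lemma riemannSum_bounds {F : ℝ → ℝ≥0∞} (hF : AntitoneOn F (Ici 0)) {h : ℝ} (hh : 0 < h) :
    ∫⁻ s in Ioi (0 : ℝ), F s ≤ ∑' i : ℕ, ENNReal.ofReal h * F (i * h) ∧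
    ∑' i : ℕ, ENNReal.ofReal h * F (i * h)
      ≤ ENNReal.ofReal h * F 0 + ∫⁻ s in Ioi (0 : ℝ), F s := by
  have key := setLIntegral_Ioi_eq_tsum (volume : Measure ℝ) (monotone_grid hh.le)
    (fun x => by
      obtain ⟨n, hn⟩ := exists_nat_ge (x / h)
      exact ⟨n, (div_le_iff₀ hh).1 hn⟩) F
  simp only [Nat.cast_zero, zero_mul] at key
  have hvol : ∀ i : ℕ, volume (Ioc ((i : ℝ) * h) (((i + 1 : ℕ) : ℝ) * h)) = ENNReal.ofReal h := by
    intro i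
    rw [Real.volume_Ioc]
    congr 1; push_cast; ring
  have hnn : ∀ i : ℕ, (0 : ℝ) ≤ i * h := fun i => by positivity
  constructor
  · rw [key]
    refine ENNReal.tsum_le_tsum fun i => ?_
    calc ∫⁻ s in Ioc ((i : ℝ) * h) (((i + 1 : ℕ) : ℝ) * h), F s
        ≤ ∫⁻ s in Ioc ((i : ℝ) * h) (((i + 1 : ℕ) : ℝ) * h), F (i * h) :=
          setLIntegral_mono' measurableSet_Ioc fun s hs =>
            hF (hnn i) ((hnn i).trans hs.1.le) hs.1.le
      _ = ENNReal.ofReal h * F (i * h) := by rw [setLIntegral_const, hvol, mul_comm]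
  · rw [tsum_eq_zero_add' ENNReal.summable, key]
    simp only [Nat.cast_zero, zero_mul]
    gcongr with i
    calc ENNReal.ofReal h * F (((i + 1 : ℕ) : ℝ) * h)
        = ∫⁻ s in Ioc ((i : ℝ) * h) (((i + 1 : ℕ) : ℝ) * h), F (((i + 1 : ℕ) : ℝ) * h) := by
          rw [setLIntegral_const, hvol, mul_comm]
      _ ≤ _ := setLIntegral_mono' measurableSet_Ioc fun s hs =>
            hF ((hnn i).trans hs.1.le) (hnn (i + 1)) hs.2

lemma tendsto_riemannSum {F : ℝ → ℝ≥0∞} (hF : AntitoneOn F (Ici 0)) (hF0 : F 0 ≠ ∞) {h : ℕ → ℝ}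
    (hh : ∀ n, 0 < h n) (hlim : Tendsto h atTop (𝓝 0)) :
    Tendsto (fun n => ∑' i : ℕ, ENNReal.ofReal (h n) * F (i * h n)) atTop
      (𝓝 (∫⁻ s in Ioi (0 : ℝ), F s)) := by
  refine tendsto_of_tendsto_of_tendsto_of_le_of_le tendsto_const_nhds ?_
    (fun n => (riemannSum_bounds hF (hh n)).1) (fun n => (riemannSum_bounds hF (hh n)).2)
  have h1 : Tendsto (fun n => ENNReal.ofReal (h n) * F 0) atTop (𝓝 0) := by
    have := ENNReal.Tendsto.mul_const (b := F 0) (ENNReal.tendsto_ofReal hlim) (Or.inr hF0)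
    simpa using this
  simpa using h1.add_const (∫⁻ s in Ioi (0 : ℝ), F s)

/-! ### The path integral as a limit of sums -/

/-- The sum approximating `∫ e^{-s} dx_s` on a grid of mesh `h`. -/
def gridSum (h : ℝ≥0) (x : ℝ≥0 → ℝ) : ℝ≥0∞ :=
  ∑' i : ℕ, ENNReal.ofReal (Real.exp (-(i * h))) *
    ENNReal.ofReal (x ((i + 1 : ℕ) * h) - x (i * h))

/-- On a cell of length `h` the weight `e^{-s}` lies between its value at the left endpoint and
`e^{-h}` times that value. -/
lemma pathIntegral_bounds {ξ : ℝ≥0 → ℝ} (hξ : ∀ t, ξ t = t) {x : ℝ≥0 → ℝ} (hx : Monotone x)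
    (hxc : ∀ t, ContinuousWithinAt x (Ici t) t) {h : ℝ≥0} (hh : 0 < h) :
    ENNReal.ofReal (Real.exp (-h)) * gridSum h x ≤ pathIntegral ξ x ∧
      pathIntegral ξ x ≤ gridSum h x := by
  have hleft : ∀ s, Function.leftLim ξ s = s := by
    intro s
    have hc : Continuous ξ := by
      rw [show ξ = fun t : ℝ≥0 => (t : ℝ) from funext hξ]
      fun_prop
    rw [← hξ s]
    exact hc.continuousWithinAt.leftLim_eq
  -- The Stieltjes function is the right-limit regularization of `x`. Right-continuity identifies it
  -- with `x` itself.
  have hmeas : ∀ a b, hx.stieltjesFunction.measure (Ioc a b) = ENNReal.ofReal (x b - x a) := by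
    intro a b
    rw [StieltjesFunction.measure_Ioc, hx.stieltjesFunction_eq, hx.stieltjesFunction_eq, (hxc a).rightLim_eq,
      (hxc b).rightLim_eq]
  have key := setLIntegral_Ioi_eq_tsum hx.stieltjesFunction.measure
    (t := fun i : ℕ => (i : ℝ≥0) * h) (monotone_grid hh.le)
    (fun x => by
      obtain ⟨n, hn⟩ := exists_nat_ge (x / h)
      exact ⟨n, (div_le_iff₀ hh).1 hn⟩)
    (fun s : ℝ≥0 => ENNReal.ofReal (Real.exp (-(s : ℝ))))
  simp only [Nat.cast_zero, zero_mul] at key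
  rw [pathIntegral, dif_pos hx]
  simp_rw [hleft]
  rw [key, gridSum]
  constructor
  · rw [← ENNReal.tsum_mul_left]
    refine ENNReal.tsum_le_tsum fun i => ?_
    rw [← hmeas, ← mul_assoc, ← ENNReal.ofReal_mul (Real.exp_nonneg _), ← Real.exp_add,
      ← setLIntegral_const]
    refine setLIntegral_mono' measurableSet_Ioc fun s hs => ?_
    gcongr
    have : (s : ℝ) ≤ ((i + 1 : ℕ) : ℝ≥0) * h := by exact_mod_cast hs.2
    push_cast at this
    linarith
  · refine ENNReal.tsum_le_tsum fun i => ?_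
    rw [← hmeas, ← setLIntegral_const]
    refine setLIntegral_mono' measurableSet_Ioc fun s hs => ?_
    gcongr
    have : ((i : ℝ≥0) : ℝ) * h ≤ s := by exact_mod_cast hs.1.le
    simpa using this

lemma tendsto_gridSum {ξ : ℝ≥0 → ℝ} (hξ : ∀ t, ξ t = t) {x : ℝ≥0 → ℝ} (hx : Monotone x)
    (hxc : ∀ t, ContinuousWithinAt x (Ici t) t) {h : ℕ → ℝ≥0} (hh : ∀ n, 0 < h n)
    (hlim : Tendsto h atTop (𝓝 0)) :
    Tendsto (fun n => gridSum (h n) x) atTop (𝓝 (pathIntegral ξ x)) := by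
  have hup : ∀ n, gridSum (h n) x ≤ ENNReal.ofReal (Real.exp (h n)) * pathIntegral ξ x := by
    intro n
    calc gridSum (h n) x
        = ENNReal.ofReal (Real.exp (h n)) *
          (ENNReal.ofReal (Real.exp (-(h n))) * gridSum (h n) x) := by
          rw [← mul_assoc, ← ENNReal.ofReal_mul (Real.exp_nonneg _), ← Real.exp_add]
          simp
      _ ≤ _ := by gcongr; exact (pathIntegral_bounds hξ hx hxc (hh n)).1
  refine tendsto_of_tendsto_of_tendsto_of_le_of_le tendsto_const_nhds ?_
    (fun n => (pathIntegral_bounds hξ hx hxc (hh n)).2) hup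
  have h1 : Tendsto (fun n => ENNReal.ofReal (Real.exp (h n))) atTop (𝓝 1) := by
    have h2 : Tendsto (fun n => Real.exp (h n : ℝ)) atTop (𝓝 1) := by
      rw [← Real.exp_zero]
      exact (Real.continuous_exp.tendsto 0).comp
        ((NNReal.continuous_coe.tendsto 0).comp hlim)
    simpa using ENNReal.tendsto_ofReal h2
  simpa using ENNReal.Tendsto.mul_const (b := pathIntegral ξ x) h1 (Or.inl one_ne_zero)

/-! ### Laplace exponents of subordinators -/

/-- The Laplace exponent `u ↦ -log ∫ e^{-ux} σ(dx)`. -/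
def laplaceExponent (σ : Measure ℝ) (u : ℝ) : ℝ≥0∞ :=
  ENNReal.ofReal (-Real.log (laplaceTransform σ u))

lemma IsProbOnNonneg.laplaceTransform_pos {σ : Measure ℝ} (h : IsProbOnNonneg σ) {u : ℝ}
    (hu : 0 ≤ u) : 0 < laplaceTransform σ u := by
  have := h.1
  rw [← ENNReal.ofReal_pos, ofReal_laplaceTransform h hu, lintegral_pos_iff_support (by fun_prop)]
  have : Function.support (fun x => expNeg (ENNReal.ofReal (u * x))) = univ := by
    ext x
    simpa using (expNeg_pos (ENNReal.ofReal_ne_top)).ne'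
  rw [this]
  simp

lemma IsProbOnNonneg.laplaceTransform_le_one {σ : Measure ℝ} (h : IsProbOnNonneg σ) {u : ℝ}
    (hu : 0 ≤ u) : laplaceTransform σ u ≤ 1 := by
  have := h.1
  have h1 := ofReal_laplaceTransform h hu
  have : ENNReal.ofReal (laplaceTransform σ u) ≤ 1 := by
    rw [h1]
    calc _ ≤ ∫⁻ _, 1 ∂σ := lintegral_mono fun x => expNeg_le_one _
      _ = 1 := by simp
  simpa using this

lemma IsProbOnNonneg.laplaceTransform_antitoneOn {σ : Measure ℝ} (h : IsProbOnNonneg σ) :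
    AntitoneOn (laplaceTransform σ) (Ici 0) := by
  intro u hu v hv huv
  rw [← ENNReal.ofReal_le_ofReal_iff (h.laplaceTransform_pos hu).le,
    ofReal_laplaceTransform h hu, ofReal_laplaceTransform h hv]
  refine lintegral_mono_ae ?_
  filter_upwards [h.ae_nonneg] with x hx
  exact expNeg_antitone (ENNReal.ofReal_le_ofReal (mul_le_mul_of_nonneg_right huv hx))

lemma IsProbOnNonneg.expNeg_laplaceExponent {σ : Measure ℝ} (h : IsProbOnNonneg σ) {u : ℝ}
    (hu : 0 ≤ u) :
    expNeg (laplaceExponent σ u) = ∫⁻ x, expNeg (ENNReal.ofReal (u * x)) ∂σ := by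
  rw [laplaceExponent, expNeg_ofReal, neg_neg, Real.exp_log (h.laplaceTransform_pos hu),
    ofReal_laplaceTransform h hu]
  rw [neg_nonneg]
  exact Real.log_nonpos (h.laplaceTransform_pos hu).le (h.laplaceTransform_le_one hu)

lemma IsProbOnNonneg.laplaceExponent_monotoneOn {σ : Measure ℝ} (h : IsProbOnNonneg σ) :
    MonotoneOn (laplaceExponent σ) (Ici 0) := by
  intro u hu v hv huv
  refine ENNReal.ofReal_le_ofReal (neg_le_neg (Real.log_le_log (h.laplaceTransform_pos hv) ?_))
  exact h.laplaceTransform_antitoneOn hu hv huv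

/-- For `m = ⌊nt⌋` both `n g(t)` and `n t g(1)` lie between `m g(1)` and `(m+1) g(1)`, so `n |g(t) -
t g(1)| ≤ g(1)` for every `n`. -/
lemma additive_monotone_eq {g : ℝ≥0 → ℝ} (hadd : ∀ s t, g (s + t) = g s + g t)
    (hmono : Monotone g) (t : ℝ≥0) : g t = t * g 1 := by
  have h0 : g 0 = 0 := by simpa using hadd 0 0
  have hmul : ∀ (n : ℕ) (s : ℝ≥0), g (n * s) = n * g s := by
    intro n s
    induction n with
    | zero => simp [h0]
    | succ n ih => push_cast; rw [add_mul, one_mul, hadd, ih]; ring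
  have hint : ∀ n : ℕ, g n = n * g 1 := fun n => by simpa using hmul n 1
  have h1 : 0 ≤ g 1 := by rw [← h0]; exact hmono zero_le_one
  have hbound : ∀ n : ℕ, |(n : ℝ) * (g t - t * g 1)| ≤ g 1 := by
    intro n
    have hlo := hmono (Nat.floor_le (zero_le (a := (n : ℝ≥0) * t)))
    have hhi := hmono (Nat.lt_floor_add_one ((n : ℝ≥0) * t)).le
    have hlo' : (n : ℝ) * t < ⌊(n : ℝ≥0) * t⌋₊ + 1 := by
      exact_mod_cast Nat.lt_floor_add_one ((n : ℝ≥0) * t)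
    have hhi' : (⌊(n : ℝ≥0) * t⌋₊ : ℝ) ≤ n * t := by
      exact_mod_cast Nat.floor_le (zero_le (a := (n : ℝ≥0) * t))
    rw [hmul, hint] at hlo
    rw [hmul, hadd, hint] at hhi
    rw [abs_le]
    constructor <;> nlinarith
  by_contra hne
  have hpos : 0 < |g t - t * g 1| := abs_pos.2 (sub_ne_zero.2 hne)
  obtain ⟨n, hn⟩ := exists_nat_gt (g 1 / |g t - t * g 1|)
  have := hbound n
  rw [abs_mul, Nat.abs_cast] at this
  rw [div_lt_iff₀ hpos] at hn
  linarith

section Subordinator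

variable {Ω : Type*} [MeasurableSpace Ω] {P : Measure Ω} [IsProbabilityMeasure P]
  {X : ℝ≥0 → Ω → ℝ}

omit [IsProbabilityMeasure P] in
lemma IsSubordinator.ae_nonneg (hX : IsSubordinator X P) (t : ℝ≥0) : ∀ᵐ ω ∂P, 0 ≤ X t ω := by
  filter_upwards [hX.zero, hX.paths] with ω h0 h1
  rw [← h0]
  exact h1.1 (zero_le (a := t))

lemma isProbOnNonneg_map {Y : Ω → ℝ} (hY : AEMeasurable Y P) (hY0 : ∀ᵐ ω ∂P, 0 ≤ Y ω) :
    IsProbOnNonneg (P.map Y) := by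
  refine ⟨Measure.isProbabilityMeasure_map hY, ?_⟩
  rw [Measure.map_apply_of_aemeasurable hY measurableSet_Iio]
  simp only [ae_iff, not_le] at hY0
  exact hY0

lemma IsSubordinator.isProbOnNonneg (hX : IsSubordinator X P) (t : ℝ≥0) :
    IsProbOnNonneg (P.map (X t)) :=
  isProbOnNonneg_map (hX.measurable t).aemeasurable (hX.ae_nonneg t)

/-- Independent stationary increments make `t ↦ E e^{-u X_t}` multiplicative, and monotone paths
make it decreasing. Hence its negative logarithm is additive and monotone, thus linear in `t`. -/
lemma IsSubordinator.lintegral_expNeg (hX : IsSubordinator X P) {u : ℝ} (hu : 0 ≤ u) (t : ℝ≥0) :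
    ∫⁻ ω, expNeg (ENNReal.ofReal (u * X t ω)) ∂P
      = expNeg (t * laplaceExponent (P.map (X 1)) u) := by
  have hmap : ∀ s, ENNReal.ofReal (laplaceTransform (P.map (X s)) u)
      = ∫⁻ ω, expNeg (ENNReal.ofReal (u * X s ω)) ∂P := by
    intro s
    rw [ofReal_laplaceTransform (hX.isProbOnNonneg s) hu,
      lintegral_map (by fun_prop) (hX.measurable s)]
  set L : ℝ≥0 → ℝ := fun s => laplaceTransform (P.map (X s)) u with hL
  have hLpos : ∀ s, 0 < L s := fun s => (hX.isProbOnNonneg s).laplaceTransform_pos hu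
  have hLmul : ∀ s t, L (s + t) = L s * L t := by
    intro s t
    have h1 : ENNReal.ofReal (L (s + t)) = ENNReal.ofReal (L s * L t) := by
      rw [ENNReal.ofReal_mul (hLpos s).le, hmap, hmap, hmap]
      -- Since `X₀ = 0` almost surely, `X_s` counts as the increment over `[0,s]`.
      have hind : IndepFun (X s) (X (s + t) - X s) P :=
        hX.indep.indepFun_eval_sub (r := 0) (zero_le (a := s)) (by simp) hX.zero
      have hf : Measurable fun x : ℝ => expNeg (ENNReal.ofReal (u * x)) := by fun_prop
      have h2 := lintegral_mul_eq_lintegral_mul_lintegral_of_indepFun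
        (hf.comp (hX.measurable s)) (hf.comp ((hX.measurable (s + t)).sub (hX.measurable s)))
        (hind.comp hf hf)
      have h3 : ∫⁻ ω, expNeg (ENNReal.ofReal (u * (X (s + t) - X s) ω)) ∂P
          = ∫⁻ ω, expNeg (ENNReal.ofReal (u * X t ω)) ∂P := by
        rw [← lintegral_map (f := fun x : ℝ => expNeg (ENNReal.ofReal (u * x))) hf
          ((hX.measurable (s + t)).sub (hX.measurable s)),
          ← lintegral_map (f := fun x : ℝ => expNeg (ENNReal.ofReal (u * x))) hf
          (hX.measurable t), ← hX.stationary s t]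
        rfl
      rw [← h3]
      refine Eq.trans ?_ h2
      refine lintegral_congr_ae ?_
      filter_upwards [hX.ae_nonneg s, hX.paths] with ω h0 hp
      have hmono : X s ω ≤ X (s + t) ω := hp.1 (by simp)
      simp only [Pi.mul_apply, Function.comp_apply, Pi.sub_apply]
      rw [← expNeg_add, ← ENNReal.ofReal_add (mul_nonneg hu h0)
        (mul_nonneg hu (sub_nonneg.2 hmono))]
      congr 2; ring
    rwa [ENNReal.ofReal_eq_ofReal_iff (hLpos _).le (mul_pos (hLpos s) (hLpos t)).le] at h1
  have hLanti : Antitone L := by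
    intro s t hst
    rw [← ENNReal.ofReal_le_ofReal_iff (hLpos _).le, hmap, hmap]
    refine lintegral_mono_ae ?_
    filter_upwards [hX.paths] with ω hp
    exact expNeg_antitone (ENNReal.ofReal_le_ofReal (mul_le_mul_of_nonneg_left (hp.1 hst) hu))
  have hg := additive_monotone_eq (g := fun s => -Real.log (L s))
    (fun s t => by
      rw [hLmul, Real.log_mul (hLpos s).ne' (hLpos t).ne']; ring)
    (fun s t hst => neg_le_neg (Real.log_le_log (hLpos t) (hLanti hst))) t
  rw [← hmap, laplaceExponent, ← ENNReal.ofReal_coe_nnreal,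
    ← ENNReal.ofReal_mul t.coe_nonneg, expNeg_ofReal, ← hg, neg_neg, Real.exp_log (hLpos t)]
  rw [← hg, neg_nonneg]
  exact Real.log_nonpos (hLpos t).le ((hX.isProbOnNonneg t).laplaceTransform_le_one hu)

/-- The grid sum is a series of independent increments over length `h`, the `i`-th weighted by
`e^{-ih}`. Each contributes a factor with exponent `h ψ(u e^{-ih})`. -/
lemma IsSubordinator.lintegral_expNeg_gridSum (hX : IsSubordinator X P) {u : ℝ} (hu : 0 ≤ u)
    (h : ℝ≥0) :
    ∫⁻ ω, expNeg (ENNReal.ofReal u * gridSum h fun t => X t ω) ∂P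
      = expNeg (∑' i : ℕ, h * laplaceExponent (P.map (X 1)) (u * Real.exp (-(i * h)))) := by
  set c : ℕ → ℝ := fun i => u * Real.exp (-(i * h)) with hc
  have hc0 : ∀ i, 0 ≤ c i := fun i => mul_nonneg hu (Real.exp_nonneg _)
  set D : ℕ → Ω → ℝ := fun i ω => X ((i + 1 : ℕ) * h) ω - X (i * h) ω with hD
  have hDm : ∀ i, Measurable (D i) := fun i => (hX.measurable _).sub (hX.measurable _)
  have hgrid : ∀ ω, ENNReal.ofReal u * gridSum h (fun t => X t ω)
      = ∑' i, ENNReal.ofReal (c i * D i ω) := by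
    intro ω
    rw [gridSum, ← ENNReal.tsum_mul_left]
    congr 1; ext i
    rw [← mul_assoc, ← ENNReal.ofReal_mul hu, ENNReal.ofReal_mul (hc0 i)]
  simp_rw [hgrid]
  have h1 : Tendsto (fun n => ∫⁻ ω, ∏ i ∈ Finset.range n,
      expNeg (ENNReal.ofReal (c i * D i ω)) ∂P) atTop
      (𝓝 (∫⁻ ω, expNeg (∑' i, ENNReal.ofReal (c i * D i ω)) ∂P)) := by
    refine tendsto_lintegral_of_dominated_convergence (fun _ => 1) (fun n => by fun_prop)
      (fun n => ae_of_all _ fun ω => ?_) (by simp)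
      (ae_of_all _ fun ω => tendsto_expNeg_tsum _)
    exact Finset.prod_le_one' fun k _ => expNeg_le_one _
  have hind : iIndepFun D P := hX.indep.nat (t := fun i : ℕ => (i : ℝ≥0) * h)
    (monotone_grid (zero_le (a := h)))
  have h2 : ∀ n, ∫⁻ ω, ∏ i ∈ Finset.range n, expNeg (ENNReal.ofReal (c i * D i ω)) ∂P
      = ∏ i ∈ Finset.range n, expNeg (h * laplaceExponent (P.map (X 1)) (c i)) := by
    intro n
    have hf : ∀ i, Measurable fun x : ℝ => expNeg (ENNReal.ofReal (c i * x)) :=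
      fun i => by fun_prop
    rw [lintegral_prod_eq_prod_lintegral_of_indepFun (Finset.range n)
      (fun i ω => expNeg (ENNReal.ofReal (c i * D i ω)))
      (hind.comp (fun i x => expNeg (ENNReal.ofReal (c i * x))) hf) (fun i => (hf i).comp (hDm i))]
    refine Finset.prod_congr rfl fun i _ => ?_
    rw [← hX.lintegral_expNeg (hc0 i), ← lintegral_map (hf i) (hDm i),
      ← lintegral_map (hf i) (hX.measurable h), ← hX.stationary (i * h) h]
    congr 2
    ext ω
    simp only [hD]
    rw [show ((i + 1 : ℕ) : ℝ≥0) * h = i * h + h by push_cast; ring]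
  simp_rw [h2] at h1
  exact tendsto_nhds_unique h1 (tendsto_expNeg_tsum _)

/-- The integral `∫_0^∞ ψ(u e^{-s}) ds` of the Laplace exponent `ψ` of `σ`. -/
def integratedExponent (σ : Measure ℝ) (u : ℝ) : ℝ≥0∞ :=
  ∫⁻ s in Ioi (0 : ℝ), laplaceExponent σ (u * Real.exp (-s))

omit [IsProbabilityMeasure P] in
lemma IsSubordinator.measurable_gridSum (hX : IsSubordinator X P) (h : ℝ≥0) :
    Measurable fun ω => gridSum h fun t => X t ω := by
  refine Measurable.tsum fun i => ?_
  exact (((hX.measurable _).sub (hX.measurable _)).ennreal_ofReal).const_mul _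

lemma tendsto_inv_nat_add_one : Tendsto (fun n : ℕ => ((n : ℝ≥0) + 1)⁻¹) atTop (𝓝 0) := by
  rw [← NNReal.tendsto_coe]
  simpa using tendsto_one_div_add_atTop_nhds_zero_nat (𝕜 := ℝ)

omit [IsProbabilityMeasure P] in
lemma IsSubordinator.ae_tendsto_gridSum (hX : IsSubordinator X P) {ξ : ℝ≥0 → ℝ}
    (hξ : ∀ t, ξ t = t) :
    ∀ᵐ ω ∂P, Tendsto (fun n : ℕ => gridSum ((n : ℝ≥0) + 1)⁻¹ fun t => X t ω) atTop
      (𝓝 (pathIntegral ξ fun t => X t ω)) := by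
  filter_upwards [hX.paths] with ω hω
  exact tendsto_gridSum hξ hω.1 hω.2 (fun n => by positivity) tendsto_inv_nat_add_one

omit [IsProbabilityMeasure P] in
lemma IsSubordinator.aemeasurable_pathIntegral (hX : IsSubordinator X P) {ξ : ℝ≥0 → ℝ}
    (hξ : ∀ t, ξ t = t) : AEMeasurable (fun ω => pathIntegral ξ fun t => X t ω) P :=
  aemeasurable_of_tendsto_metrizable_ae atTop (fun _ => (hX.measurable_gridSum _).aemeasurable)
    (hX.ae_tendsto_gridSum hξ)

/-- The Laplace transform of the exponential functional. -/
theorem IsSubordinator.lintegral_expNeg_pathIntegral (hX : IsSubordinator X P) {ξ : ℝ≥0 → ℝ}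
    (hξ : ∀ t, ξ t = t) {u : ℝ} (hu : 0 ≤ u) :
    ∫⁻ ω, expNeg (ENNReal.ofReal u * pathIntegral ξ fun t => X t ω) ∂P
      = expNeg (integratedExponent (P.map (X 1)) u) := by
  have h1 : Tendsto (fun n : ℕ => ∫⁻ ω, expNeg (ENNReal.ofReal u *
      gridSum ((n : ℝ≥0) + 1)⁻¹ fun t => X t ω) ∂P) atTop
      (𝓝 (∫⁻ ω, expNeg (ENNReal.ofReal u * pathIntegral ξ fun t => X t ω) ∂P)) := by
    refine tendsto_lintegral_of_dominated_convergence (fun _ => 1) (fun n => ?_)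
      (fun n => ae_of_all _ fun ω => expNeg_le_one _) (by simp) ?_
    · exact expNeg_measurable.comp ((hX.measurable_gridSum _).const_mul _)
    · filter_upwards [hX.ae_tendsto_gridSum hξ] with ω hω
      exact (expNeg_continuous.tendsto _).comp
        (ENNReal.Tendsto.const_mul hω (Or.inr ENNReal.ofReal_ne_top))
  simp_rw [hX.lintegral_expNeg_gridSum hu] at h1
  refine tendsto_nhds_unique h1 ((expNeg_continuous.tendsto _).comp ?_)
  -- The exponents of the grid sums are left Riemann sums of this decreasing function, so they
  -- converge to its integral even when that is infinite.
  have hanti : AntitoneOn (fun s : ℝ => laplaceExponent (P.map (X 1)) (u * Real.exp (-s)))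
      (Ici 0) := fun s _ t _ hst =>
    (hX.isProbOnNonneg 1).laplaceExponent_monotoneOn (mul_nonneg hu (Real.exp_nonneg _))
      (mul_nonneg hu (Real.exp_nonneg _))
      (mul_le_mul_of_nonneg_left (Real.exp_le_exp.2 (neg_le_neg hst)) hu)
  have h2 := tendsto_riemannSum hanti ENNReal.ofReal_ne_top
    (h := fun n : ℕ => (((n : ℝ≥0) + 1)⁻¹ : ℝ≥0)) (fun n => by positivity)
    ((NNReal.continuous_coe.tendsto 0).comp tendsto_inv_nat_add_one)
  simpa only [ENNReal.ofReal_coe_nnreal, integratedExponent] using h2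

end Subordinator

/-! ### Logarithmic moments and convergence of the exponential functional -/

lemma one_sub_expNeg_ofReal {r : ℝ} (hr : 0 ≤ r) :
    1 - expNeg (ENNReal.ofReal r) = ENNReal.ofReal (1 - Real.exp (-r)) := by
  rw [expNeg_ofReal hr, ENNReal.ofReal_sub _ (Real.exp_nonneg _), ENNReal.ofReal_one]

/-- The integral `∫_0^∞ (1 - exp (-x e^{-s})) ds`. -/
def logKernel (x : ℝ) : ℝ≥0∞ :=
  ∫⁻ s in Ioi (0 : ℝ), (1 - expNeg (ENNReal.ofReal (Real.exp (-s) * x)))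

/-- Split at `l = log⁺ x`. Before `l` the integrand is at most `1`; after `l` it is at most `x
e^{-s}`, whose integral is `x e^{-l} ≤ 1`. -/
lemma logKernel_le {x : ℝ} (hx : 0 ≤ x) : logKernel x ≤ ENNReal.ofReal (Real.posLog x) + 1 := by
  set l := Real.posLog x with hl
  have hl0 : 0 ≤ l := Real.posLog_nonneg
  have hexp : x ≤ Real.exp l := by
    rcases hx.eq_or_lt with rfl | hx
    · exact (Real.exp_pos _).le
    · rw [← Real.log_le_iff_le_exp hx]
      exact le_max_right _ _
  rw [logKernel, ← Ioc_union_Ioi_eq_Ioi hl0]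
  refine (lintegral_union_le _ _ _).trans (add_le_add ?_ ?_)
  · calc _ ≤ ∫⁻ _ in Ioc 0 l, 1 := lintegral_mono fun s => tsub_le_self
      _ = ENNReal.ofReal l := by simp
  · have h1 : ∫⁻ s in Ioi l, ENNReal.ofReal (Real.exp (-s)) = ENNReal.ofReal (Real.exp (-l)) := by
      rw [← ofReal_integral_eq_lintegral_ofReal (integrableOn_exp_neg_Ioi l)
        (ae_of_all _ fun s => Real.exp_nonneg _), integral_exp_neg_Ioi]
    calc ∫⁻ s in Ioi l, (1 - expNeg (ENNReal.ofReal (Real.exp (-s) * x)))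
        ≤ ∫⁻ s in Ioi l, ENNReal.ofReal x * ENNReal.ofReal (Real.exp (-s)) := by
          refine lintegral_mono fun s => ?_
          rw [one_sub_expNeg_ofReal (by positivity), ← ENNReal.ofReal_mul hx]
          refine ENNReal.ofReal_le_ofReal ?_
          have := Real.add_one_le_exp (-(Real.exp (-s) * x))
          linarith
      _ = ENNReal.ofReal (x * Real.exp (-l)) := by
          rw [lintegral_const_mul _ (by fun_prop), h1, ENNReal.ofReal_mul hx]
      _ ≤ 1 := by
          rw [ENNReal.ofReal_le_one, Real.exp_neg, ← div_eq_mul_inv,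
            div_le_one (Real.exp_pos _)]
          exact hexp

/-- For `0 < s ≤ log⁺ x` one has `x e^{-s} ≥ 1`, so the integrand is at least `1 - e^{-1}`. -/
lemma le_logKernel {x : ℝ} (hx : 0 ≤ x) :
    ENNReal.ofReal (1 - Real.exp (-1)) * ENNReal.ofReal (Real.posLog x) ≤ logKernel x := by
  set l := Real.posLog x with hl
  have hexp : ∀ s ∈ Ioc 0 l, Real.exp s ≤ x := by
    intro s hs
    have hlpos : 0 < l := hs.1.trans_le hs.2
    have hllog : l = Real.log x := by
      rcases max_choice 0 (Real.log x) with h | h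
      · rw [hl, Real.posLog, h] at hlpos
        exact absurd hlpos (lt_irrefl _)
      · rw [hl, Real.posLog, h]
    -- The convention `Real.log 0 = 0` excludes `x = 0` here, because `l` is positive.
    have hxpos : 0 < x := by
      rcases hx.eq_or_lt with h | h
      · rw [hllog, ← h, Real.log_zero] at hlpos
        exact absurd hlpos (lt_irrefl _)
      · exact h
    rw [← Real.le_log_iff_exp_le hxpos, ← hllog]
    exact hs.2
  calc ENNReal.ofReal (1 - Real.exp (-1)) * ENNReal.ofReal l
      = ∫⁻ _ in Ioc 0 l, ENNReal.ofReal (1 - Real.exp (-1)) := by simp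
    _ ≤ ∫⁻ s in Ioc 0 l, (1 - expNeg (ENNReal.ofReal (Real.exp (-s) * x))) := by
        refine setLIntegral_mono' measurableSet_Ioc fun s hs => ?_
        rw [one_sub_expNeg_ofReal (by positivity)]
        refine ENNReal.ofReal_le_ofReal (sub_le_sub_left (Real.exp_le_exp.2 (neg_le_neg ?_)) _)
        rw [Real.exp_neg, inv_mul_eq_div, one_le_div (Real.exp_pos _)]
        exact hexp s hs
    _ ≤ logKernel x := lintegral_mono_set Ioc_subset_Ioi_self

lemma lintegral_one_sub_laplaceTransform {σ : Measure ℝ} (h : IsProbOnNonneg σ) :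
    ∫⁻ s in Ioi (0 : ℝ), ENNReal.ofReal (1 - laplaceTransform σ (Real.exp (-s)))
      = ∫⁻ x, logKernel x ∂σ := by
  have := h.1
  unfold logKernel
  rw [lintegral_lintegral_swap (by fun_prop)]
  refine lintegral_congr fun s => ?_
  have hs : 0 ≤ Real.exp (-s) := Real.exp_nonneg _
  have hle : ∫⁻ x, expNeg (ENNReal.ofReal (Real.exp (-s) * x)) ∂σ ≤ 1 := by
    calc _ ≤ ∫⁻ _, 1 ∂σ := lintegral_mono fun x => expNeg_le_one _
      _ = 1 := by simp
  rw [ENNReal.ofReal_sub _ (h.laplaceTransform_pos hs).le, ofReal_laplaceTransform h hs,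
    lintegral_sub (by fun_prop) (ne_top_of_le_ne_top (by simp) hle)
      (ae_of_all _ fun x => expNeg_le_one _)]
  simp

/-- With `L` the Laplace transform, `-log L(v) ≤ (1 - L(v))/L(v) ≤ (1 - L(v))/L(1)` for `v ≤ 1`, and
the integral of `1 - L(e^{-s})` is `∫ logKernel dσ`. -/
lemma IsProbOnNonneg.integratedExponent_lt_top {σ : Measure ℝ} (h : IsProbOnNonneg σ)
    (hlog : Integrable (fun x => Real.posLog x) σ) : integratedExponent σ 1 < ∞ := by
  have := h.1
  have hL1 := h.laplaceTransform_pos zero_le_one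
  calc integratedExponent σ 1
      ≤ ∫⁻ s in Ioi (0 : ℝ), ENNReal.ofReal (laplaceTransform σ 1)⁻¹ *
          ENNReal.ofReal (1 - laplaceTransform σ (Real.exp (-s))) := by
        refine setLIntegral_mono' measurableSet_Ioi fun s hs => ?_
        have hs0 : 0 ≤ Real.exp (-s) := Real.exp_nonneg _
        have hs1 : Real.exp (-s) ≤ 1 := Real.exp_le_one_iff.2 (neg_nonpos.2 hs.le)
        have hpos := h.laplaceTransform_pos hs0
        have hle := h.laplaceTransform_le_one hs0
        have hmono : laplaceTransform σ 1 ≤ laplaceTransform σ (Real.exp (-s)) :=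
          h.laplaceTransform_antitoneOn hs0 (mem_Ici.2 zero_le_one) hs1
        rw [one_mul, laplaceExponent, ← ENNReal.ofReal_mul (inv_nonneg.2 hL1.le)]
        refine ENNReal.ofReal_le_ofReal ?_
        have h1 := Real.one_sub_inv_le_log_of_pos hpos
        have h2 : (laplaceTransform σ (Real.exp (-s)))⁻¹ ≤ (laplaceTransform σ 1)⁻¹ :=
          inv_anti₀ hL1 hmono
        have h3 : (laplaceTransform σ (Real.exp (-s)))⁻¹ - 1
            = (laplaceTransform σ (Real.exp (-s)))⁻¹ * (1 - laplaceTransform σ (Real.exp (-s))) := by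
          field_simp
        nlinarith
    _ = ENNReal.ofReal (laplaceTransform σ 1)⁻¹ * ∫⁻ x, logKernel x ∂σ := by
        rw [lintegral_const_mul' _ _ ENNReal.ofReal_ne_top, lintegral_one_sub_laplaceTransform h]
    _ ≤ ENNReal.ofReal (laplaceTransform σ 1)⁻¹ *
          ∫⁻ x, (ENNReal.ofReal (Real.posLog x) + 1) ∂σ := by
        refine mul_le_mul_right (lintegral_mono_ae ?_) _
        filter_upwards [h.ae_nonneg] with x hx using logKernel_le hx
    _ < ∞ := by
        refine ENNReal.mul_lt_top ENNReal.ofReal_lt_top ?_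
        rw [lintegral_add_right _ measurable_const]
        simp only [lintegral_one, measure_univ]
        exact ENNReal.add_lt_top.2 ⟨hlog.lintegral_lt_top, by simp⟩

lemma measurable_posLog : Measurable Real.posLog :=
  measurable_const.max Real.measurable_log

/-- The converse direction uses `1 - L ≤ -log L` and the lower bound for `logKernel`. -/
lemma IsProbOnNonneg.integrable_posLog {σ : Measure ℝ} (h : IsProbOnNonneg σ)
    (hfin : integratedExponent σ 1 < ∞) : Integrable (fun x => Real.posLog x) σ := by
  have := h.1
  have hle : ∫⁻ x, logKernel x ∂σ ≤ integratedExponent σ 1 := by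
    rw [← lintegral_one_sub_laplaceTransform h]
    refine setLIntegral_mono' measurableSet_Ioi fun s hs => ?_
    rw [one_mul]
    refine ENNReal.ofReal_le_ofReal ?_
    have := Real.log_le_sub_one_of_pos (h.laplaceTransform_pos (Real.exp_nonneg (-s)))
    linarith
  have hc : 0 < 1 - Real.exp (-1) := by
    rw [sub_pos, Real.exp_lt_one_iff]; norm_num
  have h1 : ENNReal.ofReal (1 - Real.exp (-1)) * ∫⁻ x, ENNReal.ofReal (Real.posLog x) ∂σ < ∞ := by
    rw [← lintegral_const_mul _ measurable_posLog.ennreal_ofReal]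
    refine lt_of_le_of_lt ?_ (hle.trans_lt hfin)
    refine lintegral_mono_ae ?_
    filter_upwards [h.ae_nonneg] with x hx using le_logKernel hx
  refine ⟨measurable_posLog.aestronglyMeasurable, ?_⟩
  rw [hasFiniteIntegral_iff_ofReal (ae_of_all _ fun x => Real.posLog_nonneg)]
  by_contra htop
  rw [not_lt_top_iff.1 htop, ENNReal.mul_top (ENNReal.ofReal_pos.2 hc).ne'] at h1
  exact absurd h1 (lt_irrefl _)

lemma IsProbOnNonneg.tendsto_laplaceExponent {σ : Measure ℝ} (h : IsProbOnNonneg σ) {u : ℕ → ℝ}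
    (hu0 : ∀ n, 0 ≤ u n) (hu : Tendsto u atTop (𝓝 0)) :
    Tendsto (fun n => laplaceExponent σ (u n)) atTop (𝓝 0) := by
  have := h.1
  have h1 : Tendsto (fun n => laplaceTransform σ (u n)) atTop (𝓝 1) := by
    have h2 : (1 : ℝ) = ∫ _, (1 : ℝ) ∂σ := by simp
    rw [h2]
    refine tendsto_integral_of_dominated_convergence (fun _ => 1) (fun n => by fun_prop)
      (integrable_const _) (fun n => ?_) (ae_of_all _ fun x => ?_)
    · filter_upwards [h.ae_nonneg] with x hx
      rw [Real.norm_of_nonneg (Real.exp_nonneg _), Real.exp_le_one_iff, neg_nonpos]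
      exact mul_nonneg (hu0 n) hx
    · have : Tendsto (fun n => -(u n * x)) atTop (𝓝 0) := by
        simpa using (hu.mul_const x).neg
      simpa [Function.comp_def] using (Real.continuous_exp.tendsto 0).comp this
  have h3 := ((Real.continuousAt_log one_ne_zero).tendsto.comp h1).neg
  simpa [laplaceExponent, Function.comp_def] using ENNReal.tendsto_ofReal h3

lemma IsProbOnNonneg.measurable_laplaceExponent_comp {σ : Measure ℝ} (h : IsProbOnNonneg σ)
    {u : ℝ} (hu : 0 ≤ u) : Measurable fun s : ℝ => laplaceExponent σ (u * Real.exp (-s)) := by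
  refine Antitone.measurable fun s t hst => ?_
  exact h.laplaceExponent_monotoneOn (mul_nonneg hu (Real.exp_nonneg _))
    (mul_nonneg hu (Real.exp_nonneg _))
    (mul_le_mul_of_nonneg_left (Real.exp_le_exp.2 (neg_le_neg hst)) hu)

lemma IsProbOnNonneg.tendsto_integratedExponent {σ : Measure ℝ} (h : IsProbOnNonneg σ)
    (hfin : integratedExponent σ 1 < ∞) :
    Tendsto (fun n : ℕ => integratedExponent σ (1 / ((n : ℝ) + 1))) atTop (𝓝 0) := by
  have hn0 : ∀ n : ℕ, 0 ≤ 1 / ((n : ℝ) + 1) := fun n => by positivity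
  have h0 : (0 : ℝ≥0∞) = ∫⁻ _ in Ioi (0 : ℝ), 0 := by simp
  rw [h0]
  refine tendsto_lintegral_of_dominated_convergence
    (fun s => laplaceExponent σ (1 * Real.exp (-s)))
    (fun n => h.measurable_laplaceExponent_comp (hn0 n))
    (fun n => ae_of_all _ fun s => ?_) hfin.ne (ae_of_all _ fun s => ?_)
  · refine h.laplaceExponent_monotoneOn (mul_nonneg (hn0 n) (Real.exp_nonneg _))
      (mul_nonneg zero_le_one (Real.exp_nonneg _))
      (mul_le_mul_of_nonneg_right ?_ (Real.exp_nonneg _))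
    rw [div_le_one (by positivity)]
    linarith [(Nat.cast_nonneg n : (0 : ℝ) ≤ n)]
  · refine h.tendsto_laplaceExponent (fun n => mul_nonneg (hn0 n) (Real.exp_nonneg _)) ?_
    simpa using (tendsto_one_div_add_atTop_nhds_zero_nat (𝕜 := ℝ)).mul_const (Real.exp (-s))

section Subordinator

variable {Ω : Type*} [MeasurableSpace Ω] {P : Measure Ω} [IsProbabilityMeasure P]
  {X : ℝ≥0 → Ω → ℝ}

/-- Convergence of the exponential functional. -/
theorem IsSubordinator.ae_pathIntegral_lt_top (hX : IsSubordinator X P) {ξ : ℝ≥0 → ℝ}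
    (hξ : ∀ t, ξ t = t) (hfin : integratedExponent (P.map (X 1)) 1 < ∞) :
    ∀ᵐ ω ∂P, pathIntegral ξ (fun t => X t ω) < ∞ := by
  refine ae_lt_top_of_tendsto_lintegral_expNeg (hX.aemeasurable_pathIntegral hξ)
    (u := fun n => ENNReal.ofReal (1 / ((n : ℝ) + 1))) (fun n => ?_) ?_
  · have : (0 : ℝ) < 1 / ((n : ℝ) + 1) := by positivity
    simpa using this
  -- By continuity of the integrated exponent at `0`, the transform of the functional at `u =
  -- 1/(n+1)` tends to `1`.
  · simp_rw [fun n : ℕ => hX.lintegral_expNeg_pathIntegral hξ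
      (show (0 : ℝ) ≤ 1 / ((n : ℝ) + 1) by positivity)]
    simpa [Function.comp_def] using (expNeg_continuous.tendsto _).comp
      ((hX.isProbOnNonneg 1).tendsto_integratedExponent hfin)

/-- The Laplace transform of the law of an almost surely finite exponential functional. -/
theorem IsSubordinator.law_pathIntegral (hX : IsSubordinator X P) {ξ : ℝ≥0 → ℝ}
    (hξ : ∀ t, ξ t = t) (hfin : ∀ᵐ ω ∂P, pathIntegral ξ (fun t => X t ω) < ∞) :
    IsProbOnNonneg (P.map fun ω => (pathIntegral ξ (fun t => X t ω)).toReal) ∧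
    ∀ u : ℝ, 0 ≤ u → ∫⁻ x, expNeg (ENNReal.ofReal (u * x))
        ∂(P.map fun ω => (pathIntegral ξ (fun t => X t ω)).toReal)
      = expNeg (integratedExponent (P.map (X 1)) u) := by
  have hm : AEMeasurable (fun ω => (pathIntegral ξ (fun t => X t ω)).toReal) P :=
    (hX.aemeasurable_pathIntegral hξ).ennreal_toReal
  refine ⟨isProbOnNonneg_map hm (ae_of_all _ fun ω => ENNReal.toReal_nonneg), fun u hu => ?_⟩
  rw [lintegral_map' (by fun_prop) hm, ← hX.lintegral_expNeg_pathIntegral hξ hu]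
  refine lintegral_congr_ae ?_
  filter_upwards [hfin] with ω hω
  rw [ENNReal.ofReal_mul hu, ENNReal.ofReal_toReal hω.ne]

end Subordinator

/-- The law of the exponential functional is determined by the Laplace exponent of `X₁`. -/
lemma IsExpFunctionalLaw.laplace {ξ : ℝ≥0 → ℝ} (hξ : ∀ t, ξ t = t) {σ μ : Measure ℝ}
    (h : IsExpFunctionalLaw ξ σ μ) : IsProbOnNonneg μ ∧ ∀ u : ℝ, 0 ≤ u →
      ∫⁻ x, expNeg (ENNReal.ofReal (u * x)) ∂μ = expNeg (integratedExponent σ u) := by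
  obtain ⟨Ω, mΩ, P, X, hP, hX, hσ, hfin, hμ⟩ := h
  subst hσ hμ
  exact hX.law_pathIntegral hξ hfin

lemma expMap_eq {ξ : ℝ≥0 → ℝ} {σ : Measure ℝ} (h : σ ∈ expDomain ξ) :
    IsExpFunctionalLaw ξ σ (expMap ξ σ) := by
  have h' : ∃ μ, IsExpFunctionalLaw ξ σ μ := h
  rw [expMap, dif_pos h']
  exact h'.choose_spec

/-! ### Lévy exponents with a density -/

/-- The Laplace exponent with drift `a` and Lévy density `g`. -/
def levyExponent (a : ℝ) (g : ℝ → ℝ) (u : ℝ) : ℝ≥0∞ :=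
  ENNReal.ofReal (a * u) +
    ∫⁻ t in Ioi (0 : ℝ), (1 - expNeg (ENNReal.ofReal (u * t))) * ENNReal.ofReal (g t)

lemma one_sub_exp_neg_le_min (t : ℝ) : 1 - Real.exp (-t) ≤ min 1 t :=
  le_min (by linarith [Real.exp_nonneg (-t)]) (by linarith [Real.add_one_le_exp (-t)])

/-- From `e^{-t} ≤ 1/(1+t)` one gets `2(1 - e^{-t}) ≥ 2t/(1+t)`, which is at least `min 1 t`. -/
lemma min_le_two_mul_one_sub_exp_neg {t : ℝ} (ht : 0 ≤ t) :
    min 1 t ≤ 2 * (1 - Real.exp (-t)) := by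
  have h1 : Real.exp (-t) ≤ (1 + t)⁻¹ := by
    rw [Real.exp_neg]
    exact inv_anti₀ (by linarith) (by linarith [Real.add_one_le_exp t])
  have h2 : min 1 t ≤ 2 * (1 - (1 + t)⁻¹) := by
    have h3 : 2 * (1 - (1 + t)⁻¹) = 2 * t / (1 + t) := by field_simp; ring
    rw [h3, le_div_iff₀ (by linarith)]
    rcases le_total 1 t with h | h
    · rw [min_eq_left h]; linarith
    · rw [min_eq_right h]; nlinarith
  linarith

lemma one_sub_exp_neg_mul_le (u : ℝ) {t : ℝ} (ht : 0 ≤ t) :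
    1 - Real.exp (-(u * t)) ≤ max 1 u * min 1 t := by
  refine (one_sub_exp_neg_le_min (u * t)).trans ?_
  rw [mul_min_of_nonneg _ _ (zero_le_one.trans (le_max_left 1 u)), mul_one]
  exact min_le_min (le_max_left _ _) (mul_le_mul_of_nonneg_right (le_max_right _ _) ht)

lemma one_sub_exp_neg_nonneg {r : ℝ} (hr : 0 ≤ r) : 0 ≤ 1 - Real.exp (-r) := by
  rw [sub_nonneg, Real.exp_le_one_iff]; linarith

section

variable {g : ℝ → ℝ} (hg : AEMeasurable g (volume.restrict (Ioi 0)))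
  (hg0 : ∀ t ∈ Ioi (0 : ℝ), 0 ≤ g t)

include hg in
lemma integrableOn_one_sub_exp_mul (hint : IntegrableOn (fun t => min 1 t * g t) (Ioi 0)) {u : ℝ}
    (hu : 0 ≤ u) : IntegrableOn (fun t => (1 - Real.exp (-(u * t))) * g t) (Ioi 0) := by
  refine Integrable.mono' (hint.norm.const_mul (max 1 u)) ?_ ?_
  · exact ((by fun_prop : Measurable fun t => 1 - Real.exp (-(u * t))).aemeasurable.mul
      hg).aestronglyMeasurable
  · filter_upwards [ae_restrict_mem measurableSet_Ioi] with t ht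
    rw [norm_mul, norm_mul, ← mul_assoc]
    refine mul_le_mul_of_nonneg_right ?_ (norm_nonneg _)
    rw [Real.norm_of_nonneg (one_sub_exp_neg_nonneg (mul_nonneg hu (le_of_lt ht))),
      Real.norm_of_nonneg (le_min zero_le_one (le_of_lt ht))]
    exact one_sub_exp_neg_mul_le u (le_of_lt ht)

lemma setLIntegral_one_sub_expNeg_mul {u : ℝ} (hu : 0 ≤ u) :
    ∫⁻ t in Ioi (0 : ℝ), (1 - expNeg (ENNReal.ofReal (u * t))) * ENNReal.ofReal (g t)
      = ∫⁻ t in Ioi (0 : ℝ), ENNReal.ofReal ((1 - Real.exp (-(u * t))) * g t) := by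
  refine setLIntegral_congr_fun measurableSet_Ioi fun t ht => ?_
  have : 0 ≤ u * t := mul_nonneg hu (le_of_lt ht)
  rw [one_sub_expNeg_ofReal this, ← ENNReal.ofReal_mul (one_sub_exp_neg_nonneg this)]

include hg hg0 in
lemma levyExponent_eq_ofReal {a : ℝ} (ha : 0 ≤ a)
    (hint : IntegrableOn (fun t => min 1 t * g t) (Ioi 0)) {u : ℝ} (hu : 0 ≤ u) :
    levyExponent a g u
      = ENNReal.ofReal (a * u + ∫ t in Ioi (0 : ℝ), (1 - Real.exp (-(u * t))) * g t) ∧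
    0 ≤ a * u + ∫ t in Ioi (0 : ℝ), (1 - Real.exp (-(u * t))) * g t := by
  have hnn : ∀ t ∈ Ioi (0 : ℝ), 0 ≤ (1 - Real.exp (-(u * t))) * g t := fun t ht =>
    mul_nonneg (one_sub_exp_neg_nonneg (mul_nonneg hu (le_of_lt ht))) (hg0 t ht)
  have hI : 0 ≤ ∫ t in Ioi (0 : ℝ), (1 - Real.exp (-(u * t))) * g t :=
    setIntegral_nonneg measurableSet_Ioi hnn
  refine ⟨?_, add_nonneg (mul_nonneg ha hu) hI⟩
  rw [levyExponent, setLIntegral_one_sub_expNeg_mul hu,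
    ENNReal.ofReal_add (mul_nonneg ha hu) hI,
    ofReal_integral_eq_lintegral_ofReal (integrableOn_one_sub_exp_mul hg hint hu)]
  filter_upwards [ae_restrict_mem measurableSet_Ioi] with t ht using hnn t ht

include hg hg0 in
lemma integrableOn_min_mul_iff {a : ℝ} : IntegrableOn (fun t => min 1 t * g t) (Ioi 0) ↔
    levyExponent a g 1 < ∞ := by
  have h1 : levyExponent a g 1 < ∞ ↔
      ∫⁻ t in Ioi (0 : ℝ), ENNReal.ofReal ((1 - Real.exp (-(1 * t))) * g t) < ∞ := by
    rw [levyExponent, setLIntegral_one_sub_expNeg_mul zero_le_one, ENNReal.add_lt_top]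
    simp
  rw [h1]
  have hnn : ∀ᵐ t ∂(volume.restrict (Ioi (0 : ℝ))), 0 ≤ min 1 t * g t := by
    filter_upwards [ae_restrict_mem measurableSet_Ioi] with t ht
    exact mul_nonneg (le_min zero_le_one (le_of_lt ht)) (hg0 t ht)
  constructor
  · intro h
    exact ((integrableOn_one_sub_exp_mul hg h zero_le_one).lintegral_lt_top)
  · intro h
    refine ⟨((by fun_prop : Measurable fun t : ℝ => min 1 t).aemeasurable.mul
      hg).aestronglyMeasurable, ?_⟩
    rw [hasFiniteIntegral_iff_ofReal hnn]
    calc ∫⁻ t in Ioi (0 : ℝ), ENNReal.ofReal (min 1 t * g t)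
        ≤ ∫⁻ t in Ioi (0 : ℝ), 2 * ENNReal.ofReal ((1 - Real.exp (-(1 * t))) * g t) := by
          refine setLIntegral_mono' measurableSet_Ioi fun t ht => ?_
          rw [← ENNReal.ofReal_ofNat 2, ← ENNReal.ofReal_mul zero_le_two, one_mul, ← mul_assoc]
          exact ENNReal.ofReal_le_ofReal (mul_le_mul_of_nonneg_right
            (min_le_two_mul_one_sub_exp_neg (le_of_lt ht)) (hg0 t ht))
      _ = 2 * ∫⁻ t in Ioi (0 : ℝ), ENNReal.ofReal ((1 - Real.exp (-(1 * t))) * g t) :=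
          lintegral_const_mul' _ _ (by simp)
      _ < ∞ := ENNReal.mul_lt_top (by simp) h

end

/-- Integrability of `min(1,t) k(t)/t` becomes finiteness of the exponent at `u = 1`. Every later
argument uses this form, free of Bochner integrals. -/
lemma hasLevyDensityForm_iff {μ : Measure ℝ} (hμ : IsProbOnNonneg μ) {a : ℝ} {k : ℝ → ℝ}
    (hk : AEMeasurable (fun t => k t / t) (volume.restrict (Ioi 0)))
    (hk0 : ∀ t ∈ Ioi (0 : ℝ), 0 ≤ k t / t) :
    HasLevyDensityForm μ a k ↔ 0 ≤ a ∧ levyExponent a (fun t => k t / t) 1 < ∞ ∧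
      ∀ u : ℝ, 0 ≤ u → ∫⁻ x, expNeg (ENNReal.ofReal (u * x)) ∂μ
        = expNeg (levyExponent a (fun t => k t / t) u) := by
  unfold HasLevyDensityForm
  rw [← integrableOn_min_mul_iff hk hk0]
  refine and_congr_right fun ha => and_congr_right fun hint => ?_
  refine forall_congr' fun u => imp_congr_right fun hu => ?_
  obtain ⟨h1, h2⟩ := levyExponent_eq_ofReal hk hk0 ha hint hu
  rw [h1, expNeg_ofReal h2, ← ofReal_laplaceTransform hμ hu,
    ENNReal.ofReal_eq_ofReal_iff (hμ.laplaceTransform_pos hu).le (Real.exp_nonneg _)]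

lemma levyExponent_congr {a : ℝ} {g g' : ℝ → ℝ} (h : ∀ t ∈ Ioi (0 : ℝ), g t = g' t) (u : ℝ) :
    levyExponent a g u = levyExponent a g' u := by
  rw [levyExponent, levyExponent]
  congr 1
  exact setLIntegral_congr_fun measurableSet_Ioi fun t ht => by simp only [h t ht]

/-- The substitution `w = t e^{-s}` maps `(0,∞)` onto `(0,t)` with `|dw| = w ds`, which is the
source of the factor `1/w` in the new Lévy density. -/
lemma setLIntegral_exp_neg_scale {F : ℝ → ℝ≥0∞} {t : ℝ} (ht : 0 < t) :
    ∫⁻ s in Ioi (0 : ℝ), F (t * Real.exp (-s)) = ∫⁻ w in Ioo 0 t, ENNReal.ofReal w⁻¹ * F w := by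
  have himg : (fun s => t * Real.exp (-s)) '' Ioi 0 = Ioo 0 t := by
    ext w
    simp only [mem_image, mem_Ioi, mem_Ioo]
    constructor
    · rintro ⟨s, hs, rfl⟩
      refine ⟨by positivity, ?_⟩
      have : Real.exp (-s) < 1 := Real.exp_lt_one_iff.2 (neg_lt_zero.2 hs)
      nlinarith
    · rintro ⟨hw0, hwt⟩
      refine ⟨Real.log (t / w), Real.log_pos ((one_lt_div hw0).2 hwt), ?_⟩
      rw [Real.exp_neg, Real.exp_log (by positivity)]
      field_simp
  rw [← himg, lintegral_image_eq_lintegral_abs_deriv_mul measurableSet_Ioi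
    (f' := fun s => t * (Real.exp (-s) * (-1)))]
  · refine setLIntegral_congr_fun measurableSet_Ioi fun s _ => ?_
    have hpos : 0 < t * Real.exp (-s) := by positivity
    have h1 : |t * (Real.exp (-s) * (-1))| = t * Real.exp (-s) := by
      rw [mul_neg_one, mul_neg, abs_neg, abs_of_pos hpos]
    simp only [h1]
    rw [← mul_assoc, ← ENNReal.ofReal_mul hpos.le, mul_inv_cancel₀ hpos.ne']
    simp
  · intro s _
    exact (((hasDerivAt_neg s).exp).const_mul t).hasDerivWithinAt
  · intro s _ s' _ h
    have := mul_left_cancel₀ ht.ne' h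
    simpa using Real.exp_injective this

/-- The Lévy density of `∫_0^∞ e^{-s} dX_s` in terms of the one of `X`. -/
lemma setLIntegral_levyExponent (a : ℝ) {g : ℝ → ℝ}
    (hg : AEMeasurable g (volume.restrict (Ioi 0))) (u : ℝ) :
    ∫⁻ s in Ioi (0 : ℝ), levyExponent a g (u * Real.exp (-s))
      = ENNReal.ofReal (a * u) + ∫⁻ w in Ioi (0 : ℝ), (1 - expNeg (ENNReal.ofReal (u * w))) *
          (ENNReal.ofReal w⁻¹ * ∫⁻ t in Ioi w, ENNReal.ofReal (g t)) := by
  have hgE : AEMeasurable (fun t => ENNReal.ofReal (g t)) (volume.restrict (Ioi (0 : ℝ))) :=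
    hg.ennreal_ofReal
  set F : ℝ → ℝ≥0∞ := fun w => 1 - expNeg (ENNReal.ofReal (u * w)) with hF
  have hFm : Measurable F := by fun_prop
  unfold levyExponent
  rw [lintegral_add_left (by fun_prop)]
  congr 1
  · have h1 : ∫⁻ s in Ioi (0 : ℝ), ENNReal.ofReal (Real.exp (-s)) = 1 := by
      rw [← ofReal_integral_eq_lintegral_ofReal (integrableOn_exp_neg_Ioi 0)
        (ae_of_all _ fun s => Real.exp_nonneg _), integral_exp_neg_Ioi]
      simp
    simp_rw [fun s : ℝ => show a * (u * Real.exp (-s)) = Real.exp (-s) * (a * u) by ring,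
      fun s : ℝ => ENNReal.ofReal_mul (q := a * u) (Real.exp_nonneg (-s))]
    rw [lintegral_mul_const _ (by fun_prop), h1, one_mul]
  · rw [lintegral_lintegral_swap (by
      exact AEMeasurable.mul (Measurable.aemeasurable (by fun_prop)) hgE.comp_snd)]
    calc ∫⁻ t in Ioi (0 : ℝ), ∫⁻ s in Ioi (0 : ℝ),
          (1 - expNeg (ENNReal.ofReal (u * Real.exp (-s) * t))) * ENNReal.ofReal (g t)
        = ∫⁻ t in Ioi (0 : ℝ), ∫⁻ w in Ioi (0 : ℝ),
            (Iio t).indicator 1 w * (ENNReal.ofReal w⁻¹ * F w) * ENNReal.ofReal (g t) := by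
          refine setLIntegral_congr_fun measurableSet_Ioi fun t ht => ?_
          have h1 : ∀ s : ℝ, 1 - expNeg (ENNReal.ofReal (u * Real.exp (-s) * t))
              = F (t * Real.exp (-s)) := by
            intro s; simp only [hF]; congr 3; ring
          simp_rw [h1]
          rw [lintegral_mul_const' _ _ ENNReal.ofReal_ne_top,
            lintegral_mul_const' _ _ ENNReal.ofReal_ne_top, setLIntegral_exp_neg_scale ht]
          congr 1
          rw [← Ioi_inter_Iio, inter_comm, ← Measure.restrict_restrict measurableSet_Iio,
            ← lintegral_indicator measurableSet_Iio]
          refine lintegral_congr fun w => ?_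
          by_cases hw : w ∈ Iio t
          · simp [hw]
          · simp [hw]
      -- Tonelli on the region `w < t`, encoded by an indicator so that both integrals run over
      -- `(0,∞)`.
      _ = ∫⁻ w in Ioi (0 : ℝ), ∫⁻ t in Ioi (0 : ℝ),
            (Iio t).indicator 1 w * (ENNReal.ofReal w⁻¹ * F w) * ENNReal.ofReal (g t) := by
          rw [lintegral_lintegral_swap]
          refine AEMeasurable.mul (Measurable.aemeasurable ?_) hgE.comp_fst
          refine Measurable.mul ?_ (by fun_prop)
          have : (fun z : ℝ × ℝ => (Iio z.1).indicator (1 : ℝ → ℝ≥0∞) z.2)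
              = {z : ℝ × ℝ | z.2 < z.1}.indicator 1 := by
            ext z
            simp [indicator]
          rw [this]
          exact measurable_one.indicator (measurableSet_lt measurable_snd measurable_fst)
      _ = _ := by
          refine setLIntegral_congr_fun measurableSet_Ioi fun w hw => ?_
          have h2 : Ioi w ∩ Ioi 0 = Ioi w := inter_eq_left.2 (Ioi_subset_Ioi (le_of_lt hw))
          have h3 : ∫⁻ t in Ioi w, ENNReal.ofReal (g t)
              = ∫⁻ t in Ioi 0, (Ioi w).indicator (fun t => ENNReal.ofReal (g t)) t := by
            rw [lintegral_indicator measurableSet_Ioi, Measure.restrict_restrict measurableSet_Ioi,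
              h2]
          rw [← mul_assoc, mul_comm (1 - _) _, h3,
            ← lintegral_const_mul'' _ (hgE.indicator measurableSet_Ioi)]
          refine lintegral_congr fun t => ?_
          by_cases htw : w < t
          · simp [htw, hF]
          · simp [htw]

/-! ### Completely monotone functions -/

namespace IsCompletelyMonotone

variable {k : ℝ → ℝ}

lemma nonneg (hk : IsCompletelyMonotone k) {t : ℝ} (ht : 0 < t) : 0 ≤ k t := by
  simpa using hk.2 0 t ht

lemma continuousOn (hk : IsCompletelyMonotone k) : ContinuousOn k (Ioi 0) := hk.1.continuousOn

lemma aemeasurable (hk : IsCompletelyMonotone k) : AEMeasurable k (volume.restrict (Ioi 0)) :=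
  hk.continuousOn.aemeasurable measurableSet_Ioi

lemma hasDerivAt (hk : IsCompletelyMonotone k) {t : ℝ} (ht : 0 < t) :
    HasDerivAt k (deriv k t) t :=
  ((hk.1.differentiableOn (by simp)).differentiableAt (Ioi_mem_nhds ht)).hasDerivAt

lemma neg_deriv (hk : IsCompletelyMonotone k) : IsCompletelyMonotone fun t => -deriv k t := by
  have heq : EqOn (fun t => -deriv k t) (-derivWithin k (Ioi 0)) (Ioi 0) := fun t ht => by
    simp [derivWithin_of_isOpen isOpen_Ioi ht]
  refine ⟨?_, fun n t ht => ?_⟩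
  · exact ((contDiffOn_infty_iff_derivWithin (uniqueDiffOn_Ioi 0)).1 hk.1).2.neg.congr heq
  · rw [iteratedDerivWithin_congr heq ht, iteratedDerivWithin_neg]
    have := hk.2 (n + 1) t ht
    rw [iteratedDerivWithin_succ', pow_succ] at this
    linarith

lemma of_hasDerivAt {g : ℝ → ℝ} (hg : IsCompletelyMonotone g)
    (hd : ∀ t, 0 < t → HasDerivAt k (-g t) t) (h0 : ∀ t, 0 < t → 0 ≤ k t) :
    IsCompletelyMonotone k := by
  have heq : EqOn (derivWithin k (Ioi 0)) (-g) (Ioi 0) := fun t ht => by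
    rw [derivWithin_of_isOpen isOpen_Ioi ht, (hd t ht).deriv]; rfl
  refine ⟨?_, fun n t ht => ?_⟩
  · refine (contDiffOn_infty_iff_derivWithin (uniqueDiffOn_Ioi 0)).2 ⟨fun t ht =>
      (hd t ht).differentiableAt.differentiableWithinAt, hg.1.neg.congr heq⟩
  · cases n with
    | zero => simpa using h0 t ht
    | succ n =>
      rw [iteratedDerivWithin_succ', iteratedDerivWithin_congr heq ht, iteratedDerivWithin_neg,
        pow_succ]
      have := hg.2 n t ht
      linarith

lemma deriv_nonpos (hk : IsCompletelyMonotone k) {t : ℝ} (ht : 0 < t) : deriv k t ≤ 0 := by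
  have := hk.neg_deriv.nonneg ht
  linarith

lemma antitoneOn (hk : IsCompletelyMonotone k) : AntitoneOn k (Ioi 0) := by
  refine antitoneOn_of_deriv_nonpos (convex_Ioi 0) hk.continuousOn ?_ ?_
  · rw [interior_Ioi]
    exact hk.1.differentiableOn (by simp)
  · rw [interior_Ioi]
    exact fun t ht => hk.deriv_nonpos ht

/-- If `k` stayed above some `ε > 0`, integrability of `k(t)/t` would make `1/t` integrable on
`(1,∞)`. Once below `ε`, `k` remains there by monotonicity. -/
lemma tendsto_atTop (hk : IsCompletelyMonotone k)
    (hint : IntegrableOn (fun t => k t / t) (Ioi 1)) : Tendsto k atTop (𝓝 0) := by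
  have key : ∀ ε > 0, ∃ T > 0, k T < ε := by
    intro ε hε
    by_contra! hcon
    refine not_integrableOn_Ioi_inv (a := 1) ?_
    refine Integrable.mono' (hint.const_mul ε⁻¹)
      (measurable_inv.aestronglyMeasurable) ?_
    filter_upwards [ae_restrict_mem measurableSet_Ioi] with t ht
    have ht0 : (0 : ℝ) < t := zero_lt_one.trans ht
    rw [Real.norm_of_nonneg (inv_nonneg.2 ht0.le), inv_mul_eq_div, div_div, mul_comm t ε,
      ← div_div, inv_eq_one_div]
    refine div_le_div_of_nonneg_right ?_ ht0.le
    rw [one_le_div hε]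
    exact hcon t ht0
  rw [Metric.tendsto_atTop]
  intro ε hε
  obtain ⟨T, hT, hTε⟩ := key ε hε
  refine ⟨T, fun t ht => ?_⟩
  have ht0 : 0 < t := hT.trans_le ht
  rw [Real.dist_eq, sub_zero, abs_of_nonneg (hk.nonneg ht0)]
  exact (hk.antitoneOn hT ht0 ht).trans_lt hTε

lemma integrableOn_neg_deriv (hk : IsCompletelyMonotone k) (h0 : Tendsto k atTop (𝓝 0)) {w : ℝ}
    (hw : 0 < w) : IntegrableOn (fun t => -deriv k t) (Ioi w) :=
  (integrableOn_Ioi_deriv_of_nonpos' (fun _ ht => hk.hasDerivAt (hw.trans_le ht))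
    (fun _ ht => hk.deriv_nonpos (hw.trans ht)) h0).neg

lemma setIntegral_neg_deriv (hk : IsCompletelyMonotone k) (h0 : Tendsto k atTop (𝓝 0)) {w : ℝ}
    (hw : 0 < w) : ∫ t in Ioi w, -deriv k t = k w := by
  rw [integral_neg, integral_Ioi_of_hasDerivAt_of_nonpos'
    (fun _ ht => hk.hasDerivAt (hw.trans_le ht)) (fun _ ht => hk.deriv_nonpos (hw.trans ht)) h0]
  ring

lemma ofReal_setIntegral (hk : IsCompletelyMonotone k) {w : ℝ} (hw : 0 < w)
    (hint : IntegrableOn k (Ioi w)) :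
    ENNReal.ofReal (∫ t in Ioi w, k t) = ∫⁻ t in Ioi w, ENNReal.ofReal (k t) := by
  rw [ofReal_integral_eq_lintegral_ofReal hint]
  filter_upwards [ae_restrict_mem measurableSet_Ioi] with t ht using hk.nonneg (hw.trans ht)

lemma setLIntegral_neg_deriv (hk : IsCompletelyMonotone k) (h0 : Tendsto k atTop (𝓝 0)) {w : ℝ}
    (hw : 0 < w) : ∫⁻ t in Ioi w, ENNReal.ofReal (-deriv k t) = ENNReal.ofReal (k w) := by
  rw [← hk.neg_deriv.ofReal_setIntegral hw (hk.integrableOn_neg_deriv h0 hw),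
    hk.setIntegral_neg_deriv h0 hw]

/-- The function `-k'` is integrable on `(1,∞)`, where it dominates `-k'(t)/t`, so the decay
criterion applies to `-k'`. This allows iteration over all derivatives. -/
lemma tendsto_neg_deriv (hk : IsCompletelyMonotone k) (h0 : Tendsto k atTop (𝓝 0)) :
    Tendsto (fun t => -deriv k t) atTop (𝓝 0) := by
  refine hk.neg_deriv.tendsto_atTop ?_
  refine Integrable.mono' (hk.integrableOn_neg_deriv h0 zero_lt_one) ?_ ?_
  · exact ((hk.neg_deriv.aemeasurable.mono_measure
      (Measure.restrict_mono (Ioi_subset_Ioi zero_le_one) le_rfl)).div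
        measurable_id.aemeasurable).aestronglyMeasurable
  · filter_upwards [ae_restrict_mem measurableSet_Ioi] with t ht
    have ht0 : (0 : ℝ) < t := zero_lt_one.trans ht
    rw [Real.norm_of_nonneg (div_nonneg (hk.neg_deriv.nonneg ht0) ht0.le)]
    exact div_le_self (hk.neg_deriv.nonneg ht0) (le_of_lt ht)

end IsCompletelyMonotone

/-! ### Tail integrals and the exponents they generate. -/

lemma hasDerivAt_setIntegral_Ioi {g : ℝ → ℝ} (hg : ContinuousOn g (Ioi 0))
    (hint : ∀ w, 0 < w → IntegrableOn g (Ioi w)) {w : ℝ} (hw : 0 < w) :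
    HasDerivAt (fun w => ∫ t in Ioi w, g t) (-g w) w := by
  -- The base point `w/2` keeps the integration away from `0`, where `g` need not be integrable.
  have hc : 0 < w / 2 := by positivity
  have hcw : w / 2 < w := half_lt_self hw
  have hii : ∀ v, w / 2 ≤ v → IntervalIntegrable g volume (w / 2) v := fun v hv =>
    (intervalIntegrable_iff_integrableOn_Ioc_of_le hv).2 ((hint _ hc).mono_set Ioc_subset_Ioi_self)
  have h1 : HasDerivAt (fun v => ∫ t in (w / 2)..v, g t) (g w) w := by
    refine intervalIntegral.integral_hasDerivAt_right (hii w hcw.le) ?_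
      (hg.continuousAt (Ioi_mem_nhds hw))
    exact hg.stronglyMeasurableAtFilter isOpen_Ioi w hw
  have h2 : (fun v => ∫ t in Ioi v, g t) =ᶠ[𝓝 w]
      fun v => (∫ t in Ioi (w / 2), g t) - ∫ t in (w / 2)..v, g t := by
    filter_upwards [Ioi_mem_nhds hcw] with v hv
    rw [← intervalIntegral.integral_interval_add_Ioi (hint _ hc) (hint _ (hc.trans hv))]
    ring
  exact (h1.const_sub _).congr_of_eventuallyEq h2

/-- The tail integral of a completely monotone function is completely monotone. -/
lemma IsCompletelyMonotone.tail {g : ℝ → ℝ} (hg : IsCompletelyMonotone g)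
    (hint : ∀ w, 0 < w → IntegrableOn g (Ioi w)) :
    IsCompletelyMonotone fun w => ∫ t in Ioi w, g t :=
  IsCompletelyMonotone.of_hasDerivAt hg
    (fun _ hw => hasDerivAt_setIntegral_Ioi hg.continuousOn hint hw)
    (fun _ hw => setIntegral_nonneg measurableSet_Ioi fun _ ht => hg.nonneg (hw.trans ht))

lemma integrableOn_Ioi_of_min_mul {g : ℝ → ℝ} (hg : IsCompletelyMonotone g)
    (hint : IntegrableOn (fun t => min 1 t * g t) (Ioi 0)) {w : ℝ} (hw : 0 < w) :
    IntegrableOn g (Ioi w) := by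
  have hm : 0 < min 1 w := lt_min zero_lt_one hw
  have hsub : Ioi w ⊆ Ioi 0 := Ioi_subset_Ioi hw.le
  refine Integrable.mono' ((hint.mono_set hsub).const_mul (min 1 w)⁻¹)
    (hg.aemeasurable.mono_measure (Measure.restrict_mono hsub le_rfl)).aestronglyMeasurable ?_
  filter_upwards [ae_restrict_mem measurableSet_Ioi] with t ht
  have hg0 := hg.nonneg (hw.trans ht)
  rw [Real.norm_of_nonneg hg0, inv_mul_eq_div, le_div_iff₀ hm, mul_comm]
  exact mul_le_mul_of_nonneg_right (min_le_min_left 1 (le_of_lt ht)) hg0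

/-- The only relation between `g` and `K` is the tail identity. It is used with `K` defined as the
tail of `g`, and with `g = -k'` and `K = k`. -/
lemma setLIntegral_levyExponent_of_tail (a : ℝ) {g K : ℝ → ℝ} (hg : IsCompletelyMonotone g)
    (hK : ∀ w, 0 < w → ∫⁻ t in Ioi w, ENNReal.ofReal (g t) = ENNReal.ofReal (K w)) (u : ℝ) :
    ∫⁻ s in Ioi (0 : ℝ), levyExponent a g (u * Real.exp (-s))
      = levyExponent a (fun w => K w / w) u := by
  rw [setLIntegral_levyExponent a hg.aemeasurable u, levyExponent]
  congr 1
  refine setLIntegral_congr_fun measurableSet_Ioi fun w hw => ?_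
  rw [hK w hw, ← ENNReal.ofReal_mul (inv_nonneg.2 (le_of_lt hw)), inv_mul_eq_div]

/-- The constant `2/v` comes from `v (1 - e^{-t}) ≤ v min(1,t) ≤ min(1,vt) ≤ 2(1 - e^{-vt})`. -/
lemma levyExponent_one_lt_top {a : ℝ} {g : ℝ → ℝ} {v : ℝ} (hv0 : 0 < v) (hv1 : v ≤ 1)
    (h : levyExponent a g v < ∞) : levyExponent a g 1 < ∞ := by
  rw [levyExponent, ENNReal.add_lt_top] at h ⊢
  refine ⟨ENNReal.ofReal_lt_top, ?_⟩
  calc ∫⁻ t in Ioi (0 : ℝ), (1 - expNeg (ENNReal.ofReal (1 * t))) * ENNReal.ofReal (g t)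
      ≤ ∫⁻ t in Ioi (0 : ℝ), ENNReal.ofReal (2 / v) *
          ((1 - expNeg (ENNReal.ofReal (v * t))) * ENNReal.ofReal (g t)) := by
        refine setLIntegral_mono' measurableSet_Ioi fun t ht => ?_
        have ht0 : 0 ≤ t := le_of_lt ht
        rw [one_mul, ← mul_assoc, one_sub_expNeg_ofReal ht0,
          one_sub_expNeg_ofReal (mul_nonneg hv0.le ht0), ← ENNReal.ofReal_mul (show 0 ≤ 2 / v by positivity)]
        gcongr
        have h1 := one_sub_exp_neg_le_min t
        have h2 := min_le_two_mul_one_sub_exp_neg (mul_nonneg hv0.le ht0)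
        have h3 : v * min 1 t ≤ min 1 (v * t) := by
          rw [mul_min_of_nonneg _ _ hv0.le, mul_one]
          exact min_le_min_right _ hv1
        rw [div_mul_eq_mul_div, le_div_iff₀ hv0]
        nlinarith
    _ = ENNReal.ofReal (2 / v) * ∫⁻ t in Ioi (0 : ℝ),
          (1 - expNeg (ENNReal.ofReal (v * t))) * ENNReal.ofReal (g t) :=
        lintegral_const_mul' _ _ ENNReal.ofReal_ne_top
    _ < ∞ := ENNReal.mul_lt_top ENNReal.ofReal_lt_top h.2

/-- A finite integral forces `ψ(e^{-s}) < ∞` at some `s > 0`, and finiteness at one point of `(0,1]`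
gives finiteness at `1`. -/
lemma levyExponent_one_lt_top_of_setLIntegral {a : ℝ} {g : ℝ → ℝ}
    (hg : AEMeasurable g (volume.restrict (Ioi 0)))
    (h : ∫⁻ s in Ioi (0 : ℝ), levyExponent a g (1 * Real.exp (-s)) < ∞) :
    levyExponent a g 1 < ∞ := by
  have hm : AEMeasurable (fun s : ℝ => levyExponent a g (1 * Real.exp (-s)))
      (volume.restrict (Ioi 0)) := by
    unfold levyExponent
    refine AEMeasurable.add (f := fun s => ENNReal.ofReal (a * (1 * Real.exp (-s))))
      (Measurable.aemeasurable (by fun_prop)) ?_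
    refine AEMeasurable.lintegral_prod_right'
      (f := fun z : ℝ × ℝ => (1 - expNeg (ENNReal.ofReal (1 * Real.exp (-z.1) * z.2))) *
        ENNReal.ofReal (g z.2)) ?_
    exact AEMeasurable.mul (Measurable.aemeasurable (by fun_prop)) hg.comp_snd.ennreal_ofReal
  have hae := ae_lt_top' hm h.ne
  have hne : (ae (volume.restrict (Ioi (0 : ℝ)))).NeBot := by
    rw [ae_neBot]
    rw [Ne, Measure.restrict_eq_zero]
    simp
  obtain ⟨s, hs, hs0⟩ := (hae.and (ae_restrict_mem measurableSet_Ioi)).exists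
  rw [one_mul] at hs
  exact levyExponent_one_lt_top (Real.exp_pos _)
    (Real.exp_le_one_iff.2 (neg_nonpos.2 (le_of_lt hs0))) hs

/-! ### Infinite divisibility -/

lemma IsProbOnNonneg.conv {τ ν : Measure ℝ} (hτ : IsProbOnNonneg τ) (hν : IsProbOnNonneg ν) :
    IsProbOnNonneg (Measure.conv τ ν) := by
  have := hτ.1
  have := hν.1
  refine isProbOnNonneg_map (P := τ.prod ν) (by fun_prop) ?_
  filter_upwards [Measure.quasiMeasurePreserving_fst.ae hτ.ae_nonneg,
    Measure.quasiMeasurePreserving_snd.ae hν.ae_nonneg] with z h1 h2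
  exact add_nonneg h1 h2

lemma lintegral_expNeg_conv {τ ν : Measure ℝ} (hτ : IsProbOnNonneg τ) (hν : IsProbOnNonneg ν)
    {u : ℝ} (hu : 0 ≤ u) : ∫⁻ x, expNeg (ENNReal.ofReal (u * x)) ∂(Measure.conv τ ν)
      = (∫⁻ x, expNeg (ENNReal.ofReal (u * x)) ∂τ) *
        ∫⁻ x, expNeg (ENNReal.ofReal (u * x)) ∂ν := by
  have := hτ.1
  have := hν.1
  rw [Measure.lintegral_conv (by fun_prop), ← lintegral_mul_const _ (by fun_prop)]
  refine lintegral_congr_ae ?_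
  filter_upwards [hτ.ae_nonneg] with x hx
  rw [← lintegral_const_mul _ (by fun_prop)]
  refine lintegral_congr_ae ?_
  filter_upwards [hν.ae_nonneg] with y hy
  rw [← expNeg_add, ← ENNReal.ofReal_add (mul_nonneg hu hx) (mul_nonneg hu hy), mul_add]

lemma isProbOnNonneg_dirac_zero : IsProbOnNonneg (Measure.dirac 0) :=
  ⟨inferInstance, by rw [Measure.dirac_apply' _ measurableSet_Iio]; simp⟩

lemma convPow_succ (ν : Measure ℝ) (n : ℕ) :
    convPow ν (n + 1) = Measure.conv (convPow ν n) ν := by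
  rw [convPow, Function.iterate_succ_apply']
  rfl

lemma IsProbOnNonneg.convPow {ν : Measure ℝ} (hν : IsProbOnNonneg ν) (n : ℕ) :
    IsProbOnNonneg (convPow ν n) := by
  induction n with
  | zero => exact isProbOnNonneg_dirac_zero
  | succ n ih => rw [convPow_succ]; exact ih.conv hν

lemma lintegral_expNeg_convPow {ν : Measure ℝ} (hν : IsProbOnNonneg ν) (n : ℕ) {u : ℝ}
    (hu : 0 ≤ u) : ∫⁻ x, expNeg (ENNReal.ofReal (u * x)) ∂(convPow ν n)
      = (∫⁻ x, expNeg (ENNReal.ofReal (u * x)) ∂ν) ^ n := by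
  induction n with
  | zero =>
    change ∫⁻ x, expNeg (ENNReal.ofReal (u * x)) ∂(Measure.dirac 0) = _
    rw [lintegral_dirac' _ (by fun_prop)]
    simp
  | succ n ih => rw [convPow_succ, lintegral_expNeg_conv (hν.convPow n) hν hu, ih, pow_succ]

lemma expNeg_natCast_mul (n : ℕ) (x : ℝ≥0∞) : expNeg (n * x) = expNeg x ^ n := by
  have := expNeg_sum (Finset.range n) fun _ => x
  simpa using this

/-- The marginals of a subordinator are infinitely divisible. -/
theorem IsSubordinator.isInfinitelyDivisible {Ω : Type*} [MeasurableSpace Ω] {P : Measure Ω}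
    [IsProbabilityMeasure P] {X : ℝ≥0 → Ω → ℝ} (hX : IsSubordinator X P) :
    IsInfinitelyDivisible (P.map (X 1)) := by
  intro n hn
  have hν := hX.isProbOnNonneg ((n : ℝ≥0)⁻¹)
  refine ⟨P.map (X (n : ℝ≥0)⁻¹), hν.1, (hν.convPow n).ext (hX.isProbOnNonneg 1) fun u hu => ?_⟩
  rw [lintegral_expNeg_convPow hν n hu, lintegral_map (by fun_prop) (hX.measurable _),
    lintegral_map (by fun_prop) (hX.measurable _), hX.lintegral_expNeg hu,
    hX.lintegral_expNeg hu, ← expNeg_natCast_mul, ← mul_assoc]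
  congr 2
  have hn' : (n : ℝ≥0) ≠ 0 := by exact_mod_cast hn.ne'
  rw [← ENNReal.coe_natCast, ← ENNReal.coe_mul, mul_inv_cancel₀ hn']

/-! ### Subordinators with a Lévy density -/

/-- Existence of a subordinator with given drift and Lévy density. -/
theorem exists_isSubordinator_levyExponent {a : ℝ} (ha : 0 ≤ a) {g : ℝ → ℝ}
    (hg : AEMeasurable g (volume.restrict (Ioi 0))) (hfin : levyExponent a g 1 < ∞) :
    ∃ (Ω : Type) (_ : MeasurableSpace Ω) (P : Measure Ω) (X : ℝ≥0 → Ω → ℝ),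
      IsProbabilityMeasure P ∧ IsSubordinator X P ∧ ∀ u : ℝ, 0 ≤ u →
        ∫⁻ x, expNeg (ENNReal.ofReal (u * x)) ∂(P.map (X 1)) = expNeg (levyExponent a g u) := by
  set Λ : Measure ℝ := (volume.restrict (Ioi 0)).withDensity fun t => ENNReal.ofReal (g t)
  have hΛ : ∀ u : ℝ≥0, u * (a.toNNReal : ℝ≥0∞) + jumpExponent Λ u = levyExponent a g u := by
    intro u
    rw [jumpExponent, lintegral_withDensity_eq_lintegral_mul₀ hg.ennreal_ofReal
      (Measurable.aemeasurable (by fun_prop)), levyExponent]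
    congr 1
    · rw [mul_comm, ENNReal.ofReal_mul ha, ENNReal.ofReal_coe_nnreal]
      rfl
    · refine lintegral_congr fun t => ?_
      rw [Pi.mul_apply, ENNReal.ofReal_mul u.coe_nonneg, ENNReal.ofReal_coe_nnreal, mul_comm]
  have hΛ1 : jumpExponent Λ 1 ≠ ∞ := by
    have h1 : jumpExponent Λ 1 ≤ levyExponent a g 1 := by
      have := hΛ 1
      push_cast at this
      rw [← this]
      exact le_add_self
    exact (h1.trans_lt hfin).ne
  obtain ⟨Ω, mΩ, P, X, hP, hX, hL⟩ := exists_isSubordinator a.toNNReal Λ hΛ1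
  refine ⟨Ω, mΩ, P, X, hP, hX, fun u hu => ?_⟩
  lift u to ℝ≥0 using hu
  rw [lintegral_map (by fun_prop) (hX.measurable 1)]
  have := hL 1 u
  rw [ENNReal.coe_one, one_mul, hΛ] at this
  rw [← this]
  simp_rw [ENNReal.ofReal_mul u.coe_nonneg, ENNReal.ofReal_coe_nnreal]

lemma IsProbOnNonneg.laplaceExponent_eq {σ : Measure ℝ} (hσ : IsProbOnNonneg σ) {a : ℝ}
    {g : ℝ → ℝ} (hL : ∀ u : ℝ, 0 ≤ u →
      ∫⁻ x, expNeg (ENNReal.ofReal (u * x)) ∂σ = expNeg (levyExponent a g u)) {u : ℝ}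
    (hu : 0 ≤ u) : laplaceExponent σ u = levyExponent a g u :=
  expNeg_strictAnti.injective (by rw [hσ.expNeg_laplaceExponent hu, hL u hu])

lemma IsProbOnNonneg.integratedExponent_eq {σ : Measure ℝ} (hσ : IsProbOnNonneg σ) {a : ℝ}
    {g : ℝ → ℝ} (hL : ∀ u : ℝ, 0 ≤ u →
      ∫⁻ x, expNeg (ENNReal.ofReal (u * x)) ∂σ = expNeg (levyExponent a g u)) {u : ℝ}
    (hu : 0 ≤ u) :
    integratedExponent σ u = ∫⁻ s in Ioi (0 : ℝ), levyExponent a g (u * Real.exp (-s)) :=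
  lintegral_congr fun _ => hσ.laplaceExponent_eq hL (mul_nonneg hu (Real.exp_nonneg _))

/-- The subordinator built from the data `(a, g)` has `X₁` distributed as `σ`, by uniqueness of
Laplace transforms. -/
lemma mem_expDomain {ξ : ℝ≥0 → ℝ} (hξ : ∀ t, ξ t = t) {σ : Measure ℝ} (hσ : IsProbOnNonneg σ)
    {a : ℝ} (ha : 0 ≤ a) {g : ℝ → ℝ} (hg : AEMeasurable g (volume.restrict (Ioi 0)))
    (hfin : levyExponent a g 1 < ∞) (hL : ∀ u : ℝ, 0 ≤ u →
      ∫⁻ x, expNeg (ENNReal.ofReal (u * x)) ∂σ = expNeg (levyExponent a g u))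
    (hlog : integratedExponent σ 1 < ∞) : σ ∈ expDomain ξ := by
  obtain ⟨Ω, mΩ, P, X, hP, hX, hXL⟩ := exists_isSubordinator_levyExponent ha hg hfin
  have hXσ : P.map (X 1) = σ := (hX.isProbOnNonneg 1).ext hσ fun u hu => by rw [hXL u hu, hL u hu]
  exact ⟨_, Ω, mΩ, P, X, hP, hX, hXσ, hX.ae_pathIntegral_lt_top hξ (by rwa [hXσ]), rfl⟩

/-! ### The mapping between the Bondesson and the Thorin class -/

lemma IsCompletelyMonotone.congr {k k' : ℝ → ℝ} (hk : IsCompletelyMonotone k)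
    (h : EqOn k' k (Ioi 0)) : IsCompletelyMonotone k' :=
  ⟨hk.1.congr h, fun n t ht => by rw [iteratedDerivWithin_congr h ht]; exact hk.2 n t ht⟩

/-! ### From `BO` to `T`: passing to the tail of the Lévy density. -/

section Bondesson

variable {ξ : ℝ≥0 → ℝ} {σ : Measure ℝ} {a : ℝ} {k : ℝ → ℝ}

lemma mem_expDomain_of_bondesson (hξ : ∀ t, ξ t = t) (hσ : IsProbOnNonneg σ)
    (hk : IsCompletelyMonotone fun t => k t / t) (hf : HasLevyDensityForm σ a k)
    (hlog : Integrable (fun x => Real.posLog x) σ) : σ ∈ expDomain ξ := by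
  obtain ⟨ha, hfin, hL⟩ := (hasLevyDensityForm_iff hσ hk.aemeasurable
    fun t ht => hk.nonneg ht).1 hf
  exact mem_expDomain hξ hσ ha hk.aemeasurable hfin hL (hσ.integratedExponent_lt_top hlog)

lemma hasLevyDensityForm_expMap (hξ : ∀ t, ξ t = t) (hσ : IsProbOnNonneg σ)
    (hk : IsCompletelyMonotone fun t => k t / t) (hf : HasLevyDensityForm σ a k)
    (hlog : Integrable (fun x => Real.posLog x) σ) :
    IsProbOnNonneg (expMap ξ σ) ∧ IsCompletelyMonotone (fun w => ∫ t in Ioi w, k t / t) ∧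
      HasLevyDensityForm (expMap ξ σ) a (fun w => ∫ t in Ioi w, k t / t) := by
  have hk0 : ∀ t ∈ Ioi (0 : ℝ), 0 ≤ k t / t := fun t ht => hk.nonneg ht
  obtain ⟨ha, hfin, hL⟩ := (hasLevyDensityForm_iff hσ hk.aemeasurable hk0).1 hf
  have hint : ∀ w, 0 < w → IntegrableOn (fun t => k t / t) (Ioi w) := fun w hw =>
    integrableOn_Ioi_of_min_mul hk hf.2.1 hw
  have hK := hk.tail hint
  obtain ⟨hμ, hμL⟩ := (expMap_eq (mem_expDomain_of_bondesson hξ hσ hk hf hlog)).laplace hξ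
  have htr := setLIntegral_levyExponent_of_tail a hk
    (fun w hw => (hk.ofReal_setIntegral hw (hint w hw)).symm)
  have hIE : ∀ u : ℝ, 0 ≤ u → integratedExponent σ u
      = levyExponent a (fun w => (∫ t in Ioi w, k t / t) / w) u := fun u hu => by
    rw [hσ.integratedExponent_eq hL hu, htr]
  refine ⟨hμ, hK, (hasLevyDensityForm_iff hμ ?_ ?_).2 ⟨ha, ?_, fun u hu => ?_⟩⟩
  · exact hK.aemeasurable.div measurable_id.aemeasurable
  · exact fun w hw => div_nonneg (hK.nonneg hw) (le_of_lt hw)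
  · rw [← hIE 1 zero_le_one]
    exact hσ.integratedExponent_lt_top hlog
  · rw [hμL u hu, hIE u hu]

end Bondesson

/-! ### From `T` to `BO`: differentiating `k`. -/

section Thorin

variable {μ : Measure ℝ} {a : ℝ} {k : ℝ → ℝ}

lemma tendsto_atTop_of_hasLevyDensityForm (hk : IsCompletelyMonotone k)
    (hf : HasLevyDensityForm μ a k) : Tendsto k atTop (𝓝 0) := by
  refine hk.tendsto_atTop ((hf.2.1.mono_set (Ioi_subset_Ioi zero_le_one)).congr_fun ?_
    measurableSet_Ioi)
  intro t ht
  simp only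
  rw [min_eq_left (le_of_lt ht), one_mul]

/-- Every generalized gamma convolution is the law of an exponential functional. -/
lemma exists_bondesson_of_thorin {ξ : ℝ≥0 → ℝ} (hξ : ∀ t, ξ t = t) (hμ : IsProbOnNonneg μ)
    (hk : IsCompletelyMonotone k) (hf : HasLevyDensityForm μ a k) :
    ∃ σ ∈ bondessonClass ∩ infDivLog, expMap ξ σ = μ ∧
      ∀ u : ℝ, 0 ≤ u → ∫⁻ x, expNeg (ENNReal.ofReal (u * x)) ∂σ
        = expNeg (levyExponent a (fun t => -deriv k t) u) := by
  have h0 := tendsto_atTop_of_hasLevyDensityForm hk hf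
  obtain ⟨ha, hfin, hL⟩ := (hasLevyDensityForm_iff hμ
    (hk.aemeasurable.div measurable_id.aemeasurable)
    (fun w hw => div_nonneg (hk.nonneg hw) (le_of_lt hw))).1 hf
  have hg := hk.neg_deriv
  have htr := setLIntegral_levyExponent_of_tail a hg (fun w hw => hk.setLIntegral_neg_deriv h0 hw)
  -- The exponent of `μ` is the integrated exponent of the data `(a, -k')`, so its finiteness passes
  -- to the latter and the subordinator exists.
  have hgfin : levyExponent a (fun t => -deriv k t) 1 < ∞ :=
    levyExponent_one_lt_top_of_setLIntegral hg.aemeasurable (by rwa [htr])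
  obtain ⟨Ω, mΩ, P, X, hP, hX, hXL⟩ := exists_isSubordinator_levyExponent ha hg.aemeasurable hgfin
  have hσ := hX.isProbOnNonneg 1
  have hIE : ∀ u : ℝ, 0 ≤ u → integratedExponent (P.map (X 1)) u
      = levyExponent a (fun w => k w / w) u := fun u hu => by
    rw [hσ.integratedExponent_eq hXL hu, htr]
  have hlog : integratedExponent (P.map (X 1)) 1 < ∞ := by rwa [hIE 1 zero_le_one]
  -- The class `BO` writes a Lévy density as a quotient by `t`, so the density `-k'` is presented
  -- through `t · (-k'(t))`.
  have heq : EqOn (fun t => t * -deriv k t / t) (fun t => -deriv k t) (Ioi 0) := fun t ht =>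
    mul_div_cancel_left₀ _ (ne_of_gt ht)
  have hcm : IsCompletelyMonotone fun t => t * -deriv k t / t := hg.congr heq
  refine ⟨P.map (X 1), ⟨⟨hσ, a, fun t => t * -deriv k t, hcm, ?_⟩, hσ.1,
    hX.isInfinitelyDivisible, hσ.integrable_posLog hlog⟩, ?_, hXL⟩
  · rw [hasLevyDensityForm_iff hσ hcm.aemeasurable fun t ht => hcm.nonneg ht]
    simp_rw [levyExponent_congr heq]
    exact ⟨ha, hgfin, hXL⟩
  · obtain ⟨hν, hνL⟩ := (expMap_eq (mem_expDomain hξ hσ ha hg.aemeasurable hgfin hXL hlog)).laplace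
      hξ
    exact hν.ext hμ fun u hu => by rw [hνL u hu, hIE u hu, hL u hu]

end Thorin

/-! ### Bernstein's theorem for bounded completely monotone functions -/

lemma setLIntegral_Ioo_pow_div_factorial (n : ℕ) {t s : ℝ} (hts : t < s) :
    ∫⁻ r in Ioo t s, ENNReal.ofReal ((s - r) ^ n / n.factorial)
      = ENNReal.ofReal ((s - t) ^ (n + 1) / (n + 1).factorial) := by
  rw [setLIntegral_congr Ioo_ae_eq_Ioc, ← ofReal_integral_eq_lintegral_ofReal]
  · rw [← intervalIntegral.integral_of_le hts.le, intervalIntegral.integral_div,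
      intervalIntegral.integral_comp_sub_left (fun x => x ^ n) s, integral_pow]
    congr 1
    rw [Nat.factorial_succ]
    push_cast
    rw [sub_self]
    field_simp
    simp
  · exact (by fun_prop : Continuous fun r => (s - r) ^ n / (n.factorial : ℝ)).integrableOn_Ioc
  · filter_upwards [ae_restrict_mem measurableSet_Ioc] with r hr
    have : 0 ≤ s - r := sub_nonneg.2 hr.2
    positivity

/-- The Taylor remainder representation of a completely monotone function vanishing at `∞`. -/
lemma IsCompletelyMonotone.exists_eq_setLIntegral_pow (n : ℕ) {k : ℝ → ℝ}
    (hk : IsCompletelyMonotone k) (h0 : Tendsto k atTop (𝓝 0)) :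
    ∃ h : ℝ → ℝ≥0∞, AEMeasurable h (volume.restrict (Ioi 0)) ∧ ∀ t, 0 < t →
      ENNReal.ofReal (k t)
        = ∫⁻ s in Ioi t, ENNReal.ofReal ((s - t) ^ n / n.factorial) * h s := by
  induction n generalizing k with
  | zero =>
    refine ⟨fun t => ENNReal.ofReal (-deriv k t), hk.neg_deriv.aemeasurable.ennreal_ofReal,
      fun t ht => ?_⟩
    rw [← hk.setLIntegral_neg_deriv h0 ht]
    simp
  | succ n ih =>
    -- Insert the representation of `-k'` into `k(t) = ∫_t^∞ -k'(r) dr`. After Tonelli, integrating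
    -- `(s-r)^n/n!` over `t < r < s` raises the order by one.
    obtain ⟨h, hm, hh⟩ := ih hk.neg_deriv (hk.tendsto_neg_deriv h0)
    refine ⟨h, hm, fun t ht => ?_⟩
    have hmt : AEMeasurable h (volume.restrict (Ioi t)) :=
      hm.mono_measure (Measure.restrict_mono (Ioi_subset_Ioi ht.le) le_rfl)
    calc ENNReal.ofReal (k t)
        = ∫⁻ r in Ioi t, ∫⁻ s in Ioi r, ENNReal.ofReal ((s - r) ^ n / n.factorial) * h s := by
          rw [← hk.setLIntegral_neg_deriv h0 ht]
          exact setLIntegral_congr_fun measurableSet_Ioi fun r hr => hh r (ht.trans hr)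
      _ = ∫⁻ r in Ioi t, ∫⁻ s in Ioi t,
            (Iio s).indicator 1 r * ENNReal.ofReal ((s - r) ^ n / n.factorial) * h s := by
          refine setLIntegral_congr_fun measurableSet_Ioi fun r hr => ?_
          have h2 : Ioi r ∩ Ioi t = Ioi r := inter_eq_left.2 (Ioi_subset_Ioi (le_of_lt hr))
          rw [← h2, ← Measure.restrict_restrict measurableSet_Ioi,
            ← lintegral_indicator measurableSet_Ioi]
          refine lintegral_congr fun s => ?_
          by_cases hs : r < s
          · simp [hs]
          · simp [hs]
      _ = ∫⁻ s in Ioi t, ∫⁻ r in Ioi t,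
            (Iio s).indicator 1 r * ENNReal.ofReal ((s - r) ^ n / n.factorial) * h s := by
          rw [lintegral_lintegral_swap]
          refine AEMeasurable.mul (Measurable.aemeasurable ?_) hmt.comp_snd
          refine Measurable.mul ?_ (by fun_prop)
          have : (fun z : ℝ × ℝ => (Iio z.2).indicator (1 : ℝ → ℝ≥0∞) z.1)
              = {z : ℝ × ℝ | z.1 < z.2}.indicator 1 := by
            ext z
            simp [indicator]
          rw [this]
          exact measurable_one.indicator (measurableSet_lt measurable_fst measurable_snd)
      _ = _ := by
          refine setLIntegral_congr_fun measurableSet_Ioi fun s hs => ?_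
          have hmr : Measurable fun r : ℝ =>
              (Iio s).indicator 1 r * ENNReal.ofReal ((s - r) ^ n / n.factorial) :=
            (measurable_one.indicator measurableSet_Iio).mul (by fun_prop)
          rw [lintegral_mul_const _ hmr, ← setLIntegral_Ioo_pow_div_factorial n hs,
            ← Ioi_inter_Iio, inter_comm, ← Measure.restrict_restrict measurableSet_Iio,
            ← lintegral_indicator measurableSet_Iio]
          congr 1
          refine lintegral_congr fun r => ?_
          by_cases hr : r < s
          · simp [hr]
          · simp [hr]

lemma max_one_sub_div_pow_le_exp_neg {n : ℕ} (hn : n ≠ 0) (z : ℝ) :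
    (max 0 (1 - z / n)) ^ n ≤ Real.exp (-z) := by
  have hn0 : (0 : ℝ) < n := by positivity
  rcases le_total z n with h | h
  · rw [max_eq_right (by rw [sub_nonneg, div_le_one hn0]; exact h)]
    exact Real.one_sub_div_pow_le_exp_neg h
  · rw [max_eq_left (by rw [sub_nonpos, one_le_div hn0]; exact h), zero_pow hn]
    exact Real.exp_nonneg _

/-- For `z ≤ n`, Bernoulli gives `1 - z²/n ≤ (1 - (z/n)²)ⁿ`, and `1 + z/n ≤ e^{z/n}` bounds this by
`(1 - z/n)ⁿ e^z`. The error `e^{-z} z²/n` is at most `2/n` because `z²/2 ≤ e^z`. -/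
lemma exp_neg_le_max_one_sub_div_pow_add {n : ℕ} (hn : n ≠ 0) {z : ℝ} (hz : 0 ≤ z) :
    Real.exp (-z) ≤ (max 0 (1 - z / n)) ^ n + 2 / n := by
  have hn1 : (1 : ℝ) ≤ n := by exact_mod_cast Nat.one_le_iff_ne_zero.2 hn
  have hn0 : (0 : ℝ) < n := by linarith
  have hquad : Real.exp (-z) * z ^ 2 ≤ 2 := by
    have := Real.quadratic_le_exp_of_nonneg hz
    rw [Real.exp_neg, inv_mul_eq_div, div_le_iff₀ (Real.exp_pos z)]
    linarith
  have hstep : Real.exp (-z) * (z ^ 2 / n) ≤ 2 / n := by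
    rw [← mul_div_assoc]
    exact div_le_div_of_nonneg_right hquad hn0.le
  suffices h : Real.exp (-z) * (1 - z ^ 2 / n) ≤ (max 0 (1 - z / n)) ^ n by linarith
  rcases le_total z n with h | h
  · have hzn : z / n ≤ 1 := by rw [div_le_one hn0]; exact h
    have hzn0 : 0 ≤ z / n := by positivity
    have hb : 0 ≤ 1 - z / n := by linarith
    rw [max_eq_right hb]
    have h1 : 1 - z ^ 2 / n ≤ (1 - (z / n) ^ 2) ^ n := by
      have := one_add_mul_le_pow (a := -(z / n) ^ 2) (by nlinarith) n
      calc 1 - z ^ 2 / n = 1 + n * (-(z / n) ^ 2) := by field_simp; ring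
        _ ≤ _ := by rwa [← sub_eq_add_neg] at this
    have h2 : (1 - (z / n) ^ 2) ^ n ≤ ((1 - z / n) * Real.exp (z / n)) ^ n := by
      refine pow_le_pow_left₀ (by nlinarith) ?_ n
      have := Real.add_one_le_exp (z / n)
      nlinarith
    have h3 : Real.exp (z / n) ^ n = Real.exp z := by
      rw [← Real.exp_nat_mul]
      congr 1; field_simp
    calc Real.exp (-z) * (1 - z ^ 2 / n)
        ≤ Real.exp (-z) * ((1 - z / n) * Real.exp (z / n)) ^ n :=
          mul_le_mul_of_nonneg_left (h1.trans h2) (Real.exp_nonneg _)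
      _ = (1 - z / n) ^ n := by
          rw [mul_pow, h3, mul_comm, mul_assoc, ← Real.exp_add, add_neg_cancel, Real.exp_zero,
            mul_one]
  · refine le_trans ?_ (pow_nonneg (le_max_left _ _) n)
    refine mul_nonpos_of_nonneg_of_nonpos (Real.exp_nonneg _) ?_
    rw [sub_nonpos, one_le_div hn0]
    nlinarith

/-- Finite measures of mass `k(0+)` whose Laplace transforms approximate `k`. -/
lemma IsCompletelyMonotone.exists_approx {k : ℝ → ℝ} (hk : IsCompletelyMonotone k)
    (h0 : Tendsto k atTop (𝓝 0)) {L : ℝ} (hL : Tendsto k (𝓝[>] 0) (𝓝 L)) {n : ℕ} (hn : n ≠ 0) :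
    ∃ ν : Measure ℝ≥0∞, ν univ = ENNReal.ofReal L ∧ ∀ t : ℝ, 0 < t →
      ENNReal.ofReal (k t) ≤ ∫⁻ y, expNeg (ENNReal.ofReal t * y) ∂ν ∧
      ∫⁻ y, expNeg (ENNReal.ofReal t * y) ∂ν
        ≤ ENNReal.ofReal (k t) + ENNReal.ofReal (2 / n) * ENNReal.ofReal L := by
  have hn0 : (0 : ℝ) < n := by positivity
  obtain ⟨h, hm, hh⟩ := hk.exists_eq_setLIntegral_pow n h0
  -- Moving `s^n` from `(s-t)^n` into the density leaves the kernel `(1 - t/s)₊^n`, which increases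
  -- to `1` as `t ↓ 0`.
  set d : ℝ → ℝ≥0∞ := fun s => ENNReal.ofReal (s ^ n / n.factorial) * h s with hd
  have hdm : AEMeasurable d (volume.restrict (Ioi 0)) :=
    AEMeasurable.mul (Measurable.aemeasurable (by fun_prop)) hm
  have hkt : ∀ t : ℝ, 0 < t → ENNReal.ofReal (k t)
      = ∫⁻ s in Ioi (0 : ℝ), d s * ENNReal.ofReal ((max 0 (1 - t / s)) ^ n) := by
    intro t ht
    have h2 : Ioi t ∩ Ioi 0 = Ioi t := inter_eq_left.2 (Ioi_subset_Ioi ht.le)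
    rw [hh t ht, ← h2, ← Measure.restrict_restrict measurableSet_Ioi,
      ← lintegral_indicator measurableSet_Ioi]
    refine setLIntegral_congr_fun measurableSet_Ioi fun s hs => ?_
    have hs0 : (0 : ℝ) < s := hs
    by_cases hts : t < s
    · have h1 : 0 ≤ 1 - t / s := by
        rw [sub_nonneg, div_le_one hs0]; exact hts.le
      rw [indicator_of_mem (mem_Ioi.2 hts), max_eq_right h1, hd, mul_right_comm,
        ← ENNReal.ofReal_mul (by positivity)]
      congr 2
      rw [div_mul_eq_mul_div, ← mul_pow, mul_sub, mul_one, mul_div_cancel₀ _ hs0.ne']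
    · have h1 : 1 - t / s ≤ 0 := by
        rw [sub_nonpos, one_le_div hs0]; exact not_lt.1 hts
      rw [indicator_of_notMem (by simpa using hts), max_eq_left h1, zero_pow hn]
      simp
  -- Monotone convergence along `t = 1/(j+1)` identifies the mass of `d` with `k(0+)`.
  have hmass : ∫⁻ s in Ioi (0 : ℝ), d s = ENNReal.ofReal L := by
    set τ : ℕ → ℝ := fun j => 1 / ((j : ℝ) + 1) with hτ
    have hτ0 : ∀ j, 0 < τ j := fun j => by positivity
    have hτlim : Tendsto τ atTop (𝓝 0) := tendsto_one_div_add_atTop_nhds_zero_nat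
    have hτanti : Antitone τ := fun i j hij => by
      have : (i : ℝ) ≤ j := by exact_mod_cast hij
      exact one_div_le_one_div_of_le (by positivity) (by linarith)
    have h1 : Tendsto (fun j => ENNReal.ofReal (k (τ j))) atTop (𝓝 (ENNReal.ofReal L)) :=
      ENNReal.tendsto_ofReal (hL.comp (tendsto_nhdsWithin_iff.2
        ⟨hτlim, Eventually.of_forall hτ0⟩))
    simp_rw [fun j => hkt (τ j) (hτ0 j)] at h1
    refine tendsto_nhds_unique ?_ h1
    refine lintegral_tendsto_of_tendsto_of_monotone (fun j => ?_) ?_ ?_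
    · exact hdm.mul (Measurable.aemeasurable (by fun_prop))
    · filter_upwards [ae_restrict_mem measurableSet_Ioi] with s hs i j hij
      have hs0 : (0 : ℝ) < s := hs
      have := hτanti hij
      simp only
      gcongr
    · refine ae_of_all _ fun s => ?_
      have h3 : Tendsto (fun j => (max 0 (1 - τ j / s)) ^ n) atTop (𝓝 1) := by
        have h4 : Tendsto (fun j => (max 0 (1 - τ j / s)) ^ n) atTop
            (𝓝 ((max 0 (1 - 0 / s)) ^ n)) :=
          ((tendsto_const_nhds (x := (0 : ℝ))).max
            (tendsto_const_nhds.sub (hτlim.div_const s))).pow n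
        simpa using h4
      simpa using ENNReal.Tendsto.const_mul (a := d s) (ENNReal.tendsto_ofReal h3)
        (Or.inl (by simp))
  set m : Measure ℝ := (volume.restrict (Ioi 0)).withDensity d with hmdef
  -- In the variable `y = n/s` the kernel reads `(1 - ty/n)₊^n`, within `2/n` of `e^{-ty}`.
  have hφ : Measurable fun s : ℝ => ENNReal.ofReal (n / s) := by fun_prop
  have hint : ∀ t : ℝ, 0 < t → ∫⁻ y, expNeg (ENNReal.ofReal t * y)
      ∂(m.map fun s : ℝ => ENNReal.ofReal (n / s))
      = ∫⁻ s in Ioi (0 : ℝ), d s * ENNReal.ofReal (Real.exp (-(t * (n / s)))) := by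
    intro t ht
    rw [lintegral_map (by fun_prop) hφ, hmdef, lintegral_withDensity_eq_lintegral_mul₀ hdm
      (Measurable.aemeasurable (by fun_prop))]
    refine setLIntegral_congr_fun measurableSet_Ioi fun s hs => ?_
    have hs0 : (0 : ℝ) < s := hs
    rw [Pi.mul_apply, ← ENNReal.ofReal_mul ht.le, expNeg_ofReal (by positivity)]
  refine ⟨m.map fun s : ℝ => ENNReal.ofReal (n / s), ?_, fun t ht => ?_⟩
  · rw [Measure.map_apply hφ MeasurableSet.univ, preimage_univ, hmdef,
      withDensity_apply _ MeasurableSet.univ, Measure.restrict_univ, hmass]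
  · have hz : ∀ s : ℝ, t * (n / s) / n = t / s := fun s => by field_simp
    rw [hint t ht, hkt t ht]
    constructor
    · refine lintegral_mono fun s => ?_
      gcongr
      rw [← hz s]
      exact max_one_sub_div_pow_le_exp_neg hn _
    · have hdm' : AEMeasurable (fun s => d s * ENNReal.ofReal ((max 0 (1 - t / s)) ^ n))
          (volume.restrict (Ioi 0)) := hdm.mul (Measurable.aemeasurable (by fun_prop))
      rw [← hmass, ← lintegral_const_mul' _ _ ENNReal.ofReal_ne_top, ← lintegral_add_left' hdm']
      refine setLIntegral_mono' measurableSet_Ioi fun s hs => ?_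
      have hs0 : (0 : ℝ) < s := hs
      rw [mul_comm (ENNReal.ofReal (2 / n)), ← mul_add,
        ← ENNReal.ofReal_add (by positivity) (by positivity)]
      gcongr
      rw [← hz s]
      exact exp_neg_le_max_one_sub_div_pow_add hn (by positivity)

/-- Bernstein's theorem for completely monotone functions with finite limit at `0` and limit `0`
at `∞`. -/
theorem IsCompletelyMonotone.exists_laplace {k : ℝ → ℝ} (hk : IsCompletelyMonotone k)
    (h0 : Tendsto k atTop (𝓝 0)) {L : ℝ} (hL : Tendsto k (𝓝[>] 0) (𝓝 L)) :
    ∃ ρ : Measure ℝ, IsFiniteMeasure ρ ∧ ρ (Iic 0) = 0 ∧ ∀ t : ℝ, 0 < t →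
      ∫⁻ x, expNeg (ENNReal.ofReal (t * x)) ∂ρ = ENNReal.ofReal (k t) := by
  choose ν hνm hν using fun n : ℕ => hk.exists_approx h0 hL (Nat.succ_ne_zero n)
  have hνf : ∀ n, IsFiniteMeasure (ν n) := fun n => ⟨by rw [hνm n]; exact ENNReal.ofReal_lt_top⟩
  set N : ℕ → FiniteMeasure ℝ≥0∞ := fun n => ⟨ν n, hνf n⟩ with hN
  -- On the compact space `[0,∞]` the measures of fixed mass form a compact set. A nonprincipal
  -- ultrafilter then gives a limit without extracting a subsequence.
  have hcomp := isCompact_setOfPred_finiteMeasure_eq_of_compactSpace ℝ≥0∞ L.toNNReal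
  have hmem : ∀ n, N n ∈ {μ : FiniteMeasure ℝ≥0∞ | μ.mass = L.toNNReal} := fun n => by
    rw [mem_ofPred_eq, ← ENNReal.coe_inj, FiniteMeasure.ennreal_mass]
    exact hνm n
  obtain ⟨μ, hμmass, hμ⟩ := hcomp.ultrafilter_le_nhds' ((hyperfilter ℕ : Ultrafilter ℕ).map N)
    (Ultrafilter.mem_map.2 (univ_mem' hmem))
  have hμ' : Tendsto N (hyperfilter ℕ : Ultrafilter ℕ) (𝓝 μ) := hμ
  have hle : ((hyperfilter ℕ : Ultrafilter ℕ) : Filter ℕ) ≤ atTop := by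
    rw [← Nat.cofinite_eq_atTop]
    exact hyperfilter_le_cofinite
  have hμL : ∀ t : ℝ, 0 < t →
      ∫⁻ y, expNeg (ENNReal.ofReal t * y) ∂(μ : Measure ℝ≥0∞) = ENNReal.ofReal (k t) := by
    intro t ht
    set φ : BoundedContinuousFunction ℝ≥0∞ ℝ≥0 :=
      BoundedContinuousFunction.mkOfCompact
        ⟨fun y => (expNeg (ENNReal.ofReal t * y)).toNNReal, by
          refine continuous_iff_continuousAt.2 fun y => ?_
          exact (ENNReal.tendsto_toNNReal (expNeg_ne_top _)).comp
            (expNeg_continuous.comp (ENNReal.continuous_const_mul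
              ENNReal.ofReal_ne_top)).continuousAt⟩
    have hφ : ∀ y, (φ y : ℝ≥0∞) = expNeg (ENNReal.ofReal t * y) := fun y =>
      ENNReal.coe_toNNReal (expNeg_ne_top _)
    have h1 := FiniteMeasure.tendsto_iff_forall_lintegral_tendsto.1 hμ' φ
    simp_rw [hφ] at h1
    have h2 : Tendsto (fun n => ∫⁻ y, expNeg (ENNReal.ofReal t * y) ∂(ν n)) atTop
        (𝓝 (ENNReal.ofReal (k t))) := by
      refine tendsto_of_tendsto_of_tendsto_of_le_of_le tendsto_const_nhds ?_
        (fun n => (hν n t ht).1) (fun n => (hν n t ht).2)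
      have h3 : Tendsto (fun n : ℕ => 2 / ((n.succ : ℕ) : ℝ)) atTop (𝓝 0) :=
        (tendsto_const_div_atTop_nhds_zero_nat 2).comp (tendsto_add_atTop_nat 1)
      have h4 := ENNReal.Tendsto.mul_const (b := ENNReal.ofReal L) (ENNReal.tendsto_ofReal h3)
        (Or.inr ENNReal.ofReal_ne_top)
      simpa using h4.const_add (ENNReal.ofReal (k t))
    exact tendsto_nhds_unique h1 (h2.mono_left hle)
  have huniv : (μ : Measure ℝ≥0∞) univ = ENNReal.ofReal L := by
    rw [← FiniteMeasure.ennreal_mass, hμmass]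
    rfl
  -- No mass sits at `∞`: the transform ignores that point, yet as `t ↓ 0` it tends to `k(0+) = L`,
  -- the full mass.
  have hinf : ∀ᵐ y ∂(μ : Measure ℝ≥0∞), y < ∞ := by
    have hτ0 : ∀ j : ℕ, (0 : ℝ) < 1 / ((j : ℝ) + 1) := fun j => by positivity
    refine ae_lt_top_of_tendsto_lintegral_expNeg (V := id) aemeasurable_id
      (u := fun j : ℕ => ENNReal.ofReal (1 / ((j : ℝ) + 1)))
      (fun j => (ENNReal.ofReal_pos.2 (hτ0 j)).ne') ?_
    simp only [id]
    simp_rw [fun j : ℕ => hμL _ (hτ0 j)]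
    rw [huniv]
    exact ENNReal.tendsto_ofReal (hL.comp (tendsto_nhdsWithin_iff.2
        ⟨tendsto_one_div_add_atTop_nhds_zero_nat, Eventually.of_forall hτ0⟩))
  -- An atom at `0` would be a lower bound for `k(j+1)`, which tends to `0`.
  have hzero : (μ : Measure ℝ≥0∞) {0} = 0 := by
    have h1 : ∀ j : ℕ, (μ : Measure ℝ≥0∞) {0} ≤ ENNReal.ofReal (k ((j : ℝ) + 1)) := by
      intro j
      rw [← hμL _ (by positivity : (0 : ℝ) < (j : ℝ) + 1), ← lintegral_indicator_one
        (measurableSet_singleton 0)]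
      refine lintegral_mono fun y => ?_
      by_cases hy : y = 0
      · simp [hy]
      · simp [hy]
    have h2 : Tendsto (fun j : ℕ => ENNReal.ofReal (k ((j : ℝ) + 1))) atTop (𝓝 0) := by
      have := ENNReal.tendsto_ofReal (h0.comp (tendsto_atTop_add_const_right _ (1 : ℝ)
        (tendsto_natCast_atTop_atTop (R := ℝ))))
      simpa [Function.comp_def] using this
    exact le_antisymm (ge_of_tendsto' h2 h1) bot_le
  refine ⟨(μ : Measure ℝ≥0∞).map ENNReal.toReal, inferInstance, ?_, fun t ht => ?_⟩
  · rw [Measure.map_apply ENNReal.measurable_toReal measurableSet_Iic]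
    have hz : ∀ᵐ y ∂(μ : Measure ℝ≥0∞), y ≠ 0 := by
      rw [ae_iff]
      simpa using hzero
    have : ∀ᵐ y ∂(μ : Measure ℝ≥0∞), y ∉ ENNReal.toReal ⁻¹' Iic 0 := by
      filter_upwards [hinf, hz] with y hy1 hy2
      simpa using ENNReal.toReal_pos hy2 hy1.ne
    simp only [ae_iff, not_not] at this
    exact this
  · rw [lintegral_map (by fun_prop) ENNReal.measurable_toReal, ← hμL t ht]
    refine lintegral_congr_ae ?_
    filter_upwards [hinf] with y hy
    rw [ENNReal.ofReal_mul ht.le, ENNReal.ofReal_toReal hy.ne]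

/-! ### Finite Stieltjes measures -/

lemma ae_pos_of_measure_Iic_eq_zero {ρ : Measure ℝ} (h : ρ (Iic 0) = 0) : ∀ᵐ x ∂ρ, 0 < x := by
  rw [ae_iff]
  simp only [not_lt]
  exact h

/-- The jump part of an exponent is `o(u)`, so the linear growth of an exponent reveals its drift.
Domination is by `min(1,t) |g(t)|`. -/
lemma tendsto_setIntegral_one_sub_exp_div {g : ℝ → ℝ}
    (hg : AEMeasurable g (volume.restrict (Ioi 0)))
    (hint : IntegrableOn (fun t => min 1 t * g t) (Ioi 0)) :
    Tendsto (fun n : ℕ => (∫ t in Ioi (0 : ℝ), (1 - Real.exp (-(((n : ℝ) + 1) * t))) * g t) /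
      ((n : ℝ) + 1)) atTop (𝓝 0) := by
  have h := tendsto_integral_of_dominated_convergence (μ := volume.restrict (Ioi (0 : ℝ)))
    (F := fun (n : ℕ) t => (1 - Real.exp (-(((n : ℝ) + 1) * t))) * g t / ((n : ℝ) + 1))
    (f := fun _ => (0 : ℝ)) (fun t => ‖min 1 t * g t‖) (fun n => ?_) hint.norm (fun n => ?_) ?_
  · simpa only [integral_div, integral_zero] using h
  · exact (((by fun_prop : Measurable fun t => 1 - Real.exp (-(((n : ℝ) + 1) * t))).aemeasurable.mul
      hg).div_const _).aestronglyMeasurable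
  · filter_upwards [ae_restrict_mem measurableSet_Ioi] with t ht
    have ht0 : 0 ≤ t := le_of_lt ht
    have hn : (0 : ℝ) < (n : ℝ) + 1 := by positivity
    rw [norm_div, norm_mul, norm_mul, Real.norm_of_nonneg hn.le, div_le_iff₀ hn,
      Real.norm_of_nonneg (one_sub_exp_neg_nonneg (mul_nonneg hn.le ht0)),
      Real.norm_of_nonneg (le_min zero_le_one ht0)]
    have h1 := one_sub_exp_neg_mul_le ((n : ℝ) + 1) ht0
    rw [max_eq_right (by linarith [n.cast_nonneg (α := ℝ)])] at h1
    calc _ ≤ ((n : ℝ) + 1) * min 1 t * ‖g t‖ := mul_le_mul_of_nonneg_right h1 (norm_nonneg _)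
      _ = _ := by ring
  · filter_upwards [ae_restrict_mem measurableSet_Ioi] with t ht
    have ht0 : 0 ≤ t := le_of_lt ht
    refine squeeze_zero_norm (a := fun n : ℕ => |g t| * (1 / ((n : ℝ) + 1))) (fun n => ?_) ?_
    · have hn : (0 : ℝ) < (n : ℝ) + 1 := by positivity
      have h1 := one_sub_exp_neg_nonneg (mul_nonneg hn.le ht0)
      rw [norm_div, norm_mul, Real.norm_of_nonneg hn.le, Real.norm_of_nonneg h1, mul_one_div,
        Real.norm_eq_abs]
      gcongr
      exact mul_le_of_le_one_left (abs_nonneg _)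
        (by linarith [Real.exp_nonneg (-(((n : ℝ) + 1) * t))])
    · simpa using tendsto_one_div_add_atTop_nhds_zero_nat.const_mul |g t|

/-- A Lévy density with a finite Stieltjes measure is integrable at `0`. -/
lemma setLIntegral_lt_top_of_stieltjes {g : ℝ → ℝ} (hg : AEMeasurable g (volume.restrict (Ioi 0)))
    (hint : IntegrableOn (fun t => min 1 t * g t) (Ioi 0))
    (hg0 : ∀ t ∈ Ioi (0 : ℝ), 0 ≤ g t) {a b : ℝ} {ρ : Measure ℝ} [IsFiniteMeasure ρ]
    (h : ∀ u : ℝ, 0 ≤ u → a * u + ∫ t in Ioi (0 : ℝ), (1 - Real.exp (-(u * t))) * g t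
      = b * u + ∫ x in Ioi (0 : ℝ), u / (u + x) ∂ρ) :
    ∫⁻ t in Ioi (0 : ℝ), ENNReal.ofReal (g t) < ∞ := by
  have hS0 : ∀ u : ℝ, 0 ≤ u → 0 ≤ ∫ x in Ioi (0 : ℝ), u / (u + x) ∂ρ := fun u hu =>
    setIntegral_nonneg measurableSet_Ioi fun x hx => div_nonneg hu (add_nonneg hu (le_of_lt hx))
  have hS1 : ∀ u : ℝ, 0 ≤ u → ∫ x in Ioi (0 : ℝ), u / (u + x) ∂ρ ≤ ρ.real (Ioi 0) := by
    intro u hu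
    have := norm_setIntegral_le_of_norm_le_const (f := fun x => u / (u + x)) (C := 1)
      (measure_lt_top ρ (Ioi 0)) fun x hx => by
        have hx0 : (0 : ℝ) < x := hx
        rw [Real.norm_of_nonneg (by positivity), div_le_one (by positivity)]
        linarith
    rw [one_mul] at this
    exact (le_abs_self _).trans this
  -- Dividing the identity by `u` and letting `u → ∞` compares drifts, since the Stieltjes term is
  -- nonnegative. It follows that the jump part is at most the mass of `ρ`.
  have hba : b ≤ a := by
    rw [← sub_nonpos]
    refine ge_of_tendsto' (tendsto_setIntegral_one_sub_exp_div hg hint) fun n => ?_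
    have hn : (0 : ℝ) < (n : ℝ) + 1 := by positivity
    rw [le_div_iff₀ hn]
    have h1 := h _ hn.le
    have h2 := hS0 _ hn.le
    linarith
  have hI : ∀ u : ℝ, 0 ≤ u →
      ∫ t in Ioi (0 : ℝ), (1 - Real.exp (-(u * t))) * g t ≤ ρ.real (Ioi 0) := by
    intro u hu
    have h1 := h u hu
    have h2 := hS1 u hu
    have h3 := mul_le_mul_of_nonneg_right hba hu
    linarith
  -- As `u → ∞` the factor `1 - e^{-ut}` tends to `1`, so the uniform bound on the jump parts passes
  -- to the total mass of `g`.
  have hfatou : ∫⁻ t in Ioi (0 : ℝ), ENNReal.ofReal (g t)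
      ≤ liminf (fun n : ℕ => ∫⁻ t in Ioi (0 : ℝ),
        ENNReal.ofReal ((1 - Real.exp (-((n : ℝ) * t))) * g t)) atTop := by
    refine le_trans (le_of_eq ?_) (lintegral_liminf_le' fun n =>
      ((by fun_prop : Measurable fun t => 1 - Real.exp (-((n : ℝ) * t))).aemeasurable.mul
        hg).ennreal_ofReal)
    refine setLIntegral_congr_fun measurableSet_Ioi fun t ht => ?_
    refine (Tendsto.liminf_eq (ENNReal.tendsto_ofReal ?_)).symm
    have h1 : Tendsto (fun n : ℕ => Real.exp (-((n : ℝ) * t))) atTop (𝓝 0) :=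
      Real.tendsto_exp_neg_atTop_nhds_zero.comp
        (tendsto_natCast_atTop_atTop.atTop_mul_const (show (0 : ℝ) < t from ht))
    simpa using (h1.const_sub 1).mul_const (g t)
  refine (hfatou.trans ?_).trans_lt (ENNReal.ofReal_lt_top (r := ρ.real (Ioi 0)))
  refine liminf_le_of_le (by isBoundedDefault) fun c hc => ?_
  obtain ⟨n, hn⟩ := hc.exists
  refine hn.trans ?_
  rw [← ofReal_integral_eq_lintegral_ofReal (integrableOn_one_sub_exp_mul hg hint n.cast_nonneg)]
  · exact ENNReal.ofReal_le_ofReal (hI n n.cast_nonneg)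
  · filter_upwards [ae_restrict_mem measurableSet_Ioi] with t ht
    exact mul_nonneg (one_sub_exp_neg_nonneg (mul_nonneg n.cast_nonneg (le_of_lt ht))) (hg0 t ht)

/-- The tail is decreasing and bounded by the total mass of the Lévy density, which is finite
because `ρ` is. -/
lemma exists_tendsto_tail_of_stieltjes {σ : Measure ℝ} {a b : ℝ} {k : ℝ → ℝ} {ρ : Measure ℝ}
    [IsFiniteMeasure ρ] (hk : IsCompletelyMonotone fun t => k t / t)
    (hf : HasLevyDensityForm σ a k) (hS : HasStieltjesForm σ b ρ) :
    ∃ L : ℝ, Tendsto (fun w => ∫ t in Ioi w, k t / t) (𝓝[>] 0) (𝓝 L) := by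
  have hlt := setLIntegral_lt_top_of_stieltjes hk.aemeasurable hf.2.1 (fun t ht => hk.nonneg ht)
    (a := a) (b := b) (ρ := ρ) fun u hu => by
      have := Real.exp_injective ((hf.2.2 u hu).symm.trans (hS.2.2 u hu))
      linarith
  have hint : IntegrableOn (fun t => k t / t) (Ioi 0) := by
    refine ⟨hk.aemeasurable.aestronglyMeasurable, ?_⟩
    rw [hasFiniteIntegral_iff_ofReal]
    · exact hlt
    · filter_upwards [ae_restrict_mem measurableSet_Ioi] with t ht using hk.nonneg ht
  have hK := hk.tail fun w hw => hint.mono_set (Ioi_subset_Ioi hw.le)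
  refine ⟨_, AntitoneOn.tendsto_nhdsGT hK.antitoneOn
    ⟨∫ t in Ioi 0, k t / t, ?_⟩⟩
  rintro _ ⟨w, hw, rfl⟩
  refine setIntegral_mono_set hint ?_ (Ioi_subset_Ioi (le_of_lt hw)).eventuallyLE
  filter_upwards [ae_restrict_mem measurableSet_Ioi] with t ht using hk.nonneg ht

lemma setLIntegral_Ioi_exp_neg_mul {u x : ℝ} (hu : 0 ≤ u) (hx : 0 < x) :
    ∫⁻ s in Ioi (0 : ℝ), ENNReal.ofReal (u * Real.exp (-(u * s))) * expNeg (ENNReal.ofReal (s * x))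
      = ENNReal.ofReal (u / (u + x)) := by
  have hc : -(u + x) < 0 := by linarith
  calc _ = ∫⁻ s in Ioi (0 : ℝ), ENNReal.ofReal (u * Real.exp (-(u + x) * s)) := by
        refine setLIntegral_congr_fun measurableSet_Ioi fun s hs => ?_
        have hs0 : (0 : ℝ) < s := hs
        rw [expNeg_ofReal (by positivity), ← ENNReal.ofReal_mul (by positivity), mul_assoc,
          ← Real.exp_add]
        congr 3
        ring
    _ = _ := by
        rw [← ofReal_integral_eq_lintegral_ofReal
          ((integrableOn_exp_mul_Ioi hc 0).const_mul u)
          (ae_of_all _ fun s => mul_nonneg hu (Real.exp_nonneg _)), integral_const_mul,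
          integral_exp_mul_Ioi hc]
        congr 1
        have : u + x ≠ 0 := by linarith
        simp only [mul_zero, Real.exp_zero]
        field_simp

lemma one_sub_expNeg_eq_setLIntegral {u t : ℝ} (hu : 0 ≤ u) (ht : 0 ≤ t) :
    1 - expNeg (ENNReal.ofReal (u * t))
      = ∫⁻ s in Ioo 0 t, ENNReal.ofReal (u * Real.exp (-(u * s))) := by
  have hd : ∀ s ∈ uIcc 0 t, HasDerivAt (fun s => -Real.exp (-(u * s)))
      (u * Real.exp (-(u * s))) s := fun s _ => by
    exact (((hasDerivAt_id s).const_mul u).neg.exp).neg.congr_deriv (by simp [mul_comm])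
  have hi : IntervalIntegrable (fun s => u * Real.exp (-(u * s))) volume 0 t :=
    Continuous.intervalIntegrable (by fun_prop) _ _
  rw [one_sub_expNeg_ofReal (mul_nonneg hu ht), setLIntegral_congr Ioo_ae_eq_Ioc,
    ← ofReal_integral_eq_lintegral_ofReal ((intervalIntegrable_iff_integrableOn_Ioc_of_le ht).1 hi)
      (ae_of_all _ fun s => mul_nonneg hu (Real.exp_nonneg _)),
    ← intervalIntegral.integral_of_le ht, intervalIntegral.integral_eq_sub_of_hasDerivAt hd hi]
  congr 1
  simp
  ring

/-- Integration by parts for a Lévy exponent. -/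
lemma setLIntegral_one_sub_expNeg_mul_of_tail {g K : ℝ → ℝ}
    (hg : AEMeasurable g (volume.restrict (Ioi 0)))
    (hK : ∀ w, 0 < w → ∫⁻ t in Ioi w, ENNReal.ofReal (g t) = ENNReal.ofReal (K w)) {u : ℝ}
    (hu : 0 ≤ u) :
    ∫⁻ t in Ioi (0 : ℝ), (1 - expNeg (ENNReal.ofReal (u * t))) * ENNReal.ofReal (g t)
      = ∫⁻ s in Ioi (0 : ℝ), ENNReal.ofReal (u * Real.exp (-(u * s))) * ENNReal.ofReal (K s) := by
  have hgE : AEMeasurable (fun t => ENNReal.ofReal (g t)) (volume.restrict (Ioi (0 : ℝ))) :=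
    hg.ennreal_ofReal
  set F : ℝ → ℝ≥0∞ := fun s => ENNReal.ofReal (u * Real.exp (-(u * s))) with hF
  have hFm : Measurable F := by fun_prop
  calc _ = ∫⁻ t in Ioi (0 : ℝ), ∫⁻ s in Ioi (0 : ℝ),
            (Iio t).indicator 1 s * F s * ENNReal.ofReal (g t) := by
          refine setLIntegral_congr_fun measurableSet_Ioi fun t ht => ?_
          rw [lintegral_mul_const' _ _ ENNReal.ofReal_ne_top,
            one_sub_expNeg_eq_setLIntegral hu (le_of_lt ht)]
          congr 1
          rw [← Ioi_inter_Iio, inter_comm, ← Measure.restrict_restrict measurableSet_Iio,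
            ← lintegral_indicator measurableSet_Iio]
          refine lintegral_congr fun s => ?_
          by_cases hs : s < t
          · simp [hs, hF]
          · simp [hs]
    _ = ∫⁻ s in Ioi (0 : ℝ), ∫⁻ t in Ioi (0 : ℝ),
            (Iio t).indicator 1 s * F s * ENNReal.ofReal (g t) := by
          rw [lintegral_lintegral_swap]
          refine AEMeasurable.mul (Measurable.aemeasurable ?_) hgE.comp_fst
          refine Measurable.mul ?_ (by fun_prop)
          have : (fun z : ℝ × ℝ => (Iio z.1).indicator (1 : ℝ → ℝ≥0∞) z.2)
              = {z : ℝ × ℝ | z.2 < z.1}.indicator 1 := by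
            ext z
            simp [indicator]
          rw [this]
          exact measurable_one.indicator (measurableSet_lt measurable_snd measurable_fst)
    _ = _ := by
          refine setLIntegral_congr_fun measurableSet_Ioi fun s hs => ?_
          have h2 : Ioi s ∩ Ioi 0 = Ioi s := inter_eq_left.2 (Ioi_subset_Ioi (le_of_lt hs))
          have h3 : ENNReal.ofReal (K s)
              = ∫⁻ t in Ioi 0, (Ioi s).indicator (fun t => ENNReal.ofReal (g t)) t := by
            rw [lintegral_indicator measurableSet_Ioi, Measure.restrict_restrict measurableSet_Ioi,
              h2, hK s hs]
          rw [h3, ← lintegral_const_mul'' _ (hgE.indicator measurableSet_Ioi)]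
          refine lintegral_congr fun t => ?_
          by_cases hst : s < t
          · simp [hst, hF]
          · simp [hst]

lemma isStieltjesMeasure_of_isFiniteMeasure {ρ : Measure ℝ} [IsFiniteMeasure ρ]
    (h : ρ (Iic 0) = 0) : IsStieltjesMeasure ρ := by
  refine ⟨h, ?_⟩
  calc ∫⁻ x in Ioi (0 : ℝ), ENNReal.ofReal ((1 + x)⁻¹) ∂ρ ≤ ∫⁻ _ in Ioi (0 : ℝ), 1 ∂ρ := by
        refine setLIntegral_mono' measurableSet_Ioi fun x hx => ?_
        have hx0 : (0 : ℝ) < x := hx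
        rw [ENNReal.ofReal_le_one]
        exact inv_le_one_of_one_le₀ (by linarith)
    _ < ∞ := by simp

/-- Bernstein's measure of `k` is itself the Stieltjes measure of `σ`: integrate by parts, insert
`k(s) = ∫ e^{-sx} ρ(dx)`, and use `∫_0^∞ u e^{-us} e^{-sx} ds = u/(u+x)`. -/
lemma exists_hasStieltjesForm {σ : Measure ℝ} (hσ : IsProbOnNonneg σ) {a : ℝ} (ha : 0 ≤ a)
    {k : ℝ → ℝ} (hk : IsCompletelyMonotone k) (h0 : Tendsto k atTop (𝓝 0)) {L : ℝ}
    (hL : Tendsto k (𝓝[>] 0) (𝓝 L)) (hσL : ∀ u : ℝ, 0 ≤ u →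
      ∫⁻ x, expNeg (ENNReal.ofReal (u * x)) ∂σ
        = expNeg (levyExponent a (fun t => -deriv k t) u)) :
    ∃ ρ : Measure ℝ, HasStieltjesForm σ a ρ ∧ IsFiniteMeasure ρ := by
  obtain ⟨ρ, hρ, hρ0, hρk⟩ := hk.exists_laplace h0 hL
  refine ⟨ρ, ⟨ha, isStieltjesMeasure_of_isFiniteMeasure hρ0, fun u hu => ?_⟩, hρ⟩
  have hpos := ae_pos_of_measure_Iic_eq_zero hρ0
  have hres : ρ.restrict (Ioi 0) = ρ := Measure.restrict_eq_self_of_ae_mem hpos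
  have hq0 : ∀ᵐ x ∂ρ, 0 ≤ u / (u + x) := by
    filter_upwards [hpos] with x hx
    positivity
  have hqint : Integrable (fun x => u / (u + x)) ρ := by
    refine Integrable.mono' (integrable_const 1)
      (by fun_prop : Measurable fun x : ℝ => u / (u + x)).aestronglyMeasurable ?_
    filter_upwards [hpos] with x hx
    rw [Real.norm_of_nonneg (by positivity), div_le_one (by positivity)]
    linarith
  have hI : ∫⁻ t in Ioi (0 : ℝ), (1 - expNeg (ENNReal.ofReal (u * t))) *
      ENNReal.ofReal (-deriv k t) = ENNReal.ofReal (∫ x in Ioi (0 : ℝ), u / (u + x) ∂ρ) := by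
    rw [setLIntegral_one_sub_expNeg_mul_of_tail hk.neg_deriv.aemeasurable
      (fun w hw => hk.setLIntegral_neg_deriv h0 hw) hu, hres,
      ofReal_integral_eq_lintegral_ofReal hqint hq0]
    calc _ = ∫⁻ s in Ioi (0 : ℝ), ∫⁻ x, ENNReal.ofReal (u * Real.exp (-(u * s))) *
          expNeg (ENNReal.ofReal (s * x)) ∂ρ := by
          refine setLIntegral_congr_fun measurableSet_Ioi fun s hs => ?_
          rw [lintegral_const_mul' _ _ ENNReal.ofReal_ne_top, hρk s hs]
      _ = ∫⁻ x, (∫⁻ s in Ioi (0 : ℝ), ENNReal.ofReal (u * Real.exp (-(u * s))) *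
          expNeg (ENNReal.ofReal (s * x))) ∂ρ := by
          rw [lintegral_lintegral_swap]
          exact Measurable.aemeasurable (by fun_prop)
      _ = ∫⁻ x, ENNReal.ofReal (u / (u + x)) ∂ρ := by
          refine lintegral_congr_ae ?_
          filter_upwards [hpos] with x hx using setLIntegral_Ioi_exp_neg_mul hu hx
  have hS0 : 0 ≤ ∫ x in Ioi (0 : ℝ), u / (u + x) ∂ρ := by
    rw [hres]
    exact integral_nonneg_of_ae hq0
  have h1 := ofReal_laplaceTransform hσ hu
  rw [hσL u hu, levyExponent, hI, ← ENNReal.ofReal_add (mul_nonneg ha hu) hS0,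
    expNeg_ofReal (add_nonneg (mul_nonneg ha hu) hS0)] at h1
  exact (ENNReal.ofReal_eq_ofReal_iff (hσ.laplaceTransform_pos hu).le (Real.exp_nonneg _)).1 h1

end ExpFunctional

end

/-- For `ξ_t = t`: the mapping `Φ_ξ` is defined on all of `BO ∩ ID_log` and does not depend there on
the choice of the subordinator; it maps `BO ∩ ID_log` onto `T`, and it maps the distributions in
`BO ∩ ID_log` with finite Stieltjes measure onto those in `T` with `k(0+) < ∞`. -/
theorem proposition3p3 (ξ : NNReal → ℝ) (hξ : ∀ t : NNReal, ξ t = (t : ℝ)) :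
    ExpFunctional.bondessonClass ∩ ExpFunctional.infDivLog ⊆ ExpFunctional.expDomain ξ ∧
    (∀ (Ω : Type*) [MeasurableSpace Ω] (P : MeasureTheory.Measure Ω)
      [MeasureTheory.IsProbabilityMeasure P] (X : NNReal → Ω → ℝ),
      ExpFunctional.IsSubordinator X P →
      P.map (X 1) ∈ ExpFunctional.bondessonClass ∩ ExpFunctional.infDivLog →
      (∀ᵐ ω ∂P, ExpFunctional.pathIntegral ξ (fun t => X t ω) < ⊤) ∧
      P.map (fun ω => (ExpFunctional.pathIntegral ξ (fun t => X t ω)).toReal) =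
        ExpFunctional.expMap ξ (P.map (X 1))) ∧
    ExpFunctional.expMap ξ '' (ExpFunctional.bondessonClass ∩ ExpFunctional.infDivLog) =
      ExpFunctional.thorinClass ∧
    ExpFunctional.expMap ξ '' (ExpFunctional.bondessonClassFinite ∩ ExpFunctional.infDivLog) =
      ExpFunctional.thorinClassFinite := by
  have key : ∀ σ ∈ ExpFunctional.bondessonClass ∩ ExpFunctional.infDivLog,
      σ ∈ ExpFunctional.expDomain ξ := by
    rintro σ ⟨⟨hσ, a, k, hk, hf⟩, -, -, hlog⟩
    exact ExpFunctional.mem_expDomain_of_bondesson hξ hσ hk hf hlog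
  refine ⟨key, fun Ω _ P _ X hX hσ => ?_, Set.Subset.antisymm ?_ ?_, Set.Subset.antisymm ?_ ?_⟩
  · have hfin := hX.ae_pathIntegral_lt_top hξ (hσ.1.1.integratedExponent_lt_top hσ.2.2.2)
    obtain ⟨h1, h1L⟩ := hX.law_pathIntegral hξ hfin
    obtain ⟨h2, h2L⟩ := (ExpFunctional.expMap_eq (key _ hσ)).laplace hξ
    exact ⟨hfin, h1.ext h2 fun u hu => by rw [h1L u hu, h2L u hu]⟩
  · rintro _ ⟨σ, ⟨⟨hσ, a, k, hk, hf⟩, -, -, hlog⟩, rfl⟩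
    obtain ⟨hμ, hK, hF⟩ := ExpFunctional.hasLevyDensityForm_expMap hξ hσ hk hf hlog
    exact ⟨hμ, a, _, hK, hF⟩
  · rintro μ ⟨hμ, a, k, hk, hf⟩
    obtain ⟨σ, hσ, hσμ, -⟩ := ExpFunctional.exists_bondesson_of_thorin hξ hμ hk hf
    exact ⟨σ, hσ, hσμ⟩
  · rintro _ ⟨σ, ⟨⟨⟨hσ, a, k, hk, hf⟩, b, ρ, hS, hρ⟩, -, -, hlog⟩, rfl⟩
    obtain ⟨hμ, hK, hF⟩ := ExpFunctional.hasLevyDensityForm_expMap hξ hσ hk hf hlog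
    exact ⟨hμ, a, _, hK, hF, ExpFunctional.exists_tendsto_tail_of_stieltjes hk hf hS⟩
  · rintro μ ⟨hμ, a, k, hk, hf, L, hL⟩
    -- The preimage found for surjectivity has Lévy density `-k'`, of mass `k(0+)`, so its Stieltjes
    -- measure can be taken finite.
    obtain ⟨σ, hσ, hσμ, hσL⟩ := ExpFunctional.exists_bondesson_of_thorin hξ hμ hk hf
    obtain ⟨ρ, hρ⟩ := ExpFunctional.exists_hasStieltjesForm hσ.1.1 hf.1 hk
      (ExpFunctional.tendsto_atTop_of_hasLevyDensityForm hk hf) hL hσL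
    exact ⟨σ, ⟨⟨hσ.1, a, ρ, hρ⟩, hσ.2⟩, hσμ⟩
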